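/- Let $\Gamma$ be a finite abelian group, and let $k$ be either $\mathbb{Z}$, or $\mathbb{Z}[1/2]$, where in the latter case $\#\Gamma$ is assumed to be odd. Put $R=k[\Gamma]$. Let $\mathcal{C}$ be the class of finite $R$-modules and $\mathcal{P}\subset\mathcal{C}$ the class of those of projective dimension at most $1$ over $R$. For $X,Y\in\mathcal{C}$ write $X\sim Y$ if there are isomorphic modules $M\simeq N$ in $\mathcal{C}$ and submodules $M'\subset M''\subset M$ and $N'\subset N''\subset N$ with $M',\,M/M'',\,N',\,N/N''\in\mathcal{P}$, $M''/M'\simeq X$ and $N''/N'\simeq Y$ (the isomorphism $M\simeq N$ need not respect the submodules). This is an equivalence relation, and $\mathcal{C}/{\sim}$ is a commutative monoid under direct sums. For $X\in\mathcal{C}$ let $[\omega^1(X)]$ be the class of $Y$ for any exact sequence $0\to Y\to P\to X\to 0$ with $P\in\mathcal{P}$. A finite group is called elementary if, for some prime $p$, it is the product of a $p$-group and a cyclic group. The monoid $\mathcal{Z}^{\mathrm{adm}}$ of admissible classes is the submonoid of $\mathcal{C}/{\sim}$ generated by the classes $[\omega^1(A_{I,\varphi})]$, where $I$ runs over the non-trivial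 elementary subgroups of $\Gamma$, $\varphi$ runs over $\Gamma/I$, and $$A_{I,\varphi}=k[\Gamma/I]/(1-\varphi^{-1}+\#I).$$ For a prime $p$ let $\Gamma_p$ be the maximal $p$-quotient of $\Gamma$. Let $\mathcal{T}$ be the set of tuples $(p,H,I_p^*,D_p^*)$ such that $p$ is a prime, $H\subset\Gamma$ is a subgroup with $\Gamma/H$ cyclic of order prime to $p$, and $I_p^*\subset D_p^*\subset\Gamma_p$ are subgroups with $I_p^*$ non-trivial and $D_p^*/I_p^*$ cyclic. The set $\mathcal{T}$ is finite. (1) If $\Gamma$ is cyclic or is a $p$-group for some prime $p$, then $\mathcal{Z}^{\mathrm{adm}}$ is a free commutative monoid of rank $\#\mathcal{T}$. (2) Otherwise, $\mathcal{Z}^{\mathrm{adm}}$ is not a free commutative monoid. -/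

import Mathlib

open CategoryTheory

universe u

namespace AdmissibleClasses

section Relation

variable (R : Type u) [CommRing R]

/-- The class `𝒫`: finite `R`-modules of projective dimension at most one. -/
def InP (M : Type u) [AddCommGroup M] [Module R M] : Prop :=
  Finite M ∧ HasProjectiveDimensionLE (ModuleCat.of R M) 1

/-- `X` is (isomorphic to) the filling `M'' / M'` of a sandwich `0 ⊆ M' ⊆ M'' ⊆ M`
with `M'` and `M / M''` in `𝒫`. -/
def IsFilling (X M : Type u) [AddCommGroup X] [Module R X] [AddCommGroup M] [Module R M] : Prop :=
  ∃ M' M'' : Submodule R M, M' ≤ M'' ∧ InP R M' ∧ InP R (M ⧸ M'') ∧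
    Nonempty (X ≃ₗ[R] (M'' ⧸ M'.submoduleOf M''))

/-- `X ∼ Y`: `X` and `Y` are fillings of two isomorphic finite modules. -/
def Sim (X Y : Type u) [AddCommGroup X] [Module R X] [AddCommGroup Y] [Module R Y] : Prop :=
  ∃ M N : ModuleCat.{u} R, Finite M ∧ Finite N ∧
    IsFilling R X M ∧ IsFilling R Y N ∧ Nonempty (M ≃ₗ[R] N)

/-- `Y` represents the shift `ω¹(X)`: there is an exact sequence `0 → Y → P → X → 0` with
`P` in `𝒫`. -/
def IsShift (X Y : Type u) [AddCommGroup X] [Module R X] [AddCommGroup Y] [Module R Y] : Prop :=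
  ∃ (P : ModuleCat.{u} R) (f : Y →ₗ[R] P) (g : P →ₗ[R] X), InP R P ∧
    Function.Injective f ∧ Function.Surjective g ∧ Function.Exact f g

end Relation

section Lemmas

variable {R : Type u} [CommRing R]
variable {A B C X Y Z M N W : Type u} [AddCommGroup A] [Module R A] [AddCommGroup B] [Module R B]
  [AddCommGroup C] [Module R C] [AddCommGroup X] [Module R X] [AddCommGroup Y] [Module R Y]
  [AddCommGroup Z] [Module R Z] [AddCommGroup M] [Module R M] [AddCommGroup N] [Module R N]
  [AddCommGroup W] [Module R W]

theorem InP.of_equiv (h : InP R A) (e : A ≃ₗ[R] B) : InP R B := by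
  obtain ⟨h1, h2⟩ := h
  exact ⟨Finite.of_equiv A e.toEquiv, hasProjectiveDimensionLT_of_iso e.toModuleIso 2⟩

theorem InP.of_subsingleton [Subsingleton A] : InP R A := by
  refine ⟨inferInstance, ?_⟩
  have : Limits.IsZero (ModuleCat.of R A) := ModuleCat.isZero_of_subsingleton _
  have := this.hasProjectiveDimensionLT_zero
  exact hasProjectiveDimensionLT_of_ge _ 0 2 (by omega)

theorem finite_of_exact (f : A →ₗ[R] B) (g : B →ₗ[R] C)
    (hfg : Function.Exact f g) [Finite A] [Finite C] : Finite B := by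
  have h1 : Finite (LinearMap.ker g) := by
    rw [LinearMap.exact_iff.mp hfg]
    exact Finite.of_surjective f.rangeRestrict f.surjective_rangeRestrict
  have h2 : Finite (B ⧸ LinearMap.ker g) :=
    Finite.of_equiv _ g.quotKerEquivRange.symm.toEquiv
  exact (finite_iff_addSubgroup_quotient (LinearMap.ker g).toAddSubgroup).mpr ⟨h1, h2⟩

theorem shortExact_of_exact {f : A →ₗ[R] B} {g : B →ₗ[R] C} (hf : Function.Injective f)
    (hg : Function.Surjective g) (hfg : Function.Exact f g) :
    (ShortComplex.mk (ModuleCat.ofHom f) (ModuleCat.ofHom g) (by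
      ext x; exact hfg.apply_apply_eq_zero x)).ShortExact where
  exact := (ShortComplex.ShortExact.moduleCat_exact_iff_function_exact _).mpr hfg
  mono_f := (ModuleCat.mono_iff_injective _).mpr hf
  epi_g := (ModuleCat.epi_iff_surjective _).mpr hg

theorem InP.of_exact {f : A →ₗ[R] B} {g : B →ₗ[R] C} (hf : Function.Injective f)
    (hg : Function.Surjective g) (hfg : Function.Exact f g) (hA : InP R A) (hC : InP R C) :
    InP R B := by
  have := hA.1
  have := hC.1
  exact ⟨finite_of_exact f g hfg, (shortExact_of_exact hf hg hfg).hasProjectiveDimensionLT_X₂ 2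
    hA.2 hC.2⟩

theorem InP.prod (hA : InP R A) (hB : InP R B) : InP R (A × B) :=
  InP.of_exact (f := LinearMap.inl R A B) (g := LinearMap.snd R A B) LinearMap.inl_injective
    LinearMap.snd_surjective Function.Exact.inl_snd hA hB

theorem InP.projective_ker (hB : InP R B) [Module.Projective R A] (f : A →ₗ[R] B)
    (hf : Function.Surjective f) : Module.Projective R (LinearMap.ker f) := by
  have S := shortExact_of_exact (LinearMap.ker f).subtype_injective hf
    (LinearMap.exact_subtype_ker_map f)
  have : Projective (ModuleCat.of R A) := (IsProjective.iff_projective A).mp inferInstance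
  rw [IsProjective.iff_projective, projective_iff_hasProjectiveDimensionLT_one]
  exact (S.hasProjectiveDimensionLT_X₃_iff 0 this).mp hB.2

theorem isFilling_iff : IsFilling R X M ↔ ∃ (W : ModuleCat.{u} R) (i : W →ₗ[R] M) (q : W →ₗ[R] X),
    Function.Injective i ∧ Function.Surjective q ∧ InP R (LinearMap.ker q) ∧
      InP R (M ⧸ LinearMap.range i) := by
  constructor
  · rintro ⟨M', M'', hle, h1, h2, ⟨e⟩⟩
    refine ⟨ModuleCat.of R M'', M''.subtype, e.symm.toLinearMap ∘ₗ (M'.submoduleOf M'').mkQ,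
      M''.subtype_injective, e.symm.surjective.comp (Submodule.mkQ_surjective _), ?_, ?_⟩
    · refine h1.of_equiv ((Submodule.submoduleOfEquivOfLe hle).symm.trans
        (LinearEquiv.ofEq _ _ ?_))
      rw [LinearEquiv.ker_comp, Submodule.ker_mkQ]
    · exact h2.of_equiv (Submodule.quotEquivOfEq _ _ (Submodule.range_subtype _).symm)
  · rintro ⟨W, i, q, hi, hq, h1, h2⟩
    let j := LinearEquiv.ofInjective i hi
    refine ⟨(LinearMap.ker q).map i, LinearMap.range i, LinearMap.map_le_range,
      h1.of_equiv (Submodule.equivMapOfInjective i hi _), h2, ⟨?_⟩⟩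
    have hs : Function.Surjective (q ∘ₗ j.symm.toLinearMap) := hq.comp j.symm.surjective
    refine ((LinearMap.quotKerEquivOfSurjective _ hs).symm.trans (Submodule.quotEquivOfEq _ _ ?_))
    ext ⟨x, w, rfl⟩
    have : j.symm ⟨i w, w, rfl⟩ = w := by
      rw [LinearEquiv.symm_apply_eq]; rfl
    simp [Submodule.submoduleOf, this, hi.eq_iff]

theorem IsFilling.of_equiv (h : IsFilling R X M) (e : M ≃ₗ[R] N) : IsFilling R X N := by
  rw [isFilling_iff] at h ⊢
  obtain ⟨W, i, q, hi, hq, h1, h2⟩ := h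
  refine ⟨W, e.toLinearMap ∘ₗ i, q, e.injective.comp hi, hq, h1, ?_⟩
  refine h2.of_equiv (Submodule.Quotient.equiv _ _ e ?_)
  rw [LinearMap.range_comp]

theorem IsFilling.of_surjective (h : IsFilling R X M) (r : N →ₗ[R] M) (hr : Function.Surjective r)
    (hk : InP R (LinearMap.ker r)) : IsFilling R X N := by
  rw [isFilling_iff] at h ⊢
  obtain ⟨W, i, q, hi, hq, h1, h2⟩ := h
  let V : Submodule R N := (LinearMap.range i).comap r
  let j := LinearEquiv.ofInjective i hi
  let s : V →ₗ[R] W := j.symm.toLinearMap ∘ₗ r.restrict (p := V) (q := LinearMap.range i)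
    (fun x hx => hx)
  have hs : ∀ v : V, i (s v) = r v := fun v => by
    have : j (s v) = ⟨r v, v.2⟩ := by
      simp only [s, LinearMap.comp_apply, LinearEquiv.coe_coe, LinearEquiv.apply_symm_apply]; rfl
    exact congrArg Subtype.val this
  have hss : Function.Surjective s := fun w => by
    obtain ⟨n, hn⟩ := hr (i w)
    refine ⟨⟨n, w, hn.symm⟩, hi ?_⟩
    rw [hs]; exact hn
  have hk' : LinearMap.ker r ≤ V := fun x hx => by
    have : r x = 0 := hx
    change r x ∈ LinearMap.range i
    rw [this]; exact zero_mem _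
  have hsk : ∀ v : V, s v = 0 ↔ r v = 0 := fun v => by
    rw [← hs, map_eq_zero_iff i hi]
  refine ⟨ModuleCat.of R V, V.subtype, q ∘ₗ s, V.subtype_injective, hq.comp hss, ?_, ?_⟩
  · let f : LinearMap.ker r →ₗ[R] LinearMap.ker (q ∘ₗ s) :=
      LinearMap.codRestrict _ (Submodule.inclusion hk') (fun x => by
        have : s (Submodule.inclusion hk' x) = 0 := (hsk _).mpr x.2
        simp [this])
    let g : LinearMap.ker (q ∘ₗ s) →ₗ[R] LinearMap.ker q := s.restrict (fun x hx => hx)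
    refine InP.of_exact (f := f) (g := g) ?_ ?_ ?_ hk h1
    · intro x y hxy
      apply Subtype.ext
      exact congrArg (fun z : LinearMap.ker (q ∘ₗ s) => ((z : V) : N)) hxy
    · rintro ⟨w, hw⟩
      obtain ⟨v, rfl⟩ := hss w
      exact ⟨⟨v, hw⟩, rfl⟩
    · rintro ⟨v, hv⟩
      constructor
      · intro h
        have h' : s v = 0 := congrArg Subtype.val h
        exact ⟨⟨v, (hsk v).mp h'⟩, rfl⟩
      · rintro ⟨x, hx⟩
        have hx' : (x : N) = v := congrArg (fun z : LinearMap.ker (q ∘ₗ s) => ((z : V) : N)) hx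
        apply Subtype.ext
        change s v = 0
        rw [hsk, ← hx']; exact x.2
  · have hs' : Function.Surjective ((LinearMap.range i).mkQ ∘ₗ r) :=
      (Submodule.mkQ_surjective _).comp hr
    refine h2.of_equiv ((LinearMap.quotKerEquivOfSurjective _ hs').symm.trans
      (Submodule.quotEquivOfEq _ _ ?_))
    change LinearMap.ker ((LinearMap.range i).mkQ ∘ₗ r) = LinearMap.range V.subtype
    rw [LinearMap.ker_comp, Submodule.ker_mkQ, Submodule.range_subtype]

theorem IsFilling.of_injective (h : IsFilling R X M) (f : M →ₗ[R] N) (hf : Function.Injective f)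
    (hk : InP R (N ⧸ LinearMap.range f)) : IsFilling R X N := by
  rw [isFilling_iff] at h ⊢
  obtain ⟨W, i, q, hi, hq, h1, h2⟩ := h
  refine ⟨W, f ∘ₗ i, q, hf.comp hi, hq, h1, ?_⟩
  have hle : LinearMap.range (f ∘ₗ i) ≤ LinearMap.range f := LinearMap.range_comp_le_range _ _
  have hmap : LinearMap.range i ≤ (LinearMap.range (f ∘ₗ i)).comap f := by
    rintro _ ⟨w, rfl⟩; exact ⟨w, rfl⟩
  refine InP.of_exact (f := Submodule.mapQ _ _ f hmap) (g := Submodule.factor hle) ?_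
    (Submodule.factor_surjective hle) ?_ h2 hk
  · rw [← LinearMap.ker_eq_bot, LinearMap.ker_eq_bot']
    intro x hx
    obtain ⟨m, rfl⟩ := Submodule.mkQ_surjective _ x
    have : f m ∈ LinearMap.range (f ∘ₗ i) := by simpa using hx
    obtain ⟨w, hw⟩ := this
    have : i w = m := hf hw
    simpa using ⟨w, this⟩
  · intro x
    obtain ⟨n, rfl⟩ := Submodule.mkQ_surjective _ x
    constructor
    · intro hx
      have : n ∈ LinearMap.range f := by simpa using hx
      obtain ⟨m, rfl⟩ := this
      exact ⟨Submodule.Quotient.mk m, by simp⟩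
    · rintro ⟨y, hy⟩
      obtain ⟨m, rfl⟩ := Submodule.mkQ_surjective _ y
      rw [← hy]
      simp

/-- Extend a surjection `q : W → N` along an injection `j : N → M` with cokernel in `𝒫`. -/
theorem exists_extension (j : N →ₗ[R] M) (hj : Function.Injective j)
    (hQ : InP R (M ⧸ LinearMap.range j)) (q : W →ₗ[R] N) (hq : Function.Surjective q) :
    ∃ (T : ModuleCat.{u} R) (i : W →ₗ[R] T) (r : T →ₗ[R] M), Function.Injective i ∧
      Function.Surjective r ∧ r ∘ₗ i = j ∘ₗ q ∧ LinearMap.ker r ≤ LinearMap.range i := by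
  let Q := M ⧸ LinearMap.range j
  let F := Q →₀ R
  let c : F →ₗ[R] Q := Finsupp.linearCombination R id
  have hc : Function.Surjective c := Finsupp.linearCombination_id_surjective R Q
  have hproj : Module.Projective R (LinearMap.ker c) := hQ.projective_ker c hc
  obtain ⟨a, ha⟩ := Module.projective_lifting_property (LinearMap.range j).mkQ c
    (Submodule.mkQ_surjective _)
  have ha' : ∀ p, (LinearMap.range j).mkQ (a p) = c p := fun p => LinearMap.congr_fun ha p
  have hak : ∀ k : LinearMap.ker c, a k ∈ LinearMap.range j := fun k => by
    have : (LinearMap.range j).mkQ (a k) = 0 := by rw [ha']; exact k.2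
    simpa using this
  let e := LinearEquiv.ofInjective j hj
  let b : LinearMap.ker c →ₗ[R] N := e.symm.toLinearMap ∘ₗ
    a.restrict (p := LinearMap.ker c) (q := LinearMap.range j) (fun x hx => hak ⟨x, hx⟩)
  have hb : ∀ k, j (b k) = a k := fun k => by
    have : e (b k) = ⟨a k, hak k⟩ := by
      simp only [b, LinearMap.comp_apply, LinearEquiv.coe_coe, LinearEquiv.apply_symm_apply]; rfl
    exact congrArg Subtype.val this
  obtain ⟨b', hb'⟩ := Module.projective_lifting_property q b hq
  have hb'' : ∀ k, j (q (b' k)) = a k := fun k => by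
    rw [← hb, ← LinearMap.congr_fun hb' k]; rfl
  let d : LinearMap.ker c →ₗ[R] W × F := b'.prod (-(LinearMap.ker c).subtype)
  let r₀ : W × F →ₗ[R] M := (j ∘ₗ q).coprod a
  let r : (W × F) ⧸ LinearMap.range d →ₗ[R] M := (LinearMap.range d).liftQ r₀ (by
    rintro _ ⟨k, rfl⟩
    simp [r₀, d, hb''])
  have hr : ∀ w p, r (Submodule.Quotient.mk (w, p)) = j (q w) + a p := fun w p => by
    simp [r, r₀]
  refine ⟨ModuleCat.of R ((W × F) ⧸ LinearMap.range d),
    (LinearMap.range d).mkQ ∘ₗ LinearMap.inl R W F, r, ?_, ?_, ?_, ?_⟩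
  · rw [← LinearMap.ker_eq_bot, LinearMap.ker_eq_bot']
    intro w hw
    have : (w, (0 : F)) ∈ LinearMap.range d := by simpa using hw
    obtain ⟨k, hk⟩ := this
    have h1 : b' k = w := congrArg Prod.fst hk
    have h2 : -(k : F) = 0 := congrArg Prod.snd hk
    have h3 : k = 0 := Subtype.ext (neg_eq_zero.mp h2)
    rw [← h1, h3, map_zero]
  · intro m
    obtain ⟨p, hp⟩ := hc ((LinearMap.range j).mkQ m)
    have : m - a p ∈ LinearMap.range j := by
      rw [← Submodule.ker_mkQ (LinearMap.range j), LinearMap.mem_ker, map_sub, ha', hp, sub_self]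
    obtain ⟨n, hn⟩ := this
    obtain ⟨w, rfl⟩ := hq n
    refine ⟨Submodule.Quotient.mk (w, p), ?_⟩
    rw [hr, hn, sub_add_cancel]
  · ext w
    change r (Submodule.Quotient.mk (w, 0)) = _
    rw [hr]; simp
  · intro t ht
    obtain ⟨⟨w, p⟩, rfl⟩ := Submodule.Quotient.mk_surjective _ t
    have h0 : j (q w) + a p = 0 := by rw [← hr]; exact ht
    have hp : p ∈ LinearMap.ker c := by
      rw [LinearMap.mem_ker, ← ha', eq_neg_of_add_eq_zero_right h0, map_neg, neg_eq_zero]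
      exact (Submodule.Quotient.mk_eq_zero _).mpr ⟨q w, rfl⟩
    refine ⟨w + b' ⟨p, hp⟩, ?_⟩
    change Submodule.Quotient.mk (w + b' ⟨p, hp⟩, (0 : F)) = Submodule.Quotient.mk (w, p)
    rw [Submodule.Quotient.eq]
    exact ⟨⟨p, hp⟩, by simp [d]⟩

theorem IsFilling.exists_extension [Finite M]
    (hX : IsFilling R X M) (j : N →ₗ[R] M) (hj : Function.Injective j)
    (hQ : InP R (M ⧸ LinearMap.range j)) (q : W →ₗ[R] N) (hq : Function.Surjective q)
    (hk : InP R (LinearMap.ker q)) :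
    ∃ (T : ModuleCat.{u} R) (i : W →ₗ[R] T), Finite T ∧ Function.Injective i ∧
      InP R (T ⧸ LinearMap.range i) ∧ IsFilling R X T := by
  obtain ⟨T, i, r, hi, hr, hc, hle⟩ := AdmissibleClasses.exists_extension j hj hQ q hq
  have hc' : ∀ w, r (i w) = j (q w) := fun w => LinearMap.congr_fun hc w
  have hker : InP R (LinearMap.ker r) := by
    have : LinearMap.ker r = (LinearMap.ker q).map i := by
      apply le_antisymm
      · intro t ht
        obtain ⟨w, rfl⟩ := hle ht
        refine ⟨w, ?_, rfl⟩
        have h0 : j (q w) = 0 := by rw [← hc']; exact ht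
        exact (map_eq_zero_iff j hj).mp h0
      · rintro _ ⟨w, hw, rfl⟩
        have hw' : q w = 0 := hw
        rw [LinearMap.mem_ker, hc', hw', map_zero]
    rw [this]
    exact hk.of_equiv (Submodule.equivMapOfInjective i hi _)
  have := hker.1
  refine ⟨T, i, finite_of_exact (LinearMap.ker r).subtype r (LinearMap.exact_subtype_ker_map r),
    hi, ?_, hX.of_surjective r hr hker⟩
  have hs : Function.Surjective ((LinearMap.range j).mkQ ∘ₗ r) :=
    (Submodule.mkQ_surjective _).comp hr
  refine hQ.of_equiv ((LinearMap.quotKerEquivOfSurjective _ hs).symm.trans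
    (Submodule.quotEquivOfEq _ _ ?_))
  ext t
  simp only [LinearMap.ker_comp, Submodule.ker_mkQ, Submodule.mem_comap]
  constructor
  · rintro ⟨n, hn⟩
    obtain ⟨w, rfl⟩ := hq n
    have : t - i w ∈ LinearMap.range i := hle (by
      rw [LinearMap.mem_ker, map_sub, hc', hn, sub_self])
    simpa using add_mem this (LinearMap.mem_range_self i w)
  · rintro ⟨w, rfl⟩
    exact ⟨q w, (hc' w).symm⟩

theorem amalgam_aux (i : W →ₗ[R] M) (i' : W →ₗ[R] N) (hi' : Function.Injective i')
    (hN : InP R (N ⧸ LinearMap.range i')) (u : M →ₗ[R] Z) (u' : N →ₗ[R] Z)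
    (h : ∀ w, u (i w) = u' (i' w)) (hs : ∀ z, ∃ m n, u m + u' n = z)
    (hk : ∀ m n, u m + u' n = 0 → ∃ w, i w = m ∧ i' w = -n) :
    Function.Injective u ∧ InP R (Z ⧸ LinearMap.range u) := by
  constructor
  · rw [← LinearMap.ker_eq_bot, LinearMap.ker_eq_bot']
    intro m hm
    obtain ⟨w, rfl, hw⟩ := hk m 0 (by simp [hm])
    have : w = 0 := hi' (by simpa using hw)
    rw [this, map_zero]
  · have hsurj : Function.Surjective ((LinearMap.range u).mkQ ∘ₗ u') := by
      intro z
      obtain ⟨z, rfl⟩ := Submodule.mkQ_surjective _ z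
      obtain ⟨m, n, rfl⟩ := hs z
      refine ⟨n, ?_⟩
      have h0 : (LinearMap.range u).mkQ (u m) = 0 :=
        (Submodule.Quotient.mk_eq_zero _).mpr ⟨m, rfl⟩
      rw [map_add, h0, zero_add]; rfl
    refine hN.of_equiv ((Submodule.quotEquivOfEq _ _ ?_).trans
      (LinearMap.quotKerEquivOfSurjective _ hsurj))
    ext n
    simp only [LinearMap.ker_comp, Submodule.ker_mkQ, Submodule.mem_comap]
    constructor
    · rintro ⟨w, rfl⟩
      exact ⟨i w, h w⟩
    · rintro ⟨m, hm⟩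
      obtain ⟨w, -, hw⟩ := hk (-m) n (by simp [hm])
      exact ⟨-w, by simp [hw]⟩

theorem Sim.exists_common (h : Sim R X Y) :
    ∃ M : ModuleCat.{u} R, Finite M ∧ IsFilling R X M ∧ IsFilling R Y M := by
  obtain ⟨M, N, hM, -, hX, hY, ⟨e⟩⟩ := h
  exact ⟨M, hM, hX, hY.of_equiv e.symm⟩

theorem IsFilling.refl : IsFilling R X X := by
  rw [isFilling_iff]
  refine ⟨ModuleCat.of R X, LinearMap.id, LinearMap.id, fun _ _ h => h, fun x => ⟨x, rfl⟩, ?_, ?_⟩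
  · have : Subsingleton (LinearMap.ker (LinearMap.id : X →ₗ[R] X)) := by
      rw [LinearMap.ker_id]; infer_instance
    exact InP.of_subsingleton
  · have : Subsingleton (X ⧸ LinearMap.range (LinearMap.id : X →ₗ[R] X)) := by
      rw [LinearMap.range_id]; infer_instance
    exact InP.of_subsingleton

theorem Sim.refl [Finite X] : Sim R X X :=
  ⟨ModuleCat.of R X, ModuleCat.of R X, inferInstance, inferInstance, IsFilling.refl,
    IsFilling.refl, ⟨LinearEquiv.refl R X⟩⟩

theorem Sim.symm (h : Sim R X Y) : Sim R Y X := by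
  obtain ⟨M, N, hM, hN, hX, hY, ⟨e⟩⟩ := h
  exact ⟨N, M, hN, hM, hY, hX, ⟨e.symm⟩⟩

theorem Sim.trans (h : Sim R X Y) (h' : Sim R Y Z) : Sim R X Z := by
  obtain ⟨M, hM, hX, hY⟩ := h.exists_common
  obtain ⟨M', hM', hY', hZ⟩ := h'.exists_common
  obtain ⟨N, j, p, hj, hp, hpk, hjc⟩ := isFilling_iff.mp hY
  obtain ⟨N', j', p', hj', hp', hpk', hjc'⟩ := isFilling_iff.mp hY'
  let W : Submodule R (N × N') :=
    LinearMap.eqLocus (p ∘ₗ LinearMap.fst R N N') (p' ∘ₗ LinearMap.snd R N N')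
  have hW : ∀ w : W, p w.1.1 = p' w.1.2 := fun w => w.2
  let q : W →ₗ[R] N := LinearMap.fst R N N' ∘ₗ W.subtype
  let q' : W →ₗ[R] N' := LinearMap.snd R N N' ∘ₗ W.subtype
  have hq : Function.Surjective q := fun n => by
    obtain ⟨n', hn'⟩ := hp' (p n)
    exact ⟨⟨(n, n'), hn'.symm⟩, rfl⟩
  have hq' : Function.Surjective q' := fun n' => by
    obtain ⟨n, hn⟩ := hp (p' n')
    exact ⟨⟨(n, n'), hn⟩, rfl⟩
  have hqk : InP R (LinearMap.ker q) := by
    let f : LinearMap.ker q →ₗ[R] LinearMap.ker p' := q'.restrict (fun w hw => by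
      have : w.1.1 = 0 := hw
      change p' w.1.2 = 0
      rw [← hW, this, map_zero])
    refine hpk'.of_equiv (LinearEquiv.ofBijective f ⟨?_, ?_⟩).symm
    · rintro ⟨⟨⟨a, a'⟩, ha⟩, h0⟩ ⟨⟨⟨b, b'⟩, hb⟩, h1⟩ hab
      have e0 : a = 0 := h0
      have e1 : b = 0 := h1
      have e2 : a' = b' := congrArg Subtype.val hab
      subst e0 e1 e2; rfl
    · rintro ⟨n', hn'⟩
      have : p' n' = 0 := hn'
      exact ⟨⟨⟨(0, n'), by change p 0 = p' n'; rw [this, map_zero]⟩, rfl⟩, rfl⟩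
  have hqk' : InP R (LinearMap.ker q') := by
    let f : LinearMap.ker q' →ₗ[R] LinearMap.ker p := q.restrict (fun w hw => by
      have : w.1.2 = 0 := hw
      change p w.1.1 = 0
      rw [hW, this, map_zero])
    refine hpk.of_equiv (LinearEquiv.ofBijective f ⟨?_, ?_⟩).symm
    · rintro ⟨⟨⟨a, a'⟩, ha⟩, h0⟩ ⟨⟨⟨b, b'⟩, hb⟩, h1⟩ hab
      have e0 : a' = 0 := h0
      have e1 : b' = 0 := h1
      have e2 : a = b := congrArg Subtype.val hab
      subst e0 e1 e2; rfl
    · rintro ⟨n, hn⟩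
      have : p n = 0 := hn
      exact ⟨⟨⟨(n, 0), by change p n = p' 0; rw [this, map_zero]⟩, rfl⟩, rfl⟩
  obtain ⟨T, i, hT, hi, hic, hXT⟩ := hX.exists_extension j hj hjc q hq hqk
  obtain ⟨T', i', hT', hi', hic', hZT'⟩ :=
    hZ.exists_extension j' hj' hjc' q' hq' hqk'
  let d : W →ₗ[R] T × T' := i.prod (-i')
  let P := (T × T') ⧸ LinearMap.range d
  let u : T →ₗ[R] P := (LinearMap.range d).mkQ ∘ₗ LinearMap.inl R T T'
  let u' : T' →ₗ[R] P := (LinearMap.range d).mkQ ∘ₗ LinearMap.inr R T T'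
  have huu : ∀ t t', u t + u' t' = Submodule.Quotient.mk (t, t') := fun t t' => by
    change Submodule.Quotient.mk (t, (0 : T')) + Submodule.Quotient.mk ((0 : T), t') = _
    rw [← Submodule.Quotient.mk_add]; simp
  have h1 : ∀ z, ∃ t t', u t + u' t' = z := fun z => by
    obtain ⟨⟨t, t'⟩, rfl⟩ := Submodule.Quotient.mk_surjective _ z
    exact ⟨t, t', huu t t'⟩
  have h2 : ∀ t t', u t + u' t' = 0 → ∃ w, i w = t ∧ i' w = -t' := fun t t' h0 => by
    rw [huu, Submodule.Quotient.mk_eq_zero] at h0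
    obtain ⟨w, hw⟩ := h0
    refine ⟨w, congrArg Prod.fst hw, ?_⟩
    have h5 : -(i' w) = t' := congrArg Prod.snd hw
    rw [← h5, neg_neg]
  have h3 : ∀ w, u (i w) = u' (i' w) := fun w => by
    rw [← sub_eq_zero, sub_eq_add_neg, ← map_neg, huu, Submodule.Quotient.mk_eq_zero]
    exact ⟨w, rfl⟩
  obtain ⟨hu, huc⟩ := amalgam_aux i i' hi' hic' u u' h3 h1 h2
  obtain ⟨hu', huc'⟩ := amalgam_aux i' i hi hic u' u (fun w => (h3 w).symm)
    (fun z => by obtain ⟨t, t', ht⟩ := h1 z; exact ⟨t', t, by rw [add_comm, ht]⟩)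
    (fun t' t h0 => by
      obtain ⟨w, hw, hw'⟩ := h2 t t' (by rw [add_comm, h0])
      exact ⟨-w, by rw [map_neg, hw', neg_neg], by rw [map_neg, hw]⟩)
  have hP : Finite P := Finite.of_surjective _ (Submodule.mkQ_surjective (LinearMap.range d))
  exact ⟨ModuleCat.of R P, ModuleCat.of R P, hP, hP, hXT.of_injective u hu huc,
    hZT'.of_injective u' hu' huc', ⟨LinearEquiv.refl R P⟩⟩

theorem IsFilling.prod (h : IsFilling R X M) (h' : IsFilling R Y N) :
    IsFilling R (X × Y) (M × N) := by
  rw [isFilling_iff] at h h' ⊢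
  obtain ⟨V, i, q, hi, hq, h1, h2⟩ := h
  obtain ⟨V', i', q', hi', hq', h1', h2'⟩ := h'
  refine ⟨ModuleCat.of R (V × V'), i.prodMap i', q.prodMap q', hi.prodMap hi', hq.prodMap hq',
    ?_, ?_⟩
  · let f : (LinearMap.ker q × LinearMap.ker q') →ₗ[R] LinearMap.ker (q.prodMap q') :=
      ((LinearMap.ker q).subtype.prodMap (LinearMap.ker q').subtype).codRestrict _ (fun x => by
        exact Prod.ext x.1.2 x.2.2)
    refine (h1.prod h1').of_equiv (LinearEquiv.ofBijective f ⟨?_, ?_⟩)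
    · intro x y hxy
      have hxy' : ((x.1 : V), (x.2 : V')) = ((y.1 : V), (y.2 : V')) := congrArg Subtype.val hxy
      exact Prod.ext (Subtype.ext (congrArg Prod.fst hxy')) (Subtype.ext (congrArg Prod.snd hxy'))
    · rintro ⟨⟨a, b⟩, hab⟩
      have hab' : (q a, q' b) = (0, 0) := hab
      exact ⟨(⟨a, congrArg Prod.fst hab'⟩, ⟨b, congrArg Prod.snd hab'⟩), rfl⟩
  · let f : (M × N) →ₗ[R] ((M ⧸ LinearMap.range i) × (N ⧸ LinearMap.range i')) :=
      (LinearMap.range i).mkQ.prodMap (LinearMap.range i').mkQ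
    have hf : Function.Surjective f :=
      (Submodule.mkQ_surjective _).prodMap (Submodule.mkQ_surjective _)
    refine (h2.prod h2').of_equiv ((LinearMap.quotKerEquivOfSurjective f hf).symm.trans
      (Submodule.quotEquivOfEq _ _ ?_))
    change LinearMap.ker f = LinearMap.range (i.prodMap i')
    rw [LinearMap.range_prodMap, LinearMap.ker_prodMap, Submodule.ker_mkQ, Submodule.ker_mkQ]

theorem Sim.prod {X' Y' : Type u} [AddCommGroup X'] [Module R X'] [AddCommGroup Y'] [Module R Y']
    (h : Sim R X Y) (h' : Sim R X' Y') : Sim R (X × X') (Y × Y') := by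
  obtain ⟨M, N, hM, hN, hX, hY, ⟨e⟩⟩ := h
  obtain ⟨M', N', hM', hN', hX', hY', ⟨e'⟩⟩ := h'
  exact ⟨ModuleCat.of R (M × M'), ModuleCat.of R (N × N'), inferInstanceAs (Finite (M × M')),
    inferInstanceAs (Finite (N × N')), hX.prod hX', hY.prod hY', ⟨e.prodCongr e'⟩⟩

theorem Sim.of_equiv [Finite X] (e : X ≃ₗ[R] Y) : Sim R X Y := by
  have : Finite Y := Finite.of_equiv X e.toEquiv
  exact ⟨ModuleCat.of R X, ModuleCat.of R Y, inferInstance, inferInstance, IsFilling.refl,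
    IsFilling.refl, ⟨e⟩⟩

end Lemmas

section Monoid

variable (R : Type u) [CommRing R]

/-- The finite `R`-modules. -/
abbrev FinMod : Type (u + 1) := {M : ModuleCat.{u} R // Finite M}

/-- The relation `∼` on finite `R`-modules, which is an equivalence relation. -/
instance simSetoid : Setoid (FinMod R) where
  r X Y := Sim R X.1 Y.1
  iseqv :=
    { refl := fun X => by have := X.2; exact Sim.refl
      symm := Sim.symm
      trans := Sim.trans }

/-- The set `𝒞/∼` of equivalence classes. -/
def SimClass : Type (u + 1) := Quotient (simSetoid R)

variable {R}

/-- The class `[X]` of a finite `R`-module. -/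
def SimClass.mk (X : FinMod R) : SimClass R := Quotient.mk _ X

/-- The direct sum of two finite modules. -/
def FinMod.sum (X Y : FinMod R) : FinMod R :=
  ⟨ModuleCat.of R (X.1 × Y.1), by
    have := X.2
    have := Y.2
    exact inferInstanceAs (Finite (X.1 × Y.1))⟩

/-- The sum on `𝒞/∼` is induced by the direct sum. -/
instance : Add (SimClass R) where
  add := Quotient.map₂ FinMod.sum (fun _ _ h _ _ h' => Sim.prod h h')

instance : Zero (SimClass R) where
  zero := SimClass.mk ⟨ModuleCat.of R PUnit.{u + 1}, inferInstanceAs (Finite PUnit)⟩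

instance : AddCommMonoid (SimClass R) where
  add_assoc := by
    rintro ⟨X⟩ ⟨Y⟩ ⟨Z⟩
    have := ((X.sum Y).sum Z).2
    exact Quotient.sound (Sim.of_equiv (LinearEquiv.prodAssoc R X.1 Y.1 Z.1))
  zero_add := by
    rintro ⟨X⟩
    have := X.2
    exact Quotient.sound (Sim.of_equiv (LinearEquiv.uniqueProd (R := R) (M := X.1)
      (M₂ := PUnit.{u + 1})).symm).symm
  add_zero := by
    rintro ⟨X⟩
    have := X.2
    exact Quotient.sound (Sim.of_equiv (LinearEquiv.prodUnique (R := R) (M := X.1)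
      (M₂ := PUnit.{u + 1})).symm).symm
  add_comm := by
    rintro ⟨X⟩ ⟨Y⟩
    have := (X.sum Y).2
    exact Quotient.sound (Sim.of_equiv (LinearEquiv.prodComm R X.1 Y.1))
  nsmul := nsmulRec

theorem SimClass.mk_add (X Y : FinMod R) :
    SimClass.mk X + SimClass.mk Y = SimClass.mk (X.sum Y) := rfl

theorem SimClass.mk_eq_iff (X Y : FinMod R) :
    SimClass.mk X = SimClass.mk Y ↔ Sim R X.1 Y.1 := Quotient.eq

end Monoid

section Groups

/-- A group is elementary if, for some prime `p`, it is the product of a `p`-group and a cyclic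
group. -/
def IsElementary (G : Type u) [Group G] : Prop :=
  ∃ p : ℕ, p.Prime ∧ ∃ (P C : Type u) (_ : Group P) (_ : Group C),
    IsPGroup p P ∧ IsCyclic C ∧ Nonempty (G ≃* P × C)

/-- The `k[Γ]`-module `A_{I,φ} = k[Γ/I] / (1 - φ⁻¹ + #I)`; the ring `k[Γ]` acts through the
projection `k[Γ] → k[Γ/I]`. -/
noncomputable def moduleA (k : Type) [CommRing k] (Γ : Type u) [CommGroup Γ] (I : Subgroup Γ)
    (φ : Γ ⧸ I) : ModuleCat.{u} (MonoidAlgebra k Γ) :=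
  (ModuleCat.restrictScalars (MonoidAlgebra.mapDomainRingHom k (QuotientGroup.mk' I))).obj
    (ModuleCat.of (MonoidAlgebra k (Γ ⧸ I)) (MonoidAlgebra k (Γ ⧸ I) ⧸
      Ideal.span {1 - MonoidAlgebra.of k (Γ ⧸ I) φ⁻¹ +
        (Nat.card I : MonoidAlgebra k (Γ ⧸ I))}))

/-- The monoid of admissible classes over `k[Γ]`: the submonoid of `𝒞/∼` generated by the classes
`[ω¹(A_{I,φ})]` with `I` a non-trivial elementary subgroup of `Γ` and `φ` in `Γ/I`. -/
noncomputable def Zadm (k : Type) [CommRing k] (Γ : Type u) [CommGroup Γ] :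
    AddSubmonoid (SimClass (MonoidAlgebra k Γ)) :=
  AddSubmonoid.closure {c | ∃ (I : Subgroup Γ) (φ : Γ ⧸ I), I ≠ ⊥ ∧ IsElementary I ∧
    ∃ Y : FinMod (MonoidAlgebra k Γ),
      IsShift (MonoidAlgebra k Γ) (moduleA k Γ I φ) Y.1 ∧ c = SimClass.mk Y}

/-- The maximal `p`-quotient `Γ_p` of `Γ`, the quotient by the smallest subgroup whose quotient is
a `p`-group. -/
abbrev MaxPQuotient (p : ℕ) (Γ : Type u) [CommGroup Γ] : Type u :=
  Γ ⧸ sInf {N : Subgroup Γ | IsPGroup p (Γ ⧸ N)}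

/-- The set `𝒯` of tuples `(p, H, I, D)`: `p` is a prime, `H ≤ Γ` is a subgroup such that `Γ/H` is
cyclic of order prime to `p`, and `I ≤ D` are subgroups of `Γ_p` such that `I` is non-trivial and
`D/I` is cyclic. -/
structure TSet (Γ : Type u) [CommGroup Γ] where
  p : ℕ
  prime : p.Prime
  H : Subgroup Γ
  cyclic_quotient : IsCyclic (Γ ⧸ H)
  coprime : (Nat.card (Γ ⧸ H)).Coprime p
  I : Subgroup (MaxPQuotient p Γ)
  D : Subgroup (MaxPQuotient p Γ)
  le : I ≤ D
  ne_bot : I ≠ ⊥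
  cyclic : IsCyclic (D ⧸ I.subgroupOf D)

end Groups

end AdmissibleClasses

/-!
Write `R = k[Γ]`. By Schanuel's lemma the class of the kernel `Y` of a surjection `P → X` with `P` in
`𝒫` depends only on the class of `X`, and `X ↦ ω¹(X)` becomes an additive endomorphism `shiftHom` of
`𝒞/∼`. All that the argument needs of the base ring is that `k` has no integer torsion and that its
quotients by non-zero integers are finite (`IsOrderLike`), together with the fact that the primes
dividing `#Γ` are not invertible in `k`.

*Generators.* The module `A_{I,φ}` is the quotient of `R` by an ideal, and it is annihilated by an
integer `z = (1 + #I) ^ m - 1`, so its class is the sum of the classes of its `p`-primary parts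
(`quotClass_eq_sum`). If `p` does not divide `#I`, the `p`-primary part is a direct summand of a module
in `𝒫` and contributes nothing (`primClass_eq_zero`). If `p` divides `#I`, the contribution depends
only on the Sylow `p`-subgroup of `I` and on the group `D` generated by `I` and `φ`
(`primClass_congr`). Indeed, the elements of `D` of order prime to `p` act trivially on the
`p`-primary part, so `I` may be replaced by a subgroup `J` of `D` that is determined by these data,
and the remaining freedom in `φ` and in the integer `#I` changes the defining element by a multiple
of the norm element of `J`. Such a change does not affect the class (`exists_forall_quotClass_eq`):
both quotients arise from the same module by dividing out a free submodule of rank one.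

*Invariants.* Modules in `𝒫` are cohomologically trivial, so the `p`-adic valuation of the order of
the `V`-coinvariants of `s Ĥ⁰(U, X)` is an additive function of the class of `X` (`tateInv`). For
`#U = p ^ (j + 1)` and `s = p ^ j`, its value at `[ω¹(A_{I,φ})]` is `v_p(#(k/p)) · [Γ : V D]` if `U ≤ I`,
and `0` otherwise (`tateInv_genClass_of_le`, `tateInv_genClass_of_not_le`).

*Cyclic groups and groups of prime power order.* Here the pairs consisting of a non-trivial
`p`-subgroup `I` and a subgroup `D ≥ I` with `D / I` cyclic correspond to the elements of `𝒯`
(`exists_tset`, `TSet.exists_decomp_eq`), so the classes attached to the elements of `𝒯` generate the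
monoid. They are independent (`eq_zero_of_sum_index`). The factor `1[U ≤ I]` separates the subgroups
`I` by descending induction. For fixed `I` the function `V ↦ [Γ : V D]` is, up to factors depending on
`V` or on `D` alone, the function `V ↦ #(V ∩ D)`. A relation between these functions makes the sum of
squares `∑_γ (∑_{D ∋ γ} y_D)²` vanish (`sum_ite_mem_eq_zero`), and evaluation at a generator of `D`
modulo `I` gives `y_D = 0` by descending induction on `D`.

*The remaining groups.* Such a group contains `x₁` and `x₂` of order `p` that generate different
subgroups, and `y` of order `q ≠ p`. The primary decomposition yields a relation
`a + b' = a' + b` between generators, which in a free monoid would make `b` a summand of `a`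
(`exists_eq_add_of_free`). The invariants exclude an admissible complement (`not_free`).
-/

universe v

namespace AdmissibleClasses

/-! ### Modules of projective dimension at most one -/

/-- The properties of the group ring `k[Γ]` that the theory of `∼` needs: it is torsion free as an
abelian group and its quotients by non-zero integers are finite. -/
class IsOrderLike (R : Type u) [CommRing R] : Prop where
  natCast_mul_eq_zero : ∀ (t : ℕ) (x : R), t ≠ 0 → (t : R) * x = 0 → x = 0
  finite_quotient : ∀ t : ℕ, t ≠ 0 → Finite (R ⧸ Ideal.span {(t : R)})

section Modules

variable {R : Type u} [CommRing R]
variable {A B C X Y K M W : Type u} [AddCommGroup A] [Module R A] [AddCommGroup B] [Module R B]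
  [AddCommGroup C] [Module R C] [AddCommGroup X] [Module R X] [AddCommGroup Y] [Module R Y]
  [AddCommGroup K] [Module R K] [AddCommGroup M] [Module R M] [AddCommGroup W] [Module R W]

theorem InP.ker (hB : InP R B) (hC : InP R C) (g : B →ₗ[R] C) (hg : Function.Surjective g) :
    InP R (LinearMap.ker g) := by
  have := hB.1
  have := hB.2
  have := hC.2
  refine ⟨inferInstance, ?_⟩
  have S := shortExact_of_exact (LinearMap.ker g).subtype_injective hg
    (LinearMap.exact_subtype_ker_map g)
  exact S.hasProjectiveDimensionLT_X₁ 2 hB.2 (hasProjectiveDimensionLT_of_ge _ 2 3 (by omega))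

theorem InP.of_retract (hB : InP R B) (i : A →ₗ[R] B) (r : B →ₗ[R] A) (h : ∀ a, r (i a) = a) :
    InP R A := by
  have := hB.1
  have := hB.2
  refine ⟨Finite.of_injective i (Function.LeftInverse.injective h), ?_⟩
  let e : Retract (ModuleCat.of R A) (ModuleCat.of R B) :=
    { i := ModuleCat.ofHom i
      r := ModuleCat.ofHom r
      retract := by ext a; exact h a }
  exact e.hasProjectiveDimensionLT 2

theorem InP.quotient_of_projective [Module.Projective R M] (N : Submodule R M)
    [Module.Projective R N] [Finite (M ⧸ N)] : InP R (M ⧸ N) := by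
  refine ⟨inferInstance, ?_⟩
  have S := shortExact_of_exact N.subtype_injective N.mkQ_surjective
    (LinearMap.exact_subtype_mkQ N)
  have h1 : Projective (ModuleCat.of R M) := (IsProjective.iff_projective M).mp inferInstance
  have h2 : Projective (ModuleCat.of R N) := (IsProjective.iff_projective N).mp inferInstance
  refine (S.hasProjectiveDimensionLT_X₃_iff 0 h1).mpr ?_
  exact projective_iff_hasProjectiveDimensionLT_one.mp h2

/-- The cokernel of an injective endomorphism of a projective module belongs to `𝒫` when it is
finite. -/
theorem InP.quotient_range [Module.Projective R K] [Module.Projective R M] (f : K →ₗ[R] M)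
    (hf : Function.Injective f) [Finite (M ⧸ LinearMap.range f)] :
    InP R (M ⧸ LinearMap.range f) := by
  have : Module.Projective R (LinearMap.range f) :=
    Module.Projective.of_equiv (LinearEquiv.ofInjective f hf)
  exact InP.quotient_of_projective _

theorem InP.quotient_span_singleton (s : R) (hs : ∀ x, s * x = 0 → x = 0)
    [hfin : Finite (R ⧸ Ideal.span {s})] : InP R (R ⧸ Ideal.span {s}) := by
  have e : LinearMap.range (LinearMap.lsmul R R s) = Ideal.span {s} := by
    ext x
    simp [Ideal.mem_span_singleton', mul_comm]
  have : Finite (R ⧸ LinearMap.range (LinearMap.lsmul R R s)) := by rw [e]; exact hfin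
  refine InP.of_equiv (InP.quotient_range (LinearMap.lsmul R R s) ?_)
    (Submodule.quotEquivOfEq _ _ e)
  exact (injective_iff_map_eq_zero _).mpr hs

theorem Sim.of_surjective [Finite W] (r : W →ₗ[R] A) (hr : Function.Surjective r)
    (hk : InP R (LinearMap.ker r)) : Sim R W A := by
  have : Finite A := Finite.of_surjective r hr
  exact ⟨ModuleCat.of R W, ModuleCat.of R W, inferInstance, inferInstance, IsFilling.refl,
    IsFilling.refl.of_surjective r hr hk, ⟨LinearEquiv.refl R W⟩⟩

theorem Sim.of_injective [Finite W] (i : A →ₗ[R] W) (hi : Function.Injective i)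
    (hk : InP R (W ⧸ LinearMap.range i)) : Sim R A W := by
  have : Finite A := Finite.of_injective i hi
  exact ⟨ModuleCat.of R W, ModuleCat.of R W, inferInstance, inferInstance,
    IsFilling.refl.of_injective i hi hk, IsFilling.refl, ⟨LinearEquiv.refl R W⟩⟩

theorem Sim.of_inP (hA : InP R A) (hB : InP R B) : Sim R A B := by
  have h0 : ∀ (Z : Type u) [AddCommGroup Z] [Module R Z], InP R Z → Sim R Z PUnit.{u + 1} := by
    intro Z _ _ hZ
    have := hZ.1
    refine Sim.of_surjective (0 : Z →ₗ[R] PUnit.{u + 1}) (fun x => ⟨0, rfl⟩) ?_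
    rw [LinearMap.ker_zero]
    exact hZ.of_equiv Submodule.topEquiv.symm
  exact (h0 A hA).trans (h0 B hB).symm

theorem finite_of_module_finite [IsOrderLike R] [Module.Finite R M] (t : ℕ) (ht : t ≠ 0)
    (h : ∀ m : M, t • m = 0) : Finite M := by
  obtain ⟨n, f, hf⟩ := Module.Finite.exists_fin' R M
  have := IsOrderLike.finite_quotient (R := R) t ht
  refine Finite.of_surjective (fun v : Fin n → R ⧸ Ideal.span {(t : R)} =>
    f (fun i => (v i).out)) fun m => ?_
  obtain ⟨x, rfl⟩ := hf m
  refine ⟨fun i => Ideal.Quotient.mk _ (x i), ?_⟩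
  have : ∀ i, ∃ y, (t : R) * y =
      (Ideal.Quotient.mk (Ideal.span {(t : R)}) (x i)).out - x i := fun i => by
    have h1 : (Ideal.Quotient.mk (Ideal.span {(t : R)}) (x i)).out - x i ∈
        Ideal.span {(t : R)} := by
      rw [← Ideal.Quotient.eq]
      exact Quotient.out_eq _
    obtain ⟨y, hy⟩ := Ideal.mem_span_singleton'.mp h1
    exact ⟨y, by rw [mul_comm, hy]⟩
  choose y hy using this
  rw [← sub_eq_zero, ← map_sub]
  have h2 : (fun i => (Ideal.Quotient.mk (Ideal.span {(t : R)}) (x i)).out) - x =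
      t • (y : Fin n → R) := by
    ext i
    simp [← hy i]
  rw [h2, map_nsmul, h]

/-- Every finite module is a quotient of a module in `𝒫`. -/
theorem exists_surjective_inP [IsOrderLike R] [Finite X] :
    ∃ (P : ModuleCat.{u} R) (g : P →ₗ[R] X), InP R P ∧ Function.Surjective g := by
  let F := X →₀ R
  let f : F →ₗ[R] F := LinearMap.lsmul R F (Nat.card X : R)
  have hX : Nat.card X ≠ 0 := Nat.card_ne_zero.mpr ⟨inferInstance, inferInstance⟩
  have hf : Function.Injective f := by
    rw [injective_iff_map_eq_zero]
    intro x hx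
    ext i
    exact IsOrderLike.natCast_mul_eq_zero _ _ hX (DFunLike.congr_fun hx i)
  have h0 : ∀ x : X, (Nat.card X : R) • x = 0 := fun x => by
    rw [Nat.cast_smul_eq_nsmul, card_nsmul_eq_zero']
  have : Finite (F ⧸ LinearMap.range f) := by
    refine finite_of_module_finite (R := R) (Nat.card X) hX fun m => ?_
    obtain ⟨m, rfl⟩ := Submodule.mkQ_surjective _ m
    rw [← map_nsmul]
    refine (Submodule.Quotient.mk_eq_zero _).mpr ⟨m, ?_⟩
    simp [f, Nat.cast_smul_eq_nsmul]
  let g : F →ₗ[R] X := Finsupp.linearCombination R id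
  refine ⟨ModuleCat.of R (F ⧸ LinearMap.range f), (LinearMap.range f).liftQ g ?_,
    InP.quotient_range f hf, ?_⟩
  · rintro _ ⟨x, rfl⟩
    rw [LinearMap.mem_ker]
    simp [f, h0]
  · intro x
    obtain ⟨y, hy⟩ := Finsupp.linearCombination_id_surjective R X x
    exact ⟨Submodule.Quotient.mk y, by simpa [g] using hy⟩

/-! ### The shift -/

theorem exists_isShift [IsOrderLike R] [Finite X] :
    ∃ Y : FinMod R, IsShift R X Y.1 := by
  obtain ⟨P, g, hP, hg⟩ := exists_surjective_inP (R := R) (X := X)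
  have := hP.1
  exact ⟨⟨ModuleCat.of R (LinearMap.ker g), inferInstanceAs (Finite (LinearMap.ker g))⟩, P,
    (LinearMap.ker g).subtype, g, hP, Submodule.subtype_injective _, hg,
    LinearMap.exact_subtype_ker_map g⟩

/-- Schanuel's lemma for shifts. -/
theorem IsShift.sim {Y' : Type u} [AddCommGroup Y'] [Module R Y'] (h : IsShift R X Y)
    (h' : IsShift R X Y') : Sim R Y Y' := by
  obtain ⟨P, f, g, hP, hf, hg, hfg⟩ := h
  obtain ⟨P', f', g', hP', hf', hg', hfg'⟩ := h'
  have := hP.1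
  have := hP'.1
  -- The fibre product `W` of `P` and `P'` over `X` contains `Y` with quotient `P'`, and `Y'` with
  -- quotient `P`.
  let W : Submodule R (P × P') :=
    LinearMap.eqLocus (g ∘ₗ LinearMap.fst R P P') (g' ∘ₗ LinearMap.snd R P P')
  have hW : ∀ w : W, g w.1.1 = g' w.1.2 := fun w => w.2
  have : Finite W := inferInstance
  have h1 : Sim R Y W := by
    let i : Y →ₗ[R] W := (LinearMap.inl R P P' ∘ₗ f).codRestrict W (fun y => by
      change g (f y) = g' 0
      rw [map_zero, hfg.apply_apply_eq_zero])
    let s : W →ₗ[R] P' := LinearMap.snd R P P' ∘ₗ W.subtype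
    have hs : Function.Surjective s := fun p' => by
      obtain ⟨p, hp⟩ := hg (g' p')
      exact ⟨⟨(p, p'), hp⟩, rfl⟩
    have hi : Function.Injective i := fun a b hab => by
      have : f a = f b := congrArg (fun w : W => w.1.1) hab
      exact hf this
    refine Sim.of_injective i hi (hP'.of_equiv
      ((LinearMap.quotKerEquivOfSurjective s hs).symm.trans (Submodule.quotEquivOfEq _ _ ?_)))
    ext ⟨⟨p, p'⟩, hw⟩
    constructor
    · intro h0
      have h0' : p' = 0 := h0
      subst h0'
      have hw' : g p = g' 0 := hw
      rw [map_zero] at hw'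
      obtain ⟨y, rfl⟩ := (hfg p).mp hw'
      exact ⟨y, rfl⟩
    · rintro ⟨y, hy⟩
      have : (0 : P') = p' := congrArg (fun w : W => w.1.2) hy
      exact this.symm
  have h2 : Sim R Y' W := by
    let i : Y' →ₗ[R] W := (LinearMap.inr R P P' ∘ₗ f').codRestrict W (fun y => by
      change g 0 = g' (f' y)
      rw [map_zero, hfg'.apply_apply_eq_zero])
    let s : W →ₗ[R] P := LinearMap.fst R P P' ∘ₗ W.subtype
    have hs : Function.Surjective s := fun p => by
      obtain ⟨p', hp⟩ := hg' (g p)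
      exact ⟨⟨(p, p'), hp.symm⟩, rfl⟩
    have hi : Function.Injective i := fun a b hab => by
      have : f' a = f' b := congrArg (fun w : W => w.1.2) hab
      exact hf' this
    refine Sim.of_injective i hi (hP.of_equiv
      ((LinearMap.quotKerEquivOfSurjective s hs).symm.trans (Submodule.quotEquivOfEq _ _ ?_)))
    ext ⟨⟨p, p'⟩, hw⟩
    constructor
    · intro h0
      have h0' : p = 0 := h0
      subst h0'
      have hw' : g 0 = g' p' := hw
      rw [map_zero] at hw'
      obtain ⟨y, rfl⟩ := (hfg' p').mp hw'.symm
      exact ⟨y, rfl⟩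
    · rintro ⟨y, hy⟩
      have : (0 : P) = p := congrArg (fun w : W => w.1.1) hy
      exact this.symm
  exact h1.trans h2.symm

/-- A shift of `X` is a shift of any extension of `X` by a module in `𝒫`. -/
theorem IsShift.of_surjective (h : IsShift R X Y) (q : W →ₗ[R] X) (hq : Function.Surjective q)
    (hk : InP R (LinearMap.ker q)) : IsShift R W Y := by
  obtain ⟨P, f, g, hP, hf, hg, hfg⟩ := h
  let Q : Submodule R (P × W) :=
    LinearMap.eqLocus (g ∘ₗ LinearMap.fst R P W) (q ∘ₗ LinearMap.snd R P W)
  let i : Y →ₗ[R] Q := (LinearMap.inl R P W ∘ₗ f).codRestrict Q (fun y => by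
    change g (f y) = q 0
    rw [map_zero, hfg.apply_apply_eq_zero])
  let j : LinearMap.ker q →ₗ[R] Q :=
    (LinearMap.inr R P W ∘ₗ (LinearMap.ker q).subtype).codRestrict Q (fun y => by
      change g 0 = q y
      rw [map_zero, y.2])
  let s : Q →ₗ[R] W := LinearMap.snd R P W ∘ₗ Q.subtype
  let r : Q →ₗ[R] P := LinearMap.fst R P W ∘ₗ Q.subtype
  have hQ : InP R Q := by
    refine InP.of_exact (f := j) (g := r) ?_ ?_ ?_ hk hP
    · intro a b hab
      have : (a : W) = b := congrArg (fun w : Q => w.1.2) hab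
      exact Subtype.ext this
    · intro p
      obtain ⟨w, hw⟩ := hq (g p)
      exact ⟨⟨(p, w), hw.symm⟩, rfl⟩
    · rintro ⟨⟨p, w⟩, hpw⟩
      constructor
      · intro h0
        have h0' : p = 0 := h0
        subst h0'
        have hpw' : g 0 = q w := hpw
        rw [map_zero] at hpw'
        exact ⟨⟨w, hpw'.symm⟩, rfl⟩
      · rintro ⟨y, hy⟩
        have : (0 : P) = p := congrArg (fun w : Q => w.1.1) hy
        exact this.symm
  refine ⟨ModuleCat.of R Q, i, s, hQ, ?_, ?_, ?_⟩
  · intro a b hab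
    have : f a = f b := congrArg (fun w : Q => w.1.1) hab
    exact hf this
  · intro w
    obtain ⟨p, hp⟩ := hg (q w)
    exact ⟨⟨(p, w), hp⟩, rfl⟩
  · rintro ⟨⟨p, w⟩, hpw⟩
    constructor
    · intro h0
      have h0' : w = 0 := h0
      subst h0'
      have hpw' : g p = q 0 := hpw
      rw [map_zero] at hpw'
      obtain ⟨y, rfl⟩ := (hfg p).mp hpw'
      exact ⟨y, rfl⟩
    · rintro ⟨y, hy⟩
      have : (0 : W) = w := congrArg (fun w : Q => w.1.2) hy
      exact this.symm

/-- A shift of `M` is a shift of any submodule of `M` with quotient in `𝒫`. -/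
theorem IsShift.of_injective (h : IsShift R M Y) (i : W →ₗ[R] M) (hi : Function.Injective i)
    (hk : InP R (M ⧸ LinearMap.range i)) : IsShift R W Y := by
  obtain ⟨P, f, g, hP, hf, hg, hfg⟩ := h
  let c : P →ₗ[R] M ⧸ LinearMap.range i := (LinearMap.range i).mkQ ∘ₗ g
  have hc : Function.Surjective c := (Submodule.mkQ_surjective _).comp hg
  let e := LinearEquiv.ofInjective i hi
  have hmem : ∀ p : LinearMap.ker c, g p ∈ LinearMap.range i := fun p => by
    have : (LinearMap.range i).mkQ (g p) = 0 := p.2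
    simpa using this
  let s : LinearMap.ker c →ₗ[R] W := e.symm.toLinearMap ∘ₗ
    (g ∘ₗ (LinearMap.ker c).subtype).codRestrict _ hmem
  have hs : ∀ p, i (s p) = g p := fun p => by
    have : e (s p) = ⟨g p, hmem p⟩ := by
      simp only [s, LinearMap.comp_apply, LinearEquiv.coe_coe, LinearEquiv.apply_symm_apply]; rfl
    exact congrArg Subtype.val this
  refine ⟨ModuleCat.of R (LinearMap.ker c), f.codRestrict _ (fun y => ?_), s, hP.ker hk c hc,
    ?_, ?_, ?_⟩
  · rw [LinearMap.mem_ker, LinearMap.comp_apply, hfg.apply_apply_eq_zero, map_zero]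
  · intro a b hab
    exact hf (congrArg Subtype.val hab)
  · intro w
    obtain ⟨p, hp⟩ := hg (i w)
    refine ⟨⟨p, (Submodule.Quotient.mk_eq_zero _).mpr ⟨w, hp.symm⟩⟩, hi ?_⟩
    rw [hs]
    exact hp
  · intro p
    rw [← map_eq_zero_iff i hi, hs]
    constructor
    · intro h0
      obtain ⟨y, hy⟩ := (hfg _).mp h0
      exact ⟨y, Subtype.ext hy⟩
    · rintro ⟨y, rfl⟩
      exact hfg.apply_apply_eq_zero y

theorem IsShift.of_equiv {X' : Type u} [AddCommGroup X'] [Module R X'] (h : IsShift R X Y)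
    (e : X ≃ₗ[R] X') : IsShift R X' Y := by
  refine h.of_surjective e.symm.toLinearMap e.symm.surjective ?_
  rw [LinearEquiv.ker]
  exact InP.of_subsingleton

theorem IsShift.sim_of_isFilling [IsOrderLike R] [Finite M] {Y' : Type u} [AddCommGroup Y']
    [Module R Y'] (hX : IsFilling R X M) (h : IsShift R X Y) (h' : IsShift R M Y') :
    Sim R Y Y' := by
  obtain ⟨W, i, q, hi, hq, h1, h2⟩ := isFilling_iff.mp hX
  exact (h.of_surjective q hq h1).sim (h'.of_injective i hi h2)

theorem IsShift.sim_of_sim [IsOrderLike R] {X' Y' : Type u} [AddCommGroup X'] [Module R X']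
    [AddCommGroup Y'] [Module R Y'] (hX : Sim R X X') (h : IsShift R X Y)
    (h' : IsShift R X' Y') : Sim R Y Y' := by
  obtain ⟨M, hM, h1, h2⟩ := hX.exists_common
  obtain ⟨Z, hZ⟩ := exists_isShift (R := R) (X := M)
  exact (IsShift.sim_of_isFilling h1 h hZ).trans (IsShift.sim_of_isFilling h2 h' hZ).symm

theorem IsShift.prod {X' Y' : Type u} [AddCommGroup X'] [Module R X'] [AddCommGroup Y']
    [Module R Y'] (h : IsShift R X Y) (h' : IsShift R X' Y') :
    IsShift R (X × X') (Y × Y') := by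
  obtain ⟨P, f, g, hP, hf, hg, hfg⟩ := h
  obtain ⟨P', f', g', hP', hf', hg', hfg'⟩ := h'
  refine ⟨ModuleCat.of R (P × P'), f.prodMap f', g.prodMap g', hP.prod hP', hf.prodMap hf',
    hg.prodMap hg', ?_⟩
  rintro ⟨p, p'⟩
  constructor
  · intro h0
    obtain ⟨y, hy⟩ := (hfg p).mp (congrArg Prod.fst h0)
    obtain ⟨y', hy'⟩ := (hfg' p').mp (congrArg Prod.snd h0)
    exact ⟨(y, y'), Prod.ext hy hy'⟩
  · rintro ⟨⟨y, y'⟩, hy⟩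
    have h1 : f y = p := congrArg Prod.fst hy
    have h2 : f' y' = p' := congrArg Prod.snd hy
    rw [← h1, ← h2]
    exact Prod.ext (hfg.apply_apply_eq_zero y) (hfg'.apply_apply_eq_zero y')

end Modules

section ShiftHom

variable (R : Type u) [CommRing R] [IsOrderLike R]

/-- A chosen shift of a finite module. -/
noncomputable def FinMod.shift (X : FinMod R) : FinMod R :=
  have := X.2
  (exists_isShift (R := R) (X := X.1)).choose

variable {R} in
theorem FinMod.isShift_shift (X : FinMod R) : IsShift R X.1 (FinMod.shift R X).1 :=
  have := X.2
  (exists_isShift (R := R) (X := X.1)).choose_spec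

/-- The endomorphism `[X] ↦ [ω¹(X)]` of the monoid `𝒞/∼`. -/
noncomputable def shiftHom : SimClass R →+ SimClass R where
  toFun := Quotient.map (FinMod.shift R) (fun X Y h =>
    IsShift.sim_of_sim h X.isShift_shift Y.isShift_shift)
  map_zero' := by
    refine Quotient.sound (Sim.of_inP ?_ (InP.of_subsingleton (A := PUnit.{u + 1})))
    have h := FinMod.isShift_shift (R := R) ⟨ModuleCat.of R PUnit.{u + 1},
      inferInstanceAs (Finite PUnit)⟩
    obtain ⟨P, f, g, hP, hf, hg, hfg⟩ := h
    refine hP.of_equiv (LinearEquiv.ofBijective f ⟨hf, fun p => (hfg p).mp ?_⟩).symm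
    exact Subsingleton.elim (α := PUnit) _ _
  map_add' := by
    rintro ⟨X⟩ ⟨Y⟩
    exact Quotient.sound (IsShift.sim (X.sum Y).isShift_shift
      (X.isShift_shift.prod Y.isShift_shift))

variable {R}

theorem shiftHom_mk {X Y : FinMod R} (h : IsShift R X.1 Y.1) :
    shiftHom R (SimClass.mk X) = SimClass.mk Y :=
  Quotient.sound (IsShift.sim X.isShift_shift h)

end ShiftHom

/-! ### Classes of cyclic modules and primary parts -/

section Classes

variable {R : Type u} [CommRing R]

/-- The class of a finite module. -/
def SimClass.of (R : Type u) [CommRing R] (X : Type u) [AddCommGroup X] [Module R X] [Finite X] :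
    SimClass R :=
  SimClass.mk ⟨ModuleCat.of R X, inferInstanceAs (Finite X)⟩

variable {X Y M Z : Type u} [AddCommGroup X] [Module R X] [AddCommGroup Y] [Module R Y]
  [AddCommGroup M] [Module R M] [AddCommGroup Z] [Module R Z]

theorem Sim.of_eq [Finite X] [Finite Y] (h : Sim R X Y) : SimClass.of R X = SimClass.of R Y :=
  (SimClass.mk_eq_iff _ _).mpr h

theorem InP.of_eq_zero [Finite X] (h : InP R X) : SimClass.of R X = 0 :=
  (SimClass.mk_eq_iff _ _).mpr (Sim.of_inP h InP.of_subsingleton)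

open Classical in
/-- The class of the cyclic module `R / 𝔟`, with the junk value `0` if it is infinite. -/
noncomputable def quotClass (b : Ideal R) : SimClass R :=
  if _h : Finite (R ⧸ b) then SimClass.of R (R ⧸ b) else 0

theorem quotClass_eq (b : Ideal R) [Finite (R ⧸ b)] :
    quotClass b = SimClass.of R (R ⧸ b) := dif_pos _

theorem finite_quotient_of_le {a b : Ideal R} (h : a ≤ b) [Finite (R ⧸ a)] : Finite (R ⧸ b) :=
  Finite.of_surjective _ (Ideal.Quotient.factor_surjective h)

theorem finite_quotient_of_natCast_mem [IsOrderLike R] {b : Ideal R} {t : ℕ} (ht : t ≠ 0)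
    (h : (t : R) ∈ b) : Finite (R ⧸ b) := by
  have := IsOrderLike.finite_quotient (R := R) t ht
  exact finite_quotient_of_le ((Ideal.span_singleton_le_iff_mem _).mpr h)

theorem quotClass_top : quotClass (⊤ : Ideal R) = 0 := by
  have : Subsingleton (R ⧸ (⊤ : Ideal R)) := Ideal.Quotient.subsingleton_iff.mpr rfl
  rw [quotClass_eq]
  exact InP.of_eq_zero InP.of_subsingleton

theorem quotClass_eq_add [IsOrderLike R] {b : Ideal R} {r s : ℕ} (hrs : r.Coprime s)
    (h0 : r * s ≠ 0) (h : ((r * s : ℕ) : R) ∈ b) :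
    quotClass b = quotClass (b ⊔ Ideal.span {(r : R)}) + quotClass (b ⊔ Ideal.span {(s : R)}) := by
  have := finite_quotient_of_natCast_mem h0 h
  have := finite_quotient_of_le (le_sup_left : b ≤ b ⊔ Ideal.span {(r : R)})
  have := finite_quotient_of_le (le_sup_left : b ≤ b ⊔ Ideal.span {(s : R)})
  obtain ⟨u, v, huv⟩ := Nat.Coprime.isCoprime hrs
  have huv' : (u : R) * r + (v : R) * s = 1 := by exact_mod_cast congrArg (Int.cast : ℤ → R) huv
  have hrs' : (r : R) * s ∈ b := by simpa using h
  let f : R →ₗ[R] (R ⧸ b ⊔ Ideal.span {(r : R)}) × (R ⧸ b ⊔ Ideal.span {(s : R)}) :=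
    (Submodule.mkQ _).prod (Submodule.mkQ _)
  have hf : Function.Surjective f := by
    rintro ⟨x, y⟩
    obtain ⟨x, rfl⟩ := Submodule.mkQ_surjective _ x
    obtain ⟨y, rfl⟩ := Submodule.mkQ_surjective _ y
    refine ⟨v * s * x + u * r * y, Prod.ext ?_ ?_⟩
    · refine (Submodule.Quotient.eq _).mpr (Submodule.mem_sup_right
        (Ideal.mem_span_singleton'.mpr ⟨u * (y - x), ?_⟩))
      linear_combination -x * huv'
    · refine (Submodule.Quotient.eq _).mpr (Submodule.mem_sup_right
        (Ideal.mem_span_singleton'.mpr ⟨v * (x - y), ?_⟩))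
      linear_combination -y * huv'
  have hk : LinearMap.ker f = b := by
    ext x
    simp only [f, LinearMap.ker_prod, Submodule.ker_mkQ, Submodule.mem_inf]
    constructor
    · rintro ⟨h1, h2⟩
      obtain ⟨i, hi, j, hj, h1⟩ := Submodule.mem_sup.mp h1
      obtain ⟨i', hi', j', hj', h2⟩ := Submodule.mem_sup.mp h2
      obtain ⟨c, rfl⟩ := Ideal.mem_span_singleton'.mp hj
      obtain ⟨c', rfl⟩ := Ideal.mem_span_singleton'.mp hj'
      have : x = v * s * i + u * r * i' + (v * c + u * c') * (r * s) := by
        linear_combination (-x) * huv' - v * s * h1 - u * r * h2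
      rw [this]
      exact add_mem (add_mem (Ideal.mul_mem_left _ _ hi) (Ideal.mul_mem_left _ _ hi'))
        (Ideal.mul_mem_left _ _ hrs')
    · intro hx
      exact ⟨Submodule.mem_sup_left hx, Submodule.mem_sup_left hx⟩
  rw [quotClass_eq, quotClass_eq, quotClass_eq]
  exact (SimClass.mk_eq_iff _ _).mpr (Sim.of_equiv
    ((Submodule.quotEquivOfEq _ _ hk.symm).trans (LinearMap.quotKerEquivOfSurjective f hf)))

theorem sup_span_pow_eq_of_mem {b : Ideal R} {a c p N : ℕ} (hp : p.Coprime c)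
    (h : ((a * c : ℕ) : R) ∈ b) :
    b ⊔ Ideal.span {(a : R)} ⊔ Ideal.span {((p ^ N : ℕ) : R)} =
      b ⊔ Ideal.span {((p ^ N : ℕ) : R)} := by
  refine le_antisymm (sup_le (sup_le le_sup_left ?_) le_sup_right)
    (sup_le_sup_right le_sup_left _)
  obtain ⟨u, v, huv⟩ := Nat.Coprime.isCoprime (Nat.Coprime.pow_left N hp)
  have huv' : (u : R) * (p ^ N : ℕ) + (v : R) * c = 1 := by
    exact_mod_cast congrArg (Int.cast : ℤ → R) huv
  rw [Ideal.span_singleton_le_iff_mem]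
  have : (a : R) = v * (a * c : ℕ) + (a * u) * (p ^ N : ℕ) := by
    rw [Nat.cast_mul]
    linear_combination (-a : R) * huv'
  rw [this]
  exact add_mem (Submodule.mem_sup_left (Ideal.mul_mem_left _ _ h))
    (Submodule.mem_sup_right (Ideal.mul_mem_left _ _ (Ideal.mem_span_singleton_self _)))

/-- The primary decomposition of the class of a cyclic module. -/
theorem quotClass_eq_sum [IsOrderLike R] (N : ℕ) (z : ℕ) : ∀ (b : Ideal R), z ≠ 0 → (z : R) ∈ b →
    (∀ p, z.factorization p ≤ N) →
    quotClass b = ∑ p ∈ z.primeFactors, quotClass (b ⊔ Ideal.span {((p ^ N : ℕ) : R)}) := by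
  induction z using Nat.recOnPosPrimePosCoprime with
  | zero => intro _ h; exact absurd rfl h
  | one =>
    intro b _ h _
    have : b = ⊤ := (Ideal.eq_top_iff_one b).mpr (by simpa using h)
    simp [this, quotClass_top]
  | prime_pow p n hp hn =>
    intro b _ h hN
    rw [Nat.primeFactors_prime_pow hn.ne' hp, Finset.sum_singleton]
    have h1 : n ≤ N := by simpa [hp.factorization_pow] using hN p
    congr 1
    refine (sup_eq_left.mpr ?_).symm
    rw [Ideal.span_singleton_le_iff_mem, ← Nat.add_sub_of_le h1, pow_add, Nat.cast_mul]
    exact Ideal.mul_mem_right _ _ h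
  | coprime r s hr hs hrs ihr ihs =>
    intro b h0 h hN
    have hr0 : r ≠ 0 := by omega
    have hs0 : s ≠ 0 := by omega
    have h' : ((s * r : ℕ) : R) ∈ b := by rwa [mul_comm]
    have hN' : ∀ p, r.factorization p + s.factorization p ≤ N := fun p => by
      simpa [Nat.factorization_mul hr0 hs0] using hN p
    rw [quotClass_eq_add hrs h0 h, hrs.primeFactors_mul,
      Finset.sum_union hrs.disjoint_primeFactors,
      ihr _ hr0 (Submodule.mem_sup_right (Ideal.mem_span_singleton_self _))
        (fun p => (Nat.le_add_right _ _).trans (hN' p)),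
      ihs _ hs0 (Submodule.mem_sup_right (Ideal.mem_span_singleton_self _))
        (fun p => (Nat.le_add_left _ _).trans (hN' p))]
    congr 1
    · refine Finset.sum_congr rfl fun p hp => ?_
      rw [sup_span_pow_eq_of_mem (Nat.Coprime.coprime_dvd_left (Nat.dvd_of_mem_primeFactors hp)
        hrs) h]
    · refine Finset.sum_congr rfl fun p hp => ?_
      rw [sup_span_pow_eq_of_mem (Nat.Coprime.coprime_dvd_left (Nat.dvd_of_mem_primeFactors hp)
        hrs.symm) h']

/-- If `K ⊆ Z` belongs to `𝒫`, then so does its image in the `p`-primary part `Z / p ^ N Z`. -/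
theorem sim_quotient_range_pow {p N s t : ℕ} (hp : p.Coprime t) (hs : s ≤ N) [Finite Z]
    (hz : ∀ z : Z, (p ^ s * t) • z = 0) (K : Submodule R Z) (hK : InP R K) (r : Z →ₗ[R] X)
    (hr : Function.Surjective r)
    (hker : LinearMap.ker r = K ⊔ LinearMap.range (LinearMap.lsmul R Z ((p ^ N : ℕ) : R))) :
    Sim R (Z ⧸ LinearMap.range (LinearMap.lsmul R Z ((p ^ N : ℕ) : R))) X := by
  obtain ⟨u, v, huv⟩ := Nat.Coprime.isCoprime (Nat.Coprime.pow_left N hp)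
  have huv' : (u : R) * (p ^ N : ℕ) + (v : R) * t = 1 := by
    exact_mod_cast congrArg (Int.cast : ℤ → R) huv
  set P := LinearMap.range (LinearMap.lsmul R Z ((p ^ N : ℕ) : R)) with hP
  have hle : P ≤ LinearMap.ker r := hker ▸ le_sup_right
  let q : Z ⧸ P →ₗ[R] X := P.liftQ r hle
  have hq : Function.Surjective q := fun x => by
    obtain ⟨z, rfl⟩ := hr x
    exact ⟨P.mkQ z, rfl⟩
  have : Finite (Z ⧸ P) := Finite.of_surjective _ P.mkQ_surjective
  refine Sim.of_surjective q hq ?_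
  -- multiplication by `c = v t` is the projection onto the `p`-primary part
  have hc : ∀ z : Z, ((p ^ N : ℕ) : R) • ((v : R) * t) • z = 0 := fun z => by
    have : ((p ^ N : ℕ) : R) * ((v : R) * t) = v * (p ^ (N - s) : ℕ) * ((p ^ s * t : ℕ) : R) := by
      rw [← Nat.add_sub_of_le hs, pow_add]
      push_cast
      rw [Nat.add_sub_cancel_left]
      ring
    rw [smul_smul, this, mul_smul, Nat.cast_smul_eq_nsmul, hz, smul_zero]
  let i₀ : Z ⧸ P →ₗ[R] Z := P.liftQ (LinearMap.lsmul R Z ((v : R) * t)) (by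
    rintro _ ⟨z, rfl⟩
    rw [LinearMap.mem_ker]
    simp only [LinearMap.lsmul_apply]
    rw [smul_comm, hc])
  have hi₀ : ∀ z, i₀ (P.mkQ z) = ((v : R) * t) • z := fun z => rfl
  have hmem : ∀ x : LinearMap.ker q, i₀ x ∈ K := by
    rintro ⟨x, hx⟩
    obtain ⟨z, rfl⟩ := P.mkQ_surjective x
    have hz' : z ∈ K ⊔ P := hker ▸ hx
    obtain ⟨k, hk, _, ⟨y, rfl⟩, rfl⟩ := Submodule.mem_sup.mp hz'
    change i₀ (P.mkQ _) ∈ K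
    rw [hi₀, smul_add, LinearMap.lsmul_apply, smul_comm, hc, add_zero]
    exact K.smul_mem _ hk
  let i : LinearMap.ker q →ₗ[R] K := (i₀ ∘ₗ (LinearMap.ker q).subtype).codRestrict K hmem
  let ρ : K →ₗ[R] LinearMap.ker q := (P.mkQ ∘ₗ K.subtype).codRestrict _ (fun k => by
    have : (k : Z) ∈ LinearMap.ker r := hker ▸ Submodule.mem_sup_left k.2
    exact this)
  refine hK.of_retract i ρ ?_
  rintro ⟨x, hx⟩
  obtain ⟨z, rfl⟩ := P.mkQ_surjective x
  apply Subtype.ext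
  change P.mkQ (((v : R) * t) • z) = P.mkQ z
  rw [← sub_eq_zero, ← map_sub]
  refine (Submodule.Quotient.mk_eq_zero _).mpr ⟨-(u : R) • z, ?_⟩
  rw [LinearMap.lsmul_apply, smul_smul]
  have : ((p ^ N : ℕ) : R) * -(u : R) = (v : R) * t - 1 := by linear_combination -huv'
  rw [this, sub_smul, one_smul]

theorem ker_factor_eq (D E : Submodule R M) (h : D ≤ E) :
    LinearMap.ker (Submodule.factor h) = E.map D.mkQ := by
  ext x
  obtain ⟨m, rfl⟩ := D.mkQ_surjective x
  constructor
  · intro hx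
    have : m ∈ E := (Submodule.Quotient.mk_eq_zero _).mp hx
    exact ⟨m, this, rfl⟩
  · rintro ⟨m', hm', he⟩
    rw [← he]
    exact (Submodule.Quotient.mk_eq_zero _).mpr hm'

/-- The image of a free rank one submodule `R e` in `M / R s e` is `R / s`. -/
theorem equiv_map_span_singleton (e : M) (he : ∀ x : R, x • e = 0 → x = 0) (s : R) (d : M)
    (hd : d = s • e) : Nonempty ((R ⧸ Ideal.span {s}) ≃ₗ[R]
      (Submodule.span R {e}).map (Submodule.span R {d}).mkQ) := by
  subst hd
  let f : R →ₗ[R] (Submodule.span R {e}).map (Submodule.span R {s • e}).mkQ :=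
    ((Submodule.span R {s • e}).mkQ ∘ₗ LinearMap.toSpanSingleton R M e).codRestrict _ (fun x =>
      ⟨x • e, Submodule.smul_mem _ _ (Submodule.mem_span_singleton_self e), rfl⟩)
  have hf : Function.Surjective f := by
    rintro ⟨_, m, hm, rfl⟩
    obtain ⟨x, rfl⟩ := Submodule.mem_span_singleton.mp hm
    exact ⟨x, rfl⟩
  have hk : LinearMap.ker f = Ideal.span {s} := by
    ext x
    have : x ∈ LinearMap.ker f ↔ x • e ∈ Submodule.span R {s • e} := by
      rw [LinearMap.mem_ker, Subtype.ext_iff]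
      exact Submodule.Quotient.mk_eq_zero _
    rw [this, Submodule.mem_span_singleton, Ideal.mem_span_singleton']
    refine exists_congr fun c => ?_
    rw [smul_smul]
    constructor
    · intro h
      rw [← sub_eq_zero]
      exact he _ (by rw [sub_smul, h, sub_self])
    · intro h
      rw [h]
  exact ⟨(Submodule.quotEquivOfEq _ _ hk.symm).trans (LinearMap.quotKerEquivOfSurjective f hf)⟩

/-- The quotients of a module by two free submodules of rank one with finite index have equivalent
`p`-primary parts. -/
theorem exists_forall_sim_quotient_span_singleton [IsOrderLike R] (e₁ e₂ : M)
    (he₁ : ∀ x : R, x • e₁ = 0 → x = 0) (he₂ : ∀ x : R, x • e₂ = 0 → x = 0)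
    [Finite (M ⧸ Submodule.span R {e₁})] [Finite (M ⧸ Submodule.span R {e₂})] (p : ℕ)
    (hp : p.Prime) : ∃ N₀, ∀ N, N₀ ≤ N →
      Sim R (M ⧸ Submodule.span R {e₁} ⊔ LinearMap.range (LinearMap.lsmul R M ((p ^ N : ℕ) : R)))
        (M ⧸ Submodule.span R {e₂} ⊔ LinearMap.range (LinearMap.lsmul R M ((p ^ N : ℕ) : R))) := by
  have ht : Nat.card (M ⧸ Submodule.span R {e₂}) ≠ 0 :=
    Nat.card_ne_zero.mpr ⟨inferInstance, inferInstance⟩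
  set t := Nat.card (M ⧸ Submodule.span R {e₂}) with ht'
  obtain ⟨s, hs⟩ : ∃ s : R, s • e₂ = (t : R) • e₁ := by
    rw [← Submodule.mem_span_singleton, ← Submodule.Quotient.mk_eq_zero, Submodule.Quotient.mk_smul,
      Nat.cast_smul_eq_nsmul, ht', card_nsmul_eq_zero']
  have hs0 : ∀ x, s * x = 0 → x = 0 := fun x hx => by
    have h1 : ((t : R) * x) • e₁ = 0 := by
      rw [mul_comm, mul_smul, ← hs, smul_smul, mul_comm x, hx, zero_smul]
    exact IsOrderLike.natCast_mul_eq_zero t x ht (he₁ _ h1)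
  set d := (t : R) • e₁ with hd
  let D := Submodule.span R {d}
  have hD₁ : D ≤ Submodule.span R {e₁} := by
    rw [Submodule.span_singleton_le_iff_mem]
    exact Submodule.smul_mem _ _ (Submodule.mem_span_singleton_self _)
  have hD₂ : D ≤ Submodule.span R {e₂} := by
    rw [Submodule.span_singleton_le_iff_mem, ← hs]
    exact Submodule.smul_mem _ _ (Submodule.mem_span_singleton_self _)
  obtain ⟨E₁⟩ := equiv_map_span_singleton e₁ he₁ (t : R) d rfl
  obtain ⟨E₂⟩ := equiv_map_span_singleton e₂ he₂ s d hs.symm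
  have hft := IsOrderLike.finite_quotient (R := R) t ht
  have hZ : Finite (M ⧸ D) := by
    have h1 : Finite ((Submodule.span R {e₁}).map D.mkQ) := Finite.of_equiv _ E₁.toEquiv
    have h2 : Finite (LinearMap.ker (Submodule.factor hD₁)) := by
      rw [ker_factor_eq]; exact h1
    exact finite_of_exact (LinearMap.ker (Submodule.factor hD₁)).subtype (Submodule.factor hD₁)
      (LinearMap.exact_subtype_ker_map _)
  have hK₁ : InP R ((Submodule.span R {e₁}).map D.mkQ) :=
    (InP.quotient_span_singleton (t : R)
      (fun x => IsOrderLike.natCast_mul_eq_zero t x ht)).of_equiv E₁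
  have hK₂ : InP R ((Submodule.span R {e₂}).map D.mkQ) := by
    have : Finite (R ⧸ Ideal.span {s}) := Finite.of_equiv _ E₂.symm.toEquiv
    exact (InP.quotient_span_singleton s hs0).of_equiv E₂
  have hz0 : Nat.card (M ⧸ D) ≠ 0 := Nat.card_ne_zero.mpr ⟨inferInstance, inferInstance⟩
  obtain ⟨n, m, hm, hnm⟩ := Nat.exists_eq_pow_mul_and_not_dvd hz0 p hp.ne_one
  have hkill : ∀ z : M ⧸ D, (p ^ n * m) • z = 0 := fun z => by
    rw [← hnm, card_nsmul_eq_zero']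
  have key : ∀ (N : ℕ), n ≤ N → ∀ e : M, D ≤ Submodule.span R {e} →
      InP R ((Submodule.span R {e}).map D.mkQ) →
      Sim R ((M ⧸ D) ⧸ LinearMap.range (LinearMap.lsmul R (M ⧸ D) ((p ^ N : ℕ) : R)))
        (M ⧸ Submodule.span R {e} ⊔
          LinearMap.range (LinearMap.lsmul R M ((p ^ N : ℕ) : R))) := by
    intro N hN e hle hP
    have hle' := hle.trans (le_sup_left (b := LinearMap.range
      (LinearMap.lsmul R M ((p ^ N : ℕ) : R))))
    refine sim_quotient_range_pow ((hp.coprime_iff_not_dvd).mpr hm) hN hkill _ hP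
      (Submodule.factor hle') (Submodule.factor_surjective _) ?_
    rw [ker_factor_eq, Submodule.map_sup]
    congr 1
    ext x
    constructor
    · rintro ⟨_, ⟨y, rfl⟩, rfl⟩
      exact ⟨D.mkQ y, rfl⟩
    · rintro ⟨y, rfl⟩
      obtain ⟨y, rfl⟩ := D.mkQ_surjective y
      exact ⟨_, ⟨y, rfl⟩, rfl⟩
  exact ⟨n, fun N hN => (key N hN e₁ hD₁ hK₁).symm.trans (key N hN e₂ hD₂ hK₂)⟩

end Classes

/-! ### Augmentation ideals of group rings -/

section GroupRing

open MonoidAlgebra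

variable {k : Type v} [CommRing k] {Γ : Type u} [CommGroup Γ]

variable (k) in
/-- The kernel of `k[Γ] → k[Γ/U]`, given by its generators `u - 1` with `u` in `U`. -/
noncomputable def augIdeal (U : Subgroup Γ) : Ideal (MonoidAlgebra k Γ) :=
  Ideal.span {x | ∃ u ∈ U, x = of k Γ u - 1}

theorem of_sub_one_mem {U : Subgroup Γ} {u : Γ} (hu : u ∈ U) : of k Γ u - 1 ∈ augIdeal k U :=
  Ideal.subset_span ⟨u, hu, rfl⟩

theorem augIdeal_le {U : Subgroup Γ} {J : Ideal (MonoidAlgebra k Γ)} :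
    augIdeal k U ≤ J ↔ ∀ u ∈ U, of k Γ u - 1 ∈ J := by
  refine ⟨fun h u hu => h (of_sub_one_mem hu), fun h => Ideal.span_le.mpr ?_⟩
  rintro _ ⟨u, hu, rfl⟩
  exact h u hu

theorem augIdeal_mono {U V : Subgroup Γ} (h : U ≤ V) : augIdeal k U ≤ augIdeal k V :=
  augIdeal_le.mpr fun _ hu => of_sub_one_mem (h hu)

/-- The group elements that act trivially on `k[Γ] / J`. -/
noncomputable def trivialOn (J : Ideal (MonoidAlgebra k Γ)) : Subgroup Γ where
  carrier := {g | of k Γ g - 1 ∈ J}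
  one_mem' := by
    change of k Γ 1 - 1 ∈ J
    rw [map_one, sub_self]
    exact J.zero_mem
  mul_mem' := fun {a b} ha hb => by
    have : of k Γ (a * b) - 1 = of k Γ a * (of k Γ b - 1) + (of k Γ a - 1) := by
      rw [map_mul]; ring
    change _ - 1 ∈ J
    rw [this]
    exact add_mem (J.mul_mem_left _ hb) ha
  inv_mem' := fun {a} ha => by
    have h1 : of k Γ a⁻¹ * of k Γ a = 1 := by rw [← map_mul, inv_mul_cancel, map_one]
    have : of k Γ a⁻¹ - 1 = (-of k Γ a⁻¹) * (of k Γ a - 1) := by linear_combination h1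
    change _ - 1 ∈ J
    rw [this]
    exact J.mul_mem_left _ ha

theorem mem_trivialOn {J : Ideal (MonoidAlgebra k Γ)} {g : Γ} :
    g ∈ trivialOn J ↔ of k Γ g - 1 ∈ J := Iff.rfl

theorem augIdeal_le_iff_le_trivialOn {U : Subgroup Γ} {J : Ideal (MonoidAlgebra k Γ)} :
    augIdeal k U ≤ J ↔ U ≤ trivialOn J := augIdeal_le

theorem augIdeal_sup (U V : Subgroup Γ) : augIdeal k (U ⊔ V) = augIdeal k U ⊔ augIdeal k V := by
  refine le_antisymm ?_ (sup_le (augIdeal_mono le_sup_left) (augIdeal_mono le_sup_right))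
  rw [augIdeal_le_iff_le_trivialOn, sup_le_iff, ← augIdeal_le_iff_le_trivialOn,
    ← augIdeal_le_iff_le_trivialOn]
  exact ⟨le_sup_left, le_sup_right⟩

theorem augIdeal_bot : augIdeal k (⊥ : Subgroup Γ) = ⊥ := by
  rw [eq_bot_iff, augIdeal_le]
  intro u hu
  rw [Subgroup.mem_bot.mp hu, map_one, sub_self]
  exact zero_mem _

variable (k) in
/-- The projection `k[Γ] → k[Γ/U]`. -/
noncomputable abbrev proj (U : Subgroup Γ) : MonoidAlgebra k Γ →+* MonoidAlgebra k (Γ ⧸ U) :=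
  mapDomainRingHom k (QuotientGroup.mk' U)

theorem proj_of (U : Subgroup Γ) (g : Γ) :
    proj k U (of k Γ g) = of k (Γ ⧸ U) (g : Γ ⧸ U) := by
  simp [of_apply]

theorem proj_surjective (U : Subgroup Γ) : Function.Surjective (proj k U) := by
  intro x
  induction x using MonoidAlgebra.induction_linear with
  | zero => exact ⟨0, map_zero _⟩
  | add x y hx hy =>
    obtain ⟨a, rfl⟩ := hx
    obtain ⟨b, rfl⟩ := hy
    exact ⟨a + b, map_add _ _ _⟩
  | single q r =>
    obtain ⟨g, rfl⟩ := QuotientGroup.mk_surjective q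
    exact ⟨single g r, by simp⟩

theorem ker_proj (U : Subgroup Γ) : RingHom.ker (proj k U) = augIdeal k U := by
  refine le_antisymm (fun x hx => ?_) (augIdeal_le.mpr fun u hu => ?_)
  · -- modulo the augmentation ideal, `x` is the lift of its image along a section of `Γ → Γ/U`
    have key : ∀ x : MonoidAlgebra k Γ,
        x - mapDomain Quotient.out (proj k U x) ∈ augIdeal k U := by
      intro x
      induction x using MonoidAlgebra.induction_linear with
      | zero => simp
      | add x y hx hy =>
        have := add_mem hx hy
        rw [map_add, mapDomain_add]
        convert this using 1
        abel
      | single g r =>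
        obtain ⟨u, hu⟩ := QuotientGroup.mk_out_eq_mul U g
        have : single g r - mapDomain Quotient.out (proj k U (single g r)) =
            - single g r * (of k Γ (u : Γ) - 1) := by
          have h1 : proj k U (single g r) = single (g : Γ ⧸ U) r := by simp
          rw [h1, mapDomain_single, hu, of_apply, mul_sub, neg_mul, single_mul_single]
          simp only [mul_one]
          abel
        rw [this]
        exact Ideal.mul_mem_left _ _ (of_sub_one_mem u.2)
    have h0 : proj k U x = 0 := hx
    simpa [h0] using key x
  · rw [RingHom.mem_ker, map_sub, proj_of, (QuotientGroup.eq_one_iff u).mpr hu, map_one, map_one,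
      sub_self]

theorem proj_eq_iff {U : Subgroup Γ} {x y : MonoidAlgebra k Γ} :
    proj k U x = proj k U y ↔ x - y ∈ augIdeal k U := by
  rw [← ker_proj, RingHom.mem_ker, map_sub, sub_eq_zero]

/-- Reduction modulo `t` identifies `k[Γ/U] / t` with the functions from `Γ/U` to `k / t`. -/
theorem nonempty_quotient_equiv_fun [Finite Γ] (U : Subgroup Γ) (t : ℕ) :
    Nonempty ((MonoidAlgebra k Γ ⧸ augIdeal k U ⊔ Ideal.span {(t : MonoidAlgebra k Γ)}) ≃
      (Γ ⧸ U → k ⧸ Ideal.span {(t : k)})) := by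
  let c : MonoidAlgebra k Γ →+ (Γ ⧸ U → k ⧸ Ideal.span {(t : k)}) :=
    { toFun := fun x q => Ideal.Quotient.mk _ ((proj k U x).coeff q)
      map_zero' := by ext q; simp
      map_add' := fun x y => by ext q; rw [map_add]; rfl }
  have hc : Function.Surjective c := fun f => by
    choose g hg using fun q => Ideal.Quotient.mk_surjective (f q)
    obtain ⟨x, hx⟩ := proj_surjective U (ofCoeff (Finsupp.equivFunOnFinite.symm g))
    refine ⟨x, ?_⟩
    ext q
    change Ideal.Quotient.mk _ ((proj k U x).coeff q) = f q
    rw [hx, ← hg]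
    rfl
  have hk : c.ker =
      (augIdeal k U ⊔ Ideal.span {(t : MonoidAlgebra k Γ)}).toAddSubgroup := by
    ext x
    constructor
    · intro hx
      have h1 : ∀ q, ∃ y, y * (t : k) = (proj k U x).coeff q := fun q => by
        have h2 : Ideal.Quotient.mk _ ((proj k U x).coeff q) = 0 := congrFun hx q
        exact Ideal.mem_span_singleton'.mp (Ideal.Quotient.eq_zero_iff_mem.mp h2)
      choose y hy using h1
      obtain ⟨x', hx'⟩ := proj_surjective U (ofCoeff (Finsupp.equivFunOnFinite.symm y))
      have h3 : proj k U x = proj k U (x' * (t : MonoidAlgebra k Γ)) := by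
        rw [map_mul, hx', map_natCast]
        ext q
        rw [natCast_def, coeff_mul_single_one, ← hy]
        rfl
      have h4 := proj_eq_iff.mp h3
      have : x = (x - x' * (t : MonoidAlgebra k Γ)) + x' * (t : MonoidAlgebra k Γ) := by ring
      change x ∈ augIdeal k U ⊔ _
      rw [this]
      exact add_mem (Submodule.mem_sup_left h4)
        (Submodule.mem_sup_right (Ideal.mul_mem_left _ _ (Ideal.mem_span_singleton_self _)))
    · intro hx
      obtain ⟨i, hi, j, hj, rfl⟩ := Submodule.mem_sup.mp hx
      obtain ⟨y, rfl⟩ := Ideal.mem_span_singleton'.mp hj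
      ext q
      change Ideal.Quotient.mk _ ((proj k U (i + y * _)).coeff q) = 0
      have h0 : proj k U i = 0 := by rwa [← ker_proj, RingHom.mem_ker] at hi
      rw [map_add, h0, zero_add, map_mul, map_natCast, natCast_def, coeff_mul_single_one,
        Ideal.Quotient.eq_zero_iff_mem]
      exact Ideal.mul_mem_left _ _ (Ideal.mem_span_singleton_self _)
  exact ⟨(QuotientAddGroup.quotientAddEquivOfEq hk.symm).toEquiv.trans
    (QuotientAddGroup.quotientKerEquivOfSurjective c hc).toEquiv⟩

theorem card_quotient_augIdeal_sup [Finite Γ] (U : Subgroup Γ) (t : ℕ) :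
    Nat.card (MonoidAlgebra k Γ ⧸ augIdeal k U ⊔ Ideal.span {(t : MonoidAlgebra k Γ)}) =
      Nat.card (k ⧸ Ideal.span {(t : k)}) ^ U.index := by
  obtain ⟨e⟩ := nonempty_quotient_equiv_fun (k := k) U t
  rw [Nat.card_congr e, Nat.card_fun, Subgroup.index]

theorem coeff_natCast_mul (t : ℕ) (x : MonoidAlgebra k Γ) (g : Γ) :
    ((t : MonoidAlgebra k Γ) * x).coeff g = (t : k) * x.coeff g := by
  rw [natCast_def, coeff_single_one_mul]

instance [IsOrderLike k] [Finite Γ] : IsOrderLike (MonoidAlgebra k Γ) where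
  natCast_mul_eq_zero t x ht h := by
    ext g
    refine IsOrderLike.natCast_mul_eq_zero t _ ht ?_
    rw [← coeff_natCast_mul, h]
    rfl
  finite_quotient t ht := by
    obtain ⟨e⟩ := nonempty_quotient_equiv_fun (k := k) (⊥ : Subgroup Γ) t
    rw [augIdeal_bot, bot_sup_eq] at e
    have := IsOrderLike.finite_quotient (R := k) t ht
    exact Finite.of_equiv _ e.symm

/-! ### Cohomological triviality -/

variable (k) in
/-- The norm element `N_U`, the sum of the elements of `U`. -/
noncomputable def normElt (U : Subgroup Γ) : MonoidAlgebra k Γ := ∑ᶠ u : U, of k Γ (u : Γ)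

theorem normElt_eq_sum (U : Subgroup Γ) [Fintype U] :
    normElt k U = ∑ u : U, of k Γ (u : Γ) := finsum_eq_sum_of_fintype _

theorem of_mul_normElt [Finite Γ] {U : Subgroup Γ} {u : Γ} (hu : u ∈ U) :
    of k Γ u * normElt k U = normElt k U := by
  cases nonempty_fintype U
  rw [normElt_eq_sum, Finset.mul_sum]
  refine Fintype.sum_equiv (Equiv.mulLeft (⟨u, hu⟩ : U)) _ _ fun w => ?_
  rw [← map_mul]
  rfl

theorem mul_normElt_eq_zero [Finite Γ] {U : Subgroup Γ} {x : MonoidAlgebra k Γ}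
    (hx : x ∈ augIdeal k U) : x * normElt k U = 0 := by
  have : augIdeal k U ≤ LinearMap.ker (LinearMap.mulRight (MonoidAlgebra k Γ) (normElt k U)) := by
    rw [augIdeal_le]
    intro u hu
    rw [LinearMap.mem_ker, LinearMap.mulRight_apply, sub_mul, of_mul_normElt hu, one_mul, sub_self]
  exact this hx

theorem normElt_sub_card_mem [Finite Γ] (U : Subgroup Γ) :
    normElt k U - (Nat.card U : MonoidAlgebra k Γ) ∈ augIdeal k U := by
  cases nonempty_fintype U
  have : normElt k U - (Nat.card U : MonoidAlgebra k Γ) = ∑ u : U, (of k Γ (u : Γ) - 1) := by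
    rw [normElt_eq_sum, Finset.sum_sub_distrib, Nat.card_eq_fintype_card]
    simp
  rw [this]
  exact sum_mem fun u _ => of_sub_one_mem u.2

section Modules

variable {X Y : Type*} [AddCommGroup X] [Module (MonoidAlgebra k Γ) X]
  [AddCommGroup Y] [Module (MonoidAlgebra k Γ) Y]

variable (k) in
/-- A `k[Γ]`-module is weakly projective for `U` if its identity is the trace from the trivial
group to `U` of an additive endomorphism. -/
def IsWeaklyProjective (U : Subgroup Γ) (X : Type*) [AddCommGroup X]
    [Module (MonoidAlgebra k Γ) X] : Prop :=
  ∃ θ : X →+ X, ∀ x, ∑ᶠ u : U, of k Γ (u : Γ) • θ (of k Γ (u : Γ)⁻¹ • x) = x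

theorem of_inv_smul_smul (g : Γ) (x : X) : of k Γ g⁻¹ • of k Γ g • x = x := by
  rw [smul_smul, ← map_mul, inv_mul_cancel, map_one, one_smul]

/-- The projection of `k[Γ]` onto the span of a transversal of `U` shows that `k[Γ]` is weakly
projective. -/
theorem isWeaklyProjective_self [Finite Γ] (U : Subgroup Γ) :
    IsWeaklyProjective k U (MonoidAlgebra k Γ) := by
  classical
  cases nonempty_fintype U
  let T : Γ → Prop := fun g => (g : Γ ⧸ U).out = g
  let θ : MonoidAlgebra k Γ →+ MonoidAlgebra k Γ :=
    (coeffAddEquiv.symm.toAddMonoidHom.comp (Finsupp.filterAddHom T)).comp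
      coeffAddEquiv.toAddMonoidHom
  have hθ : ∀ g r, θ (single g r) = if T g then single g r else 0 := fun g r => by
    change ofCoeff (Finsupp.filter T (Finsupp.single g r)) = _
    split_ifs with h
    · rw [Finsupp.filter_single_of_pos _ h]; rfl
    · rw [Finsupp.filter_single_of_neg _ h]; rfl
  refine ⟨θ, fun x => ?_⟩
  rw [finsum_eq_sum_of_fintype]
  induction x using MonoidAlgebra.induction_linear with
  | zero => simp
  | add x y hx hy =>
    simp only [smul_add, map_add, Finset.sum_add_distrib, hx, hy]
  | single g r =>
    have h1 : ∀ u : U, of k Γ (u : Γ) • θ (of k Γ (u : Γ)⁻¹ • single g r) =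
        if T ((u : Γ)⁻¹ * g) then single g r else 0 := fun u => by
      rw [smul_eq_mul, smul_eq_mul, of_apply, of_apply, single_mul_single, one_mul, hθ]
      split_ifs
      · rw [single_mul_single, one_mul, mul_inv_cancel_left]
      · rw [mul_zero]
    rw [Finset.sum_congr rfl fun u _ => h1 u]
    obtain ⟨w, hw⟩ := QuotientGroup.mk_out_eq_mul U g
    rw [Finset.sum_eq_single w⁻¹]
    · rw [if_pos]
      change Quotient.out (QuotientGroup.mk _ : Γ ⧸ U) = _
      have : ((((w⁻¹ : U) : Γ)⁻¹ * g : Γ) : Γ ⧸ U) = g := by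
        rw [QuotientGroup.eq]
        simp [mul_comm, w.2]
      rw [this, hw]
      simp [mul_comm]
    · intro u _ hu
      rw [if_neg]
      intro h
      apply hu
      have h2 : (((u : Γ)⁻¹ * g : Γ) : Γ ⧸ U) = g := by
        rw [QuotientGroup.eq]
        simp [mul_comm]
      change Quotient.out (QuotientGroup.mk _ : Γ ⧸ U) = _ at h
      rw [h2, hw, mul_comm] at h
      have h3 := mul_right_cancel h
      rw [eq_inv_iff_mul_eq_one, ← inv_eq_iff_mul_eq_one]
      exact Subtype.ext h3.symm
    · intro h
      exact absurd (Finset.mem_univ _) h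

theorem IsWeaklyProjective.of_retract {U : Subgroup Γ} [Finite Γ] (h : IsWeaklyProjective k U Y)
    (i : X →ₗ[MonoidAlgebra k Γ] Y) (r : Y →ₗ[MonoidAlgebra k Γ] X) (hr : ∀ x, r (i x) = x) :
    IsWeaklyProjective k U X := by
  obtain ⟨θ, hθ⟩ := h
  cases nonempty_fintype U
  refine ⟨(r.toAddMonoidHom.comp θ).comp i.toAddMonoidHom, fun x => ?_⟩
  conv_rhs => rw [← hr x, ← hθ (i x)]
  rw [finsum_eq_sum_of_fintype, finsum_eq_sum_of_fintype, map_sum]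
  refine Finset.sum_congr rfl fun u _ => ?_
  change of k Γ (u : Γ) • r (θ (i _)) = _
  rw [map_smul r, map_smul i]

theorem isWeaklyProjective_finsupp [Finite Γ] (U : Subgroup Γ) (ι : Type*) :
    IsWeaklyProjective k U (ι →₀ MonoidAlgebra k Γ) := by
  obtain ⟨θ, hθ⟩ := isWeaklyProjective_self (k := k) U
  cases nonempty_fintype U
  refine ⟨Finsupp.mapRange.addMonoidHom θ, fun x => ?_⟩
  ext1 i
  rw [finsum_eq_sum_of_fintype, Finsupp.finsetSum_apply]
  conv_rhs => rw [← hθ (x i), finsum_eq_sum_of_fintype]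
  rfl

theorem isWeaklyProjective_of_projective [Finite Γ] (U : Subgroup Γ)
    [h : Module.Projective (MonoidAlgebra k Γ) X] : IsWeaklyProjective k U X := by
  obtain ⟨s, hs⟩ := Module.projective_def'.mp h
  exact (isWeaklyProjective_finsupp U X).of_retract s
    (Finsupp.linearCombination (MonoidAlgebra k Γ) id) (fun x => LinearMap.congr_fun hs x)

namespace IsWeaklyProjective

variable {U : Subgroup Γ} [Finite Γ]

/-- The vanishing of `Ĥ⁰(U, X / t X)`. -/
theorem exists_eq_norm_add (h : IsWeaklyProjective k U X) (t : ℕ) (x : X)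
    (hx : ∀ u ∈ U, ∃ y, of k Γ u • x = x + t • y) : ∃ y₀ y₁, x = normElt k U • y₀ + t • y₁ := by
  obtain ⟨θ, hθ⟩ := h
  cases nonempty_fintype U
  choose! y hy using hx
  refine ⟨θ x, ∑ u : U, of k Γ (u : Γ) • θ (y (u : Γ)⁻¹), ?_⟩
  conv_lhs => rw [← hθ x, finsum_eq_sum_of_fintype]
  rw [normElt_eq_sum, Finset.sum_smul, Finset.smul_sum, ← Finset.sum_add_distrib]
  refine Finset.sum_congr rfl fun u _ => ?_
  rw [hy _ (U.inv_mem u.2), map_add, map_nsmul, smul_add, smul_comm]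

/-- The vanishing of `Ĥ⁻¹(U, X / t X)`. -/
theorem mem_of_norm_eq (h : IsWeaklyProjective k U X) (t : ℕ) (x y : X)
    (hx : normElt k U • x = t • y) :
    ∃ z, x - t • z ∈ augIdeal k U • (⊤ : Submodule (MonoidAlgebra k Γ) X) := by
  obtain ⟨θ, hθ⟩ := h
  cases nonempty_fintype U
  refine ⟨θ y, ?_⟩
  have h1 : normElt k U • x = ∑ u : U, of k Γ (u : Γ)⁻¹ • x := by
    rw [normElt_eq_sum, Finset.sum_smul]
    exact Fintype.sum_equiv (Equiv.inv U) _ _ fun u => by simp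
  have h2 : x - t • θ y = ∑ u : U, (of k Γ (u : Γ) - 1) • θ (of k Γ (u : Γ)⁻¹ • x) := by
    rw [← map_nsmul, ← hx, h1, map_sum]
    conv_lhs => enter [1]; rw [← hθ x, finsum_eq_sum_of_fintype]
    rw [← Finset.sum_sub_distrib]
    exact Finset.sum_congr rfl fun u _ => by rw [sub_smul, one_smul]
  rw [h2]
  exact sum_mem fun u _ => Submodule.smul_mem_smul (of_sub_one_mem u.2) Submodule.mem_top

/-- The vanishing of `H¹(U, X / t X)`. -/
theorem exists_cobounding (h : IsWeaklyProjective k U X) (t : ℕ) (d : Γ → X)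
    (hd : ∀ u ∈ U, ∀ v ∈ U, ∃ y, d (u * v) = d u + of k Γ u • d v + t • y) :
    ∃ x, ∀ u ∈ U, ∃ y, d u = of k Γ u • x - x + t • y := by
  obtain ⟨θ, hθ⟩ := h
  cases nonempty_fintype U
  choose! e he using hd
  refine ⟨-∑ v : U, of k Γ (v : Γ) • θ (of k Γ (v : Γ)⁻¹ • d v), fun u hu => ?_⟩
  let u' : U := ⟨u, hu⟩
  refine ⟨-∑ w : U, of k Γ (w : Γ) • θ (of k Γ (w : Γ)⁻¹ • e u (u⁻¹ * w)), ?_⟩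
  have h1 : of k Γ u • ∑ v : U, of k Γ (v : Γ) • θ (of k Γ (v : Γ)⁻¹ • d v) =
      ∑ w : U, of k Γ (w : Γ) • θ (of k Γ (w : Γ)⁻¹ • of k Γ u • d (u⁻¹ * w)) := by
    rw [Finset.smul_sum]
    refine Fintype.sum_equiv (Equiv.mulLeft u') _ _ fun v => ?_
    have e1 : ((Equiv.mulLeft u' v : U) : Γ) = u * v := rfl
    rw [e1, inv_mul_cancel_left, smul_smul, smul_smul, ← map_mul, ← map_mul]
    congr 4
    rw [mul_inv_rev, mul_assoc, inv_mul_cancel, mul_one]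
  have h2 : ∀ w : U, of k Γ u • d (u⁻¹ * w) = d w - d u - t • e u (u⁻¹ * w) := fun w => by
    have := he u hu (u⁻¹ * w) (U.mul_mem (U.inv_mem hu) w.2)
    rw [mul_inv_cancel_left] at this
    rw [this]
    abel
  have h3 : d u = ∑ w : U, of k Γ (w : Γ) • θ (of k Γ (w : Γ)⁻¹ • d u) := by
    conv_lhs => rw [← hθ (d u), finsum_eq_sum_of_fintype]
  rw [smul_neg, h1]
  conv_lhs => rw [h3]
  rw [smul_neg, Finset.smul_sum, sub_neg_eq_add, ← Finset.sum_neg_distrib,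
    ← Finset.sum_neg_distrib, ← Finset.sum_add_distrib, ← Finset.sum_add_distrib]
  refine Finset.sum_congr rfl fun w _ => ?_
  rw [h2, smul_sub, smul_sub, map_sub, map_sub, smul_sub, smul_sub, smul_comm _ t, map_nsmul,
    smul_comm _ t]
  abel

end IsWeaklyProjective

end Modules

end GroupRing

section Invariants

open MonoidAlgebra

variable {k : Type} [CommRing k] {Γ : Type u} [CommGroup Γ]

section Vanishing

variable [Finite Γ] {U : Subgroup Γ}
variable {K : Type u} [AddCommGroup K] [Module (MonoidAlgebra k Γ) K]

/-- A module in `𝒫` is the quotient of a free module by a projective one, and projective modules are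
weakly projective. -/
theorem InP.exists_resolution (hK : InP (MonoidAlgebra k Γ) K) :
    ∃ c : (K →₀ MonoidAlgebra k Γ) →ₗ[MonoidAlgebra k Γ] K, Function.Surjective c ∧
      IsWeaklyProjective k U (LinearMap.ker c) := by
  refine ⟨Finsupp.linearCombination _ id, Finsupp.linearCombination_id_surjective _ K, ?_⟩
  have := hK.projective_ker (Finsupp.linearCombination (MonoidAlgebra k Γ) id)
    (Finsupp.linearCombination_id_surjective _ K)
  exact isWeaklyProjective_of_projective U

/-- The vanishing of `Ĥ⁰(U, K)` for `K` in `𝒫`, by dimension shifting from `H¹` of the kernel. -/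
theorem InP.exists_norm_smul_eq (hK : InP (MonoidAlgebra k Γ) K) (x : K)
    (hx : ∀ u ∈ U, of k Γ u • x = x) : ∃ y, normElt k U • y = x := by
  classical
  obtain ⟨c, hc, hw⟩ := hK.exists_resolution (U := U)
  obtain ⟨x, rfl⟩ := hc x
  have hmem : ∀ u ∈ U, of k Γ u • x - x ∈ LinearMap.ker c := fun u hu => by
    rw [LinearMap.mem_ker, map_sub, map_smul, hx u hu, sub_self]
  obtain ⟨y, hy⟩ := hw.exists_cobounding 0
    (fun u => if h : u ∈ U then ⟨_, hmem u h⟩ else 0) (fun u hu v hv => ⟨0, by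
      simp only [dif_pos hu, dif_pos hv, dif_pos (U.mul_mem hu hv)]
      apply Subtype.ext
      simp only [Submodule.coe_add, Submodule.coe_smul, smul_zero, add_zero, map_mul, mul_smul,
        smul_sub]
      abel⟩)
  obtain ⟨y₀, y₁, h⟩ := (isWeaklyProjective_finsupp (k := k) U K).exists_eq_norm_add 0
    (x - (y : K →₀ MonoidAlgebra k Γ))
    (fun u hu => by
      obtain ⟨e, he⟩ := hy u hu
      refine ⟨0, ?_⟩
      rw [dif_pos hu] at he
      have he' := congrArg Subtype.val he
      simp only [Submodule.coe_sub, Submodule.coe_smul, zero_smul, add_zero] at he'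
      rw [smul_zero, add_zero, smul_sub, sub_eq_sub_iff_add_eq_add]
      rw [sub_eq_sub_iff_add_eq_add] at he'
      rw [he', add_comm])
  refine ⟨c y₀, ?_⟩
  rw [← map_smul]
  have h2 : x = y + normElt k U • y₀ := by
    rw [zero_smul, add_zero] at h
    rw [← h]; abel
  conv_rhs => rw [h2, map_add, y.2, zero_add]

/-- The vanishing of `Ĥ⁻¹(U, K)` for `K` in `𝒫`, by dimension shifting from `Ĥ⁰` of the kernel. -/
theorem InP.mem_of_norm_smul_eq_zero (hK : InP (MonoidAlgebra k Γ) K) (x : K)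
    (hx : normElt k U • x = 0) :
    x ∈ augIdeal k U • (⊤ : Submodule (MonoidAlgebra k Γ) K) := by
  obtain ⟨c, hc, hw⟩ := hK.exists_resolution (U := U)
  obtain ⟨x, rfl⟩ := hc x
  have hmem : normElt k U • x ∈ LinearMap.ker c := by
    rw [LinearMap.mem_ker, map_smul, hx]
  obtain ⟨y₀, y₁, h⟩ := hw.exists_eq_norm_add 0 ⟨_, hmem⟩ (fun u hu => ⟨0, by
    apply Subtype.ext
    rw [smul_zero, add_zero]
    change of k Γ u • normElt k U • x = normElt k U • x
    rw [smul_smul, of_mul_normElt hu]⟩)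
  rw [zero_smul, add_zero] at h
  have h' : normElt k U • x = normElt k U • (y₀ : K →₀ MonoidAlgebra k Γ) :=
    congrArg Subtype.val h
  obtain ⟨z, hz⟩ := (isWeaklyProjective_finsupp (k := k) U K).mem_of_norm_eq 0
    (x - (y₀ : K →₀ MonoidAlgebra k Γ)) 0
    (by rw [smul_sub, h', sub_self, smul_zero])
  rw [zero_smul, sub_zero] at hz
  have h2 : c x = c (x - (y₀ : K →₀ MonoidAlgebra k Γ)) := by rw [map_sub, y₀.2, sub_zero]
  rw [h2]
  have h3 := Submodule.mem_map_of_mem (f := c) hz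
  rw [Submodule.map_smul''] at h3
  exact Submodule.smul_mono le_rfl le_top h3

/-- The vanishing of `H¹(U, K)` for `K` in `𝒫`: with `K = F₀ / F₁` and `t = #K`,
multiplication by `t` turns a cocycle with values in `K` into one with values in `F₁ / t F₁`. -/
theorem InP.exists_cobounding [IsOrderLike k] (hK : InP (MonoidAlgebra k Γ) K) (d : Γ → K)
    (hd : ∀ u ∈ U, ∀ v ∈ U, d (u * v) = d u + of k Γ u • d v) :
    ∃ x, ∀ u ∈ U, d u = of k Γ u • x - x := by
  have := hK.1
  obtain ⟨c, hc, hw⟩ := hK.exists_resolution (U := U)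
  choose D hD using fun u => hc (d u)
  -- multiplication by `t` embeds `K = F₀ / F₁` into `F₁ / t F₁`
  set t := Nat.card K with ht
  have ht0 : t ≠ 0 := Nat.card_ne_zero.mpr ⟨inferInstance, inferInstance⟩
  have htK : ∀ x, t • x ∈ LinearMap.ker c := fun x => by
    rw [LinearMap.mem_ker, map_nsmul, ht, card_nsmul_eq_zero']
  obtain ⟨y, hy⟩ := hw.exists_cobounding t (fun u => ⟨t • D u, htK _⟩) (fun u hu v hv => by
    refine ⟨⟨D (u * v) - D u - of k Γ u • D v, ?_⟩, ?_⟩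
    · rw [LinearMap.mem_ker, map_sub, map_sub, map_smul, hD, hD, hD, hd u hu v hv]
      abel
    · apply Subtype.ext
      change t • D (u * v) = t • D u + of k Γ u • t • D v +
        t • (D (u * v) - D u - of k Γ u • D v)
      rw [smul_comm (of k Γ u) t, smul_sub, smul_sub]
      abel)
  choose! e he using hy
  have he' : ∀ u ∈ U, t • D u = of k Γ u • (y : K →₀ MonoidAlgebra k Γ) - y +
      t • (e u : K →₀ MonoidAlgebra k Γ) :=
    fun u hu => congrArg Subtype.val (he u hu)
  obtain ⟨y₀, y₁, h⟩ := (isWeaklyProjective_finsupp (k := k) U K).exists_eq_norm_add t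
    (y : K →₀ MonoidAlgebra k Γ)
    (fun u hu => ⟨D u - (e u : K →₀ MonoidAlgebra k Γ), by rw [smul_sub, he' u hu]; abel⟩)
  refine ⟨c y₁, fun u hu => ?_⟩
  have h1 : t • (D u - (of k Γ u • y₁ - y₁) - (e u : K →₀ MonoidAlgebra k Γ)) = 0 := by
    rw [smul_sub, smul_sub, he' u hu, h, smul_add, smul_smul (of k Γ u), of_mul_normElt hu,
      smul_sub, smul_comm (of k Γ u) t]
    abel
  have h2 : D u - (of k Γ u • y₁ - y₁) - (e u : K →₀ MonoidAlgebra k Γ) = 0 := by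
    ext1 i
    refine IsOrderLike.natCast_mul_eq_zero t _ ht0 ?_
    rw [← nsmul_eq_mul]
    exact DFunLike.congr_fun h1 i
  have h3 : D u = (of k Γ u • y₁ - y₁) + (e u : K →₀ MonoidAlgebra k Γ) := by
    rw [← sub_eq_zero, ← h2]; abel
  rw [← hD, h3, map_add, (e u).2, add_zero, map_sub, map_smul]

end Vanishing

/-! ### Tate cohomology in degree zero -/

section Tate

variable {X Y Z : Type*} [AddCommGroup X] [Module (MonoidAlgebra k Γ) X]
  [AddCommGroup Y] [Module (MonoidAlgebra k Γ) Y] [AddCommGroup Z] [Module (MonoidAlgebra k Γ) Z]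

variable (k) in
/-- The submodule of `U`-fixed elements. -/
def fixedSub (U : Subgroup Γ) (X : Type*) [AddCommGroup X] [Module (MonoidAlgebra k Γ) X] :
    Submodule (MonoidAlgebra k Γ) X where
  carrier := {x | ∀ u ∈ U, of k Γ u • x = x}
  zero_mem' := fun u _ => smul_zero _
  add_mem' := fun {a b} ha hb u hu => by rw [smul_add, ha u hu, hb u hu]
  smul_mem' := fun r x hx u hu => by rw [smul_comm, hx u hu]

variable (k) in
/-- Tate cohomology in degree zero, `Ĥ⁰(U, X) = X^U / N_U X`, as a `k[Γ]`-module. -/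
abbrev Tate (U : Subgroup Γ) (X : Type*) [AddCommGroup X] [Module (MonoidAlgebra k Γ) X] :=
  fixedSub k U X ⧸ (LinearMap.range
    (LinearMap.lsmul (MonoidAlgebra k Γ) X (normElt k U))).submoduleOf (fixedSub k U X)

variable {U : Subgroup Γ}

theorem map_mem_fixedSub (f : X →ₗ[MonoidAlgebra k Γ] Y) {x : X} (hx : x ∈ fixedSub k U X) :
    f x ∈ fixedSub k U Y := fun u hu => by rw [← map_smul, hx u hu]

theorem Tate.mk_eq_zero_iff (x : fixedSub k U X) :
    (Submodule.Quotient.mk x : Tate k U X) = 0 ↔ ∃ y, normElt k U • y = (x : X) :=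
  Submodule.Quotient.mk_eq_zero _

theorem Tate.nonempty_equiv (f : X →ₗ[MonoidAlgebra k Γ] Y)
    (hs : ∀ y ∈ fixedSub k U Y, ∃ x ∈ fixedSub k U X, ∃ w, y = f x + normElt k U • w)
    (hi : ∀ x ∈ fixedSub k U X, ∀ w, normElt k U • w = f x → ∃ w', normElt k U • w' = x) :
    Nonempty (Tate k U X ≃ₗ[MonoidAlgebra k Γ] Tate k U Y) := by
  let g : fixedSub k U X →ₗ[MonoidAlgebra k Γ] Tate k U Y :=
    (Submodule.mkQ _) ∘ₗ f.restrict (fun x hx => map_mem_fixedSub f hx)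
  have hg : Function.Surjective g := fun y => by
    obtain ⟨⟨y, hy⟩, rfl⟩ := Submodule.mkQ_surjective _ y
    obtain ⟨x, hx, w, rfl⟩ := hs y hy
    refine ⟨⟨x, hx⟩, (Submodule.Quotient.eq _).mpr ⟨-w, ?_⟩⟩
    simp
  refine ⟨(Submodule.quotEquivOfEq _ _ ?_).trans (LinearMap.quotKerEquivOfSurjective g hg)⟩
  ext ⟨x, hx⟩
  have : (⟨x, hx⟩ : fixedSub k U X) ∈ LinearMap.ker g ↔ ∃ w, normElt k U • w = f x :=
    Tate.mk_eq_zero_iff _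
  rw [this]
  constructor
  · rintro ⟨w, hw⟩
    have hw' : normElt k U • w = x := hw
    exact ⟨f w, by rw [← map_smul, hw']⟩
  · rintro ⟨w, hw⟩
    exact hi x hx w hw

theorem Tate.nonempty_prod_equiv (U : Subgroup Γ) (X Y : Type*) [AddCommGroup X]
    [Module (MonoidAlgebra k Γ) X] [AddCommGroup Y] [Module (MonoidAlgebra k Γ) Y] :
    Nonempty (Tate k U (X × Y) ≃ₗ[MonoidAlgebra k Γ] Tate k U X × Tate k U Y) := by
  let g : fixedSub k U (X × Y) →ₗ[MonoidAlgebra k Γ] Tate k U X × Tate k U Y :=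
    ((Submodule.mkQ _) ∘ₗ (LinearMap.fst _ X Y).restrict
      (fun x hx => map_mem_fixedSub (LinearMap.fst (MonoidAlgebra k Γ) X Y) hx)).prod
    ((Submodule.mkQ _) ∘ₗ (LinearMap.snd _ X Y).restrict
      (fun x hx => map_mem_fixedSub (LinearMap.snd (MonoidAlgebra k Γ) X Y) hx))
  have hg : Function.Surjective g := by
    rintro ⟨x, y⟩
    obtain ⟨⟨x, hx⟩, rfl⟩ := Submodule.mkQ_surjective _ x
    obtain ⟨⟨y, hy⟩, rfl⟩ := Submodule.mkQ_surjective _ y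
    exact ⟨⟨(x, y), fun u hu => Prod.ext (hx u hu) (hy u hu)⟩, rfl⟩
  refine ⟨(Submodule.quotEquivOfEq _ _ ?_).trans (LinearMap.quotKerEquivOfSurjective g hg)⟩
  ext ⟨⟨x, y⟩, h⟩
  rw [LinearMap.mem_ker]
  have : g ⟨(x, y), h⟩ = 0 ↔ (∃ w, normElt k U • w = x) ∧ (∃ w, normElt k U • w = y) := by
    rw [Prod.ext_iff]
    exact and_congr (Tate.mk_eq_zero_iff _) (Tate.mk_eq_zero_iff _)
  rw [this]
  constructor
  · rintro ⟨⟨w, w'⟩, hw⟩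
    exact ⟨⟨w, congrArg Prod.fst hw⟩, ⟨w', congrArg Prod.snd hw⟩⟩
  · rintro ⟨⟨w, hw⟩, ⟨w', hw'⟩⟩
    exact ⟨(w, w'), Prod.ext hw hw'⟩

end Tate

section TateInP

variable [IsOrderLike k] [Finite Γ] {U : Subgroup Γ}
variable {X M : Type u} [AddCommGroup X] [Module (MonoidAlgebra k Γ) X]
  [AddCommGroup M] [Module (MonoidAlgebra k Γ) M]

theorem Tate.nonempty_equiv_of_surjective (q : M →ₗ[MonoidAlgebra k Γ] X)
    (hq : Function.Surjective q) (hk : InP (MonoidAlgebra k Γ) (LinearMap.ker q)) :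
    Nonempty (Tate k U M ≃ₗ[MonoidAlgebra k Γ] Tate k U X) := by
  classical
  refine Tate.nonempty_equiv q (fun y hy => ?_) (fun x hx w hw => ?_)
  · obtain ⟨m, rfl⟩ := hq y
    have hmem : ∀ u ∈ U, of k Γ u • m - m ∈ LinearMap.ker q := fun u hu => by
      rw [LinearMap.mem_ker, map_sub, map_smul, hy u hu, sub_self]
    obtain ⟨κ, hκ⟩ := hk.exists_cobounding (U := U)
      (fun u => if h : u ∈ U then ⟨_, hmem u h⟩ else 0) (fun u hu v hv => by
        simp only [dif_pos hu, dif_pos hv, dif_pos (U.mul_mem hu hv)]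
        apply Subtype.ext
        simp only [Submodule.coe_add, Submodule.coe_smul, map_mul, mul_smul, smul_sub]
        abel)
    refine ⟨m - κ, fun u hu => ?_, 0, ?_⟩
    · have h := hκ u hu
      rw [dif_pos hu] at h
      have h' : of k Γ u • m - m = of k Γ u • (κ : M) - κ := congrArg Subtype.val h
      rw [smul_sub, sub_eq_sub_iff_add_eq_add]
      rw [sub_eq_sub_iff_add_eq_add] at h'
      rw [h', add_comm]
    · rw [map_sub, κ.2, sub_zero, smul_zero, add_zero]
  · obtain ⟨w, rfl⟩ := hq w
    have hmem : x - normElt k U • w ∈ LinearMap.ker q := by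
      rw [LinearMap.mem_ker, map_sub, map_smul, hw, sub_self]
    obtain ⟨κ, hκ⟩ := hk.exists_norm_smul_eq (U := U) ⟨_, hmem⟩ (fun u hu => by
      apply Subtype.ext
      change of k Γ u • (x - normElt k U • w) = x - normElt k U • w
      rw [smul_sub, hx u hu, smul_smul, of_mul_normElt hu])
    have h' : normElt k U • (κ : M) = x - normElt k U • w := congrArg Subtype.val hκ
    exact ⟨κ + w, by rw [smul_add, h', sub_add_cancel]⟩

omit [IsOrderLike k] in
theorem Tate.nonempty_equiv_of_injective (i : X →ₗ[MonoidAlgebra k Γ] M)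
    (hi : Function.Injective i) (hk : InP (MonoidAlgebra k Γ) (M ⧸ LinearMap.range i)) :
    Nonempty (Tate k U X ≃ₗ[MonoidAlgebra k Γ] Tate k U M) := by
  refine Tate.nonempty_equiv i (fun y hy => ?_) (fun x hx w hw => ?_)
  · obtain ⟨w, hw⟩ := hk.exists_norm_smul_eq (U := U) ((LinearMap.range i).mkQ y)
      (map_mem_fixedSub _ hy)
    obtain ⟨w, rfl⟩ := (LinearMap.range i).mkQ_surjective w
    rw [← map_smul, ← sub_eq_zero, ← map_sub] at hw
    obtain ⟨x, hx⟩ := (Submodule.Quotient.mk_eq_zero _).mp hw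
    refine ⟨-x, fun u hu => hi ?_, w, by rw [map_neg, hx]; abel⟩
    rw [map_smul, map_neg, hx, smul_neg, smul_sub, hy u hu, smul_smul, of_mul_normElt hu]
  · have h0 : normElt k U • (LinearMap.range i).mkQ w = 0 := by
      rw [← map_smul, hw]
      exact (Submodule.Quotient.mk_eq_zero _).mpr ⟨x, rfl⟩
    have h1 := hk.mem_of_norm_smul_eq_zero _ h0
    have h2 : (⊤ : Submodule (MonoidAlgebra k Γ) (M ⧸ LinearMap.range i)) =
        (⊤ : Submodule _ M).map (LinearMap.range i).mkQ := by
      rw [Submodule.map_top, Submodule.range_mkQ]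
    rw [h2, ← Submodule.map_smul''] at h1
    obtain ⟨a, ha, hab⟩ := h1
    rw [← sub_eq_zero, ← map_sub] at hab
    obtain ⟨x', hx'⟩ := (Submodule.Quotient.mk_eq_zero _).mp hab
    have h3 : normElt k U • a = 0 := by
      refine Submodule.smul_induction_on (p := fun a => normElt k U • a = 0) ha
        (fun r hr n _ => ?_) (fun x y hx hy => ?_)
      · rw [smul_smul, mul_comm, mul_normElt_eq_zero hr, zero_smul]
      · rw [smul_add, hx, hy, add_zero]
    refine ⟨-x', hi ?_⟩
    rw [map_smul, map_neg, hx', smul_neg, smul_sub, h3, hw, zero_sub, neg_neg]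

theorem Tate.nonempty_equiv_of_isFilling (h : IsFilling (MonoidAlgebra k Γ) X M) :
    Nonempty (Tate k U X ≃ₗ[MonoidAlgebra k Γ] Tate k U M) := by
  obtain ⟨W, i, q, hi, hq, h1, h2⟩ := isFilling_iff.mp h
  obtain ⟨e⟩ := Tate.nonempty_equiv_of_surjective (U := U) q hq h1
  obtain ⟨e'⟩ := Tate.nonempty_equiv_of_injective (U := U) i hi h2
  exact ⟨e.symm.trans e'⟩

theorem Tate.nonempty_equiv_of_sim (h : Sim (MonoidAlgebra k Γ) X M) :
    Nonempty (Tate k U X ≃ₗ[MonoidAlgebra k Γ] Tate k U M) := by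
  obtain ⟨N, -, h1, h2⟩ := h.exists_common
  obtain ⟨e⟩ := Tate.nonempty_equiv_of_isFilling (U := U) h1
  obtain ⟨e'⟩ := Tate.nonempty_equiv_of_isFilling (U := U) h2
  exact ⟨e.trans e'.symm⟩

omit [IsOrderLike k] in
/-- Dimension shifting: if `Y` is a shift of a cyclic module `R / 𝔟`, then `Ĥ⁰(U, Y)` is
`Ĥ⁻¹(U, R / 𝔟)`. -/
theorem Tate.nonempty_equiv_of_isShift {b B : Ideal (MonoidAlgebra k Γ)} {Y : Type u}
    [AddCommGroup Y] [Module (MonoidAlgebra k Γ) Y]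
    (hB : ∀ x, x ∈ B ↔ normElt k U * x ∈ b)
    (h : IsShift (MonoidAlgebra k Γ) (MonoidAlgebra k Γ ⧸ b) Y) :
    Nonempty ((B ⧸ (b ⊔ augIdeal k U).submoduleOf B) ≃ₗ[MonoidAlgebra k Γ] Tate k U Y) := by
  obtain ⟨P, f, g, hP, hf, hg, hfg⟩ := h
  obtain ⟨π, hπ⟩ := hg (Submodule.Quotient.mk 1)
  have hgπ : ∀ x : MonoidAlgebra k Γ, g (x • π) = Submodule.Quotient.mk x := fun x => by
    rw [map_smul, hπ, ← Submodule.Quotient.mk_smul, smul_eq_mul, mul_one]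
  have hmem : ∀ x : B, (normElt k U * (x : MonoidAlgebra k Γ)) • π ∈ LinearMap.range f := fun x => by
    refine (hfg _).mp ?_
    rw [hgπ]
    exact (Submodule.Quotient.mk_eq_zero _).mpr ((hB _).mp x.2)
  let e := LinearEquiv.ofInjective f hf
  let F₀ : B →ₗ[MonoidAlgebra k Γ] Y := e.symm.toLinearMap ∘ₗ
    (LinearMap.codRestrict (LinearMap.range f) ((LinearMap.toSpanSingleton _ P π) ∘ₗ
      (LinearMap.mulLeft (MonoidAlgebra k Γ) (normElt k U)) ∘ₗ
        (Submodule.subtype B)) hmem)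
  have hF₀ : ∀ x, f (F₀ x) = (normElt k U * (x : MonoidAlgebra k Γ)) • π := fun x => by
    have : e (F₀ x) = ⟨_, hmem x⟩ := by
      simp only [F₀, LinearMap.comp_apply, LinearEquiv.coe_coe, LinearEquiv.apply_symm_apply]
      rfl
    exact congrArg Subtype.val this
  have hfix : ∀ x, F₀ x ∈ fixedSub k U Y := fun x u hu => hf (by
    rw [map_smul, hF₀, smul_smul, ← mul_assoc, of_mul_normElt hu])
  let F : B →ₗ[MonoidAlgebra k Γ] Tate k U Y := (Submodule.mkQ _) ∘ₗ F₀.codRestrict _ hfix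
  have hF : Function.Surjective F := by
    intro y
    obtain ⟨⟨y, hy⟩, rfl⟩ := Submodule.mkQ_surjective _ y
    obtain ⟨ρ, hρ⟩ := hP.exists_norm_smul_eq (U := U) (f y) (map_mem_fixedSub f hy)
    obtain ⟨x, hx⟩ := Submodule.Quotient.mk_surjective _ (g ρ)
    have h0 : g (x • π - ρ) = 0 := by rw [map_sub, hgπ, hx, sub_self]
    obtain ⟨y', hy'⟩ := (hfg _).mp h0
    have hxB : x ∈ B := by
      rw [hB, ← Submodule.Quotient.mk_eq_zero, ← smul_eq_mul, Submodule.Quotient.mk_smul, hx,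
        ← map_smul, hρ, hfg.apply_apply_eq_zero]
    refine ⟨⟨x, hxB⟩, (Submodule.Quotient.eq _).mpr ⟨y', hf ?_⟩⟩
    change f (normElt k U • y') = f (F₀ ⟨x, hxB⟩ - y)
    rw [map_smul, map_sub, hF₀, hy', smul_sub, hρ, smul_smul]
  refine ⟨(Submodule.quotEquivOfEq _ _ ?_).trans (LinearMap.quotKerEquivOfSurjective F hF)⟩
  ext ⟨x, hx⟩
  have h1 : (⟨x, hx⟩ : B) ∈ LinearMap.ker F ↔ ∃ w, normElt k U • w = F₀ ⟨x, hx⟩ :=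
    Tate.mk_eq_zero_iff _
  rw [h1]
  change x ∈ b ⊔ augIdeal k U ↔ _
  constructor
  · intro h
    obtain ⟨i, hi, j, hj, rfl⟩ := Submodule.mem_sup.mp h
    obtain ⟨w, hw⟩ := (hfg (i • π)).mp (by
      rw [hgπ]; exact (Submodule.Quotient.mk_eq_zero _).mpr hi)
    refine ⟨w, hf ?_⟩
    rw [map_smul, hF₀, hw, smul_smul, mul_add, mul_comm _ j, mul_normElt_eq_zero hj, add_zero]
  · rintro ⟨w, hw⟩
    have h2 : normElt k U • (x • π - f w) = 0 := by
      have := congrArg f hw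
      rw [map_smul, hF₀] at this
      rw [smul_sub, this, smul_smul, sub_self]
    have h3 := Submodule.mem_map_of_mem (f := g) (hP.mem_of_norm_smul_eq_zero _ h2)
    rw [map_sub, hgπ, hfg.apply_apply_eq_zero, sub_zero, Submodule.map_smul''] at h3
    have h4 : (Submodule.map g ⊤ : Submodule _ (MonoidAlgebra k Γ ⧸ b)) =
        (⊤ : Submodule _ (MonoidAlgebra k Γ)).map b.mkQ := by
      rw [Submodule.map_top, Submodule.map_top, LinearMap.range_eq_top.mpr hg,
        Submodule.range_mkQ]
    rw [h4, ← Submodule.map_smul'', Ideal.smul_eq_mul, Ideal.mul_top] at h3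
    obtain ⟨a, ha, hax⟩ := h3
    have h5 : x - a ∈ b := by
      rw [← Submodule.Quotient.mk_eq_zero, Submodule.Quotient.mk_sub, sub_eq_zero]
      exact hax.symm
    rw [← sub_add_cancel x a]
    exact add_mem (Submodule.mem_sup_left h5) (Submodule.mem_sup_right ha)

end TateInP

end Invariants

/-! ### Numerical invariants -/

section Count

variable {R : Type*} [CommRing R] {T T' : Type*} [AddCommGroup T] [Module R T]
  [AddCommGroup T'] [Module R T']

/-- The submodule of `T` such that the quotient is the reduction modulo `J` of `s T`. -/
abbrev countSub (s : R) (J : Ideal R) (T : Type*) [AddCommGroup T] [Module R T] :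
    Submodule R T := J • ⊤ ⊔ Submodule.torsionBy R T s

/-- The order of `s T / J s T`. -/
noncomputable def count (s : R) (J : Ideal R) (T : Type*) [AddCommGroup T] [Module R T] : ℕ :=
  Nat.card (T ⧸ countSub s J T)

theorem map_torsionBy_equiv (s : R) (e : T ≃ₗ[R] T') :
    (Submodule.torsionBy R T s).map (e : T →ₗ[R] T') = Submodule.torsionBy R T' s := by
  ext y
  constructor
  · rintro ⟨x, hx, rfl⟩
    rw [SetLike.mem_coe, Submodule.mem_torsionBy_iff] at hx
    rw [Submodule.mem_torsionBy_iff, ← map_smul, hx, map_zero]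
  · intro hy
    refine ⟨e.symm y, ?_, by simp⟩
    rw [Submodule.mem_torsionBy_iff] at hy
    rw [SetLike.mem_coe, Submodule.mem_torsionBy_iff, ← map_smul, hy, map_zero]

theorem count_congr (s : R) (J : Ideal R) (e : T ≃ₗ[R] T') : count s J T = count s J T' := by
  refine Nat.card_congr (Submodule.Quotient.equiv _ _ e ?_).toEquiv
  rw [Submodule.map_sup, map_torsionBy_equiv, Submodule.map_smul'', Submodule.map_top,
    LinearEquiv.range]

theorem smul_top_prod (J : Ideal R) :
    J • (⊤ : Submodule R (T × T')) = (J • (⊤ : Submodule R T)).prod (J • (⊤ : Submodule R T')) := by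
  refine le_antisymm (Submodule.smul_le.mpr fun r hr n _ => ?_) ?_
  · exact ⟨Submodule.smul_mem_smul hr trivial, Submodule.smul_mem_smul hr trivial⟩
  · rintro ⟨a, b⟩ ⟨ha, hb⟩
    have h1 := Submodule.mem_map_of_mem (f := LinearMap.inl R T T') ha
    have h2 := Submodule.mem_map_of_mem (f := LinearMap.inr R T T') hb
    rw [Submodule.map_smul''] at h1 h2
    have := add_mem (Submodule.smul_mono (le_refl J) le_top h1)
      (Submodule.smul_mono (le_refl J) le_top h2)
    simpa using this

theorem count_prod (s : R) (J : Ideal R) : count s J (T × T') = count s J T * count s J T' := by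
  rw [count, count, count, ← Nat.card_prod]
  let g : T × T' →ₗ[R] (T ⧸ countSub s J T) × (T' ⧸ countSub s J T') :=
    (Submodule.mkQ _).prodMap (Submodule.mkQ _)
  have hg : Function.Surjective g :=
    (Submodule.mkQ_surjective _).prodMap (Submodule.mkQ_surjective _)
  refine Nat.card_congr ((Submodule.quotEquivOfEq _ _ ?_).trans
    (LinearMap.quotKerEquivOfSurjective g hg)).toEquiv
  rw [LinearMap.ker_prodMap, Submodule.ker_mkQ, Submodule.ker_mkQ, countSub, smul_top_prod,
    ← Submodule.prod_sup_prod]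
  congr 1
  ext ⟨x, y⟩
  simp [Submodule.mem_prod]

theorem count_ne_zero (s : R) (J : Ideal R) [Finite T] : count s J T ≠ 0 := by
  have : Finite (T ⧸ countSub s J T) :=
    Finite.of_surjective _ (Submodule.mkQ_surjective (countSub s J T))
  exact Nat.card_ne_zero.mpr ⟨inferInstance, inferInstance⟩

theorem count_eq_one (s : R) (J : Ideal R) (h : ∀ t : T, s • t = 0) : count s J T = 1 := by
  have : countSub s J T = ⊤ := by
    rw [eq_top_iff]
    intro t _
    exact Submodule.mem_sup_right ((Submodule.mem_torsionBy_iff _ _).mpr (h t))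
  rw [count, this, Nat.card_eq_one_iff_unique]
  have := Submodule.Quotient.subsingleton_iff.mpr (rfl : (⊤ : Submodule R T) = ⊤)
  exact ⟨inferInstance, inferInstance⟩

/-- For a cyclic module `R / c`, the submodule divided out in `count` is the image of the ideal
`J + (c : s)`. -/
theorem count_quotient (s : R) (J c : Ideal R) (cs : Ideal R) (hcs : ∀ x, x ∈ cs ↔ s * x ∈ c) :
    count s J (R ⧸ c) = Nat.card (R ⧸ J ⊔ cs) := by
  have h1 : Submodule.map c.mkQ (J ⊔ cs) = countSub s J (R ⧸ c) := by
    rw [Submodule.map_sup]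
    congr 1
    · conv_lhs => rw [← Ideal.mul_top J, ← smul_eq_mul]
      rw [Submodule.map_smul'', Submodule.map_top,
        Submodule.range_mkQ]
    · ext y
      obtain ⟨y, rfl⟩ := c.mkQ_surjective y
      rw [Submodule.mem_torsionBy_iff, ← map_smul, smul_eq_mul]
      constructor
      · rintro ⟨x, hx, hxy⟩
        have h2 : s * x ∈ c := (hcs x).mp hx
        have h3 : x - y ∈ c := (Submodule.Quotient.eq _).mp hxy
        refine (Submodule.Quotient.mk_eq_zero _).mpr ?_
        have : s * y = s * x - s * (x - y) := by ring
        rw [this]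
        exact sub_mem h2 (Ideal.mul_mem_left _ _ h3)
      · intro hy
        exact ⟨y, (hcs y).mpr ((Submodule.Quotient.mk_eq_zero _).mp hy), rfl⟩
  have hle : c ≤ J ⊔ cs := le_trans
    (fun x hx => (hcs x).mpr (Ideal.mul_mem_left _ _ hx)) le_sup_right
  rw [count, ← h1]
  exact Nat.card_congr (Submodule.quotientQuotientEquivQuotient c (J ⊔ cs) hle).toEquiv

end Count

/-! ### The ideals defining the modules `A_{I,φ}` -/

section Geometric

open MonoidAlgebra

variable {k : Type} [CommRing k] {G : Type u} [CommGroup G] [Finite G]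

theorem normElt_zpowers (ψ : G) :
    normElt k (Subgroup.zpowers ψ) = ∑ i ∈ Finset.range (orderOf ψ), of k G ψ ^ i := by
  classical
  cases nonempty_fintype (Subgroup.zpowers ψ)
  rw [normElt_eq_sum, ← Fin.sum_univ_eq_sum_range (fun i => of k G ψ ^ i)]
  refine (Fintype.sum_equiv (finEquivZPowers (isOfFinOrder_of_finite ψ)) _ _ fun i => ?_).symm
  rw [← map_pow]
  rfl

/-- The element `f = 1 + n - ψ` divides the integer `(1 + n) ^ m - 1`, where `m` is the order of
`ψ`, and the quotient is the norm of `ψ` modulo `n`. -/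
theorem exists_geometric (ψ : G) (n : ℕ) : ∃ g' e : MonoidAlgebra k G,
    ((n + 1 : ℕ) - of k G ψ) * g' = (((n + 1) ^ orderOf ψ - 1 : ℕ) : MonoidAlgebra k G) ∧
      g' = normElt k (Subgroup.zpowers ψ) + n * e := by
  set m := orderOf ψ
  set w : MonoidAlgebra k G := ((n + 1 : ℕ) : MonoidAlgebra k G)
  set x := of k G ψ
  have hx : x ^ m = 1 := by rw [← map_pow, pow_orderOf_eq_one, map_one]
  have h1 : (w - x) * ∑ i ∈ Finset.range m, w ^ i * x ^ (m - 1 - i) = w ^ m - x ^ m :=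
    (Commute.all w x).mul_geom_sum₂ m
  have h2 : (n : MonoidAlgebra k G) ∣ (∑ i ∈ Finset.range m, w ^ i * x ^ (m - 1 - i)) -
      normElt k (Subgroup.zpowers ψ) := by
    rw [normElt_zpowers, ← Finset.sum_range_reflect (fun i => x ^ i), ← Finset.sum_sub_distrib]
    refine Finset.dvd_sum fun i _ => ?_
    have h3 : (n : MonoidAlgebra k G) ∣ w ^ i - 1 := by
      have := sub_dvd_pow_sub_pow w 1 i
      rw [one_pow] at this
      simpa [w] using this
    have h4 : w ^ i * x ^ (m - 1 - i) - x ^ (m - 1 - i) = (w ^ i - 1) * x ^ (m - 1 - i) := by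
      rw [sub_mul, one_mul]
    rw [h4]
    exact Dvd.dvd.mul_right h3 _
  obtain ⟨e, he⟩ := h2
  refine ⟨∑ i ∈ Finset.range m, w ^ i * x ^ (m - 1 - i), e, ?_, by rw [← he]; ring⟩
  rw [h1, hx, Nat.cast_sub (Nat.one_le_pow _ _ (Nat.succ_pos n))]
  simp [w]

variable [IsOrderLike k]

theorem geometric_ne_zero (ψ : G) {n : ℕ} (hn : n ≠ 0) : (n + 1) ^ orderOf ψ - 1 ≠ 0 := by
  have : 1 < (n + 1) ^ orderOf ψ := Nat.one_lt_pow (orderOf_pos ψ).ne' (by omega)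
  omega

theorem geometric_regular (ψ : G) {n : ℕ} (hn : n ≠ 0) (x : MonoidAlgebra k G)
    (h : ((n + 1 : ℕ) - of k G ψ) * x = 0) : x = 0 := by
  obtain ⟨g', e, hg, -⟩ := exists_geometric (k := k) ψ n
  refine IsOrderLike.natCast_mul_eq_zero _ x (geometric_ne_zero ψ hn) ?_
  rw [← hg]
  linear_combination g' * h

omit [Finite G] in
theorem dvd_geometric (ψ : G) {n : ℕ} : n ∣ (n + 1) ^ orderOf ψ - 1 := by
  simpa using Nat.sub_dvd_pow_sub_pow (n + 1) 1 (orderOf ψ)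

/-- The `P`-torsion of `k[G] / f`, for a divisor `P` of `n`. -/
theorem geometric_torsion (ψ : G) {n P q : ℕ} (hn : n ≠ 0)
    (hz : (n + 1) ^ orderOf ψ - 1 = P * q) (hP : P ∣ n) (x y : MonoidAlgebra k G)
    (h : (P : MonoidAlgebra k G) * x = ((n + 1 : ℕ) - of k G ψ) * y) :
    ∃ x' y', x = (q : MonoidAlgebra k G) * x' + ((n + 1 : ℕ) - of k G ψ) * y' := by
  obtain ⟨g', e, hg, hg'⟩ := exists_geometric (k := k) ψ n
  obtain ⟨c, rfl⟩ := hP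
  have hP0 : P ≠ 0 := left_ne_zero_of_mul hn
  push_cast at h hg hg'
  have h1 : of k G ψ • y = y + P • (c * y - x) := by
    rw [smul_eq_mul, nsmul_eq_mul]
    linear_combination h
  have h2 : ∀ u ∈ Subgroup.zpowers ψ, ∃ y', of k G u • y = y + P • y' := by
    have key : Subgroup.zpowers ψ ≤
        { carrier := {u | ∃ y', of k G u • y = y + P • y'}
          one_mem' := ⟨0, by rw [map_one, one_smul, smul_zero, add_zero]⟩
          mul_mem' := by
            rintro a b ⟨y₁, h₁⟩ ⟨y₂, h₂⟩
            refine ⟨y₁ + of k G a • y₂, ?_⟩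
            rw [map_mul, mul_smul, h₂, smul_add, h₁, smul_add, smul_comm _ P, add_assoc]
          inv_mem' := by
            rintro a ⟨y₁, h₁⟩
            refine ⟨-(of k G a⁻¹ • y₁), ?_⟩
            have := of_inv_smul_smul (k := k) a y
            rw [h₁, smul_add, smul_comm _ P] at this
            rw [smul_neg]
            exact eq_add_neg_of_add_eq this : Subgroup G } := by
      rw [Subgroup.zpowers_le]
      exact ⟨_, h1⟩
    exact fun u hu => key hu
  obtain ⟨y₀, y₁, h3⟩ := (isWeaklyProjective_self (Subgroup.zpowers ψ)).exists_eq_norm_add P y h2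
  rw [smul_eq_mul, nsmul_eq_mul] at h3
  refine ⟨y₀, y₁ - c * e * y₀, ?_⟩
  rw [← sub_eq_zero]
  refine IsOrderLike.natCast_mul_eq_zero P _ hP0 ?_
  have hz' : (((P * c + 1) ^ orderOf ψ - 1 : ℕ) : MonoidAlgebra k G) = P * q := by
    rw [hz, Nat.cast_mul]
  rw [hz'] at hg
  push_cast
  linear_combination h + ((P * c + 1 : MonoidAlgebra k G) - of k G ψ) * h3 + y₀ * hg -
    ((P * c + 1 : MonoidAlgebra k G) - of k G ψ) * y₀ * hg'

/-- The annihilator of `z / P` on `k[G] / f`, where `f` divides `z`. -/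
theorem geometric_annihilator (ψ : G) {n P q : ℕ} (hn : n ≠ 0)
    (hz : (n + 1) ^ orderOf ψ - 1 = P * q) (hP : P ∣ n) (x y : MonoidAlgebra k G)
    (h : (q : MonoidAlgebra k G) * x = ((n + 1 : ℕ) - of k G ψ) * y) :
    ∃ z, x - (P : MonoidAlgebra k G) * z ∈ augIdeal k (Subgroup.zpowers ψ) := by
  obtain ⟨g', e, hg, hg'⟩ := exists_geometric (k := k) ψ n
  have hz0 := geometric_ne_zero ψ hn
  rw [hz] at hg hz0
  obtain ⟨c, rfl⟩ := hP
  have h1 : g' * x = P * y := by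
    rw [← sub_eq_zero]
    refine IsOrderLike.natCast_mul_eq_zero q _ (right_ne_zero_of_mul hz0) ?_
    push_cast at hg h ⊢
    linear_combination g' * h + y * hg
  obtain ⟨z, hz⟩ := (isWeaklyProjective_self (Subgroup.zpowers ψ)).mem_of_norm_eq (k := k) P x
    (y - c * e * x) (by
      rw [smul_eq_mul, nsmul_eq_mul]
      push_cast at hg'
      linear_combination h1 - x * hg')
  refine ⟨z, ?_⟩
  rw [smul_eq_mul, Ideal.mul_top, nsmul_eq_mul] at hz
  exact hz

end Geometric

section Ideals

open MonoidAlgebra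

variable {k : Type} [CommRing k] {Γ : Type u} [CommGroup Γ]

/-- The element `1 - g⁻¹ + n` of `k[Γ]`. -/
noncomputable def frobElt (k : Type) [CommRing k] {Γ : Type u} [CommGroup Γ] (g : Γ) (n : ℕ) :
    MonoidAlgebra k Γ := ((n + 1 : ℕ) : MonoidAlgebra k Γ) - of k Γ g⁻¹

/-- The ideal `𝔟` such that `A_{I,φ} = k[Γ] / 𝔟`, where `g` represents `φ`. -/
noncomputable def idealA (k : Type) [CommRing k] {Γ : Type u} [CommGroup Γ] (I : Subgroup Γ)
    (g : Γ) : Ideal (MonoidAlgebra k Γ) := augIdeal k I ⊔ Ideal.span {frobElt k g (Nat.card I)}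

theorem proj_frobElt (I : Subgroup Γ) (g : Γ) (n : ℕ) :
    proj k I (frobElt k g n) = ((n + 1 : ℕ) : MonoidAlgebra k (Γ ⧸ I)) -
      of k (Γ ⧸ I) (g⁻¹ : Γ) := by
  rw [frobElt, map_sub, map_natCast, proj_of]

theorem mem_augIdeal_sup_span {I : Subgroup Γ} {f x : MonoidAlgebra k Γ} :
    x ∈ augIdeal k I ⊔ Ideal.span {f} ↔ ∃ y, proj k I x = proj k I f * y := by
  constructor
  · intro h
    obtain ⟨i, hi, j, hj, rfl⟩ := Submodule.mem_sup.mp h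
    obtain ⟨y, rfl⟩ := Ideal.mem_span_singleton'.mp hj
    have h0 : proj k I i = 0 := by rwa [← ker_proj, RingHom.mem_ker] at hi
    exact ⟨proj k I y, by rw [map_add, h0, zero_add, map_mul, mul_comm]⟩
  · rintro ⟨y, hy⟩
    obtain ⟨y, rfl⟩ := proj_surjective I y
    rw [← map_mul, proj_eq_iff] at hy
    rw [← sub_add_cancel x (f * y)]
    exact add_mem (Submodule.mem_sup_left hy)
      (Submodule.mem_sup_right (Ideal.mul_mem_right _ _ (Ideal.mem_span_singleton_self _)))

theorem mem_augIdeal_of_proj_mem {I V : Subgroup Γ} (h : I ≤ V) {x : MonoidAlgebra k Γ}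
    {C : Subgroup (Γ ⧸ I)} (hC : C ≤ V.map (QuotientGroup.mk' I))
    (hx : proj k I x ∈ augIdeal k C) : x ∈ augIdeal k V := by
  have h1 : augIdeal k C ≤ (augIdeal k V).map (proj k I) := by
    rw [augIdeal_le]
    intro c hc
    obtain ⟨v, hv, rfl⟩ := hC hc
    have : of k (Γ ⧸ I) (QuotientGroup.mk' I v) - 1 = proj k I (of k Γ v - 1) := by
      rw [map_sub, proj_of, map_one]; rfl
    rw [this]
    exact Ideal.mem_map_of_mem _ (of_sub_one_mem hv)
  obtain ⟨y, hy, hxy⟩ := (Ideal.mem_map_iff_of_surjective _ (proj_surjective I)).mp (h1 hx)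
  have h2 := augIdeal_mono h (proj_eq_iff.mp hxy)
  have : x = y - (y - x) := by ring
  rw [this]
  exact sub_mem hy h2

theorem natCast_mul_mem_augIdeal [IsOrderLike k] [Finite Γ] {V : Subgroup Γ} {t : ℕ} (ht : t ≠ 0)
    {x : MonoidAlgebra k Γ} (h : (t : MonoidAlgebra k Γ) * x ∈ augIdeal k V) :
    x ∈ augIdeal k V := by
  rw [← ker_proj, RingHom.mem_ker, map_mul, map_natCast] at h
  rw [← ker_proj, RingHom.mem_ker]
  exact IsOrderLike.natCast_mul_eq_zero t _ ht h

/-- The subgroup generated by `I` and `g`, the preimage of the subgroup of `Γ/I` generated by the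
class of `g`. -/
def decomp (I : Subgroup Γ) (g : Γ) : Subgroup Γ := I ⊔ Subgroup.zpowers g

theorem le_decomp (I : Subgroup Γ) (g : Γ) : I ≤ decomp I g := le_sup_left

theorem mem_decomp (I : Subgroup Γ) (g : Γ) : g ∈ decomp I g :=
  (le_sup_right : Subgroup.zpowers g ≤ _) (Subgroup.mem_zpowers g)

theorem decomp_le {I V : Subgroup Γ} {g : Γ} : decomp I g ≤ V ↔ I ≤ V ∧ g ∈ V := by
  rw [decomp, sup_le_iff, Subgroup.zpowers_le]

variable [Finite Γ]

/-- The integer `(1 + #I) ^ m - 1` that annihilates `A_{I,φ}`, where `m` is the order of `φ`. -/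
noncomputable def annA (I : Subgroup Γ) (g : Γ) : ℕ :=
  (Nat.card I + 1) ^ orderOf ((g⁻¹ : Γ) : Γ ⧸ I) - 1

theorem card_subgroup_ne_zero (I : Subgroup Γ) : Nat.card I ≠ 0 :=
  Nat.card_ne_zero.mpr ⟨inferInstance, inferInstance⟩

theorem annA_mem (I : Subgroup Γ) (g : Γ) : (annA I g : MonoidAlgebra k Γ) ∈ idealA k I g := by
  obtain ⟨g', e, hg, -⟩ := exists_geometric (k := k) ((g⁻¹ : Γ) : Γ ⧸ I) (Nat.card I)
  rw [idealA, mem_augIdeal_sup_span]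
  exact ⟨g', by rw [proj_frobElt, hg, map_natCast, annA]⟩

omit [Finite Γ] in
theorem mem_idealA {I : Subgroup Γ} {g : Γ} {x : MonoidAlgebra k Γ} : x ∈ idealA k I g ↔
    ∃ y, proj k I x = (((Nat.card I + 1 : ℕ) : MonoidAlgebra k (Γ ⧸ I)) -
      of k (Γ ⧸ I) (g⁻¹ : Γ)) * y := by
  rw [idealA, mem_augIdeal_sup_span, proj_frobElt]

omit [Finite Γ] in
/-- `D = ⟨I, g⟩` acts trivially modulo `#I`. -/
theorem augIdeal_decomp_le (I : Subgroup Γ) (g : Γ) {P : ℕ} (hP : P ∣ Nat.card I) :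
    augIdeal k (decomp I g) ≤ idealA k I g ⊔ Ideal.span {(P : MonoidAlgebra k Γ)} := by
  rw [augIdeal_le_iff_le_trivialOn, decomp_le, ← augIdeal_le_iff_le_trivialOn]
  refine ⟨le_sup_left.trans le_sup_left, ?_⟩
  rw [← inv_mem_iff, mem_trivialOn]
  obtain ⟨c, hc⟩ := hP
  have : of k Γ g⁻¹ - 1 = -frobElt k g (Nat.card I) + c * (P : MonoidAlgebra k Γ) := by
    rw [frobElt, hc]
    push_cast
    ring
  rw [this]
  exact add_mem (Submodule.mem_sup_left (neg_mem (Submodule.mem_sup_right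
      (Ideal.mem_span_singleton_self _))))
    (Submodule.mem_sup_right (Ideal.mul_mem_left _ _ (Ideal.mem_span_singleton_self _)))

omit [Finite Γ] in
theorem augIdeal_le_idealA (I : Subgroup Γ) (g : Γ) : augIdeal k I ≤ idealA k I g := le_sup_left

omit [Finite Γ] in
theorem zpowers_inv_le_map_decomp (I : Subgroup Γ) (g : Γ) :
    Subgroup.zpowers ((g⁻¹ : Γ) : Γ ⧸ I) ≤ (decomp I g).map (QuotientGroup.mk' I) := by
  rw [Subgroup.zpowers_le]
  exact ⟨g⁻¹, inv_mem (mem_decomp I g), rfl⟩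

variable [IsOrderLike k]

/-- If `P` divides `#I`, the `P`-torsion of `A_{I,φ}` is generated by the class of the integer
`q = z / P`. -/
theorem exists_mul_sub_mem_of_natCast_mul_mem {I : Subgroup Γ} {g : Γ} {P q : ℕ}
    (hz : annA I g = P * q) (hP : P ∣ Nat.card I) {x : MonoidAlgebra k Γ}
    (h : (P : MonoidAlgebra k Γ) * x ∈ idealA k I g) :
    ∃ x', (q : MonoidAlgebra k Γ) * x' - x ∈ idealA k I g := by
  obtain ⟨y, hy⟩ := mem_idealA.mp h
  rw [map_mul, map_natCast] at hy
  obtain ⟨x', y', h'⟩ := geometric_torsion _ (card_subgroup_ne_zero I) hz hP _ _ hy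
  obtain ⟨x', rfl⟩ := proj_surjective I x'
  refine ⟨x', mem_idealA.mpr ⟨-y', ?_⟩⟩
  rw [map_sub, h', map_mul, map_natCast]
  ring

/-- If `P` divides `#I`, the annihilator of the generator `q = z / P` of the `P`-torsion of `A_{I,φ}`
is the kernel of `k[Γ] → k[Γ/D] / P`. The `P`-torsion is therefore isomorphic to `k[Γ/D] / P`. -/
theorem natCast_mul_mem_iff {I : Subgroup Γ} {g : Γ} {P q : ℕ}
    (hz : annA I g = P * q) (hP : P ∣ Nat.card I) {x : MonoidAlgebra k Γ} :
    (q : MonoidAlgebra k Γ) * x ∈ idealA k I g ↔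
      x ∈ augIdeal k (decomp I g) ⊔ Ideal.span {(P : MonoidAlgebra k Γ)} := by
  constructor
  · intro h
    obtain ⟨y, hy⟩ := mem_idealA.mp h
    rw [map_mul, map_natCast] at hy
    obtain ⟨z, h'⟩ := geometric_annihilator _ (card_subgroup_ne_zero I) hz hP _ _ hy
    obtain ⟨z, rfl⟩ := proj_surjective I z
    have h2 : x - (P : MonoidAlgebra k Γ) * z ∈ augIdeal k (decomp I g) := by
      refine mem_augIdeal_of_proj_mem (le_decomp I g) (zpowers_inv_le_map_decomp I g) ?_
      rwa [map_sub, map_mul, map_natCast]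
    rw [← sub_add_cancel x ((P : MonoidAlgebra k Γ) * z)]
    exact add_mem (Submodule.mem_sup_left h2)
      (Submodule.mem_sup_right (Ideal.mul_mem_right _ _ (Ideal.mem_span_singleton_self _)))
  · intro h
    have h1 := sup_le (augIdeal_decomp_le (k := k) I g hP) le_sup_right h
    obtain ⟨i, hi, j, hj, rfl⟩ := Submodule.mem_sup.mp h1
    obtain ⟨c, rfl⟩ := Ideal.mem_span_singleton'.mp hj
    have h2 : (q : MonoidAlgebra k Γ) * (i + c * P) = q * i + c * (annA I g : ℕ) := by
      rw [hz]; push_cast; ring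
    rw [h2]
    exact add_mem (Ideal.mul_mem_left _ _ hi) (Ideal.mul_mem_left _ _ (annA_mem I g))

omit [IsOrderLike k] in
theorem proj_normElt (I U : Subgroup Γ) :
    proj k I (normElt k U) = (Nat.card (I ⊓ U : Subgroup Γ) : MonoidAlgebra k (Γ ⧸ I)) *
      normElt k (U.map (QuotientGroup.mk' I)) := by
  classical
  cases nonempty_fintype U
  cases nonempty_fintype (U.map (QuotientGroup.mk' I))
  rw [normElt_eq_sum, normElt_eq_sum, map_sum, Finset.mul_sum]
  let φ := (QuotientGroup.mk' I).subgroupMap U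
  have hφ : Function.Surjective φ := (QuotientGroup.mk' I).subgroupMap_surjective U
  rw [← Finset.sum_fiberwise_of_maps_to (g := φ) (fun _ _ => Finset.mem_univ _)]
  refine Finset.sum_congr rfl fun q _ => ?_
  have h1 : ∀ u ∈ Finset.univ.filter (fun u : U => φ u = q),
      proj k I (of k Γ (u : Γ)) = of k (Γ ⧸ I) (q : Γ ⧸ I) := fun u hu => by
    rw [proj_of, ← (Finset.mem_filter.mp hu).2]
    rfl
  rw [Finset.sum_congr rfl h1, Finset.sum_const, nsmul_eq_mul]
  congr 2
  have h2 : (Finset.univ.filter (fun u : U => φ u = q)).card =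
      (Finset.univ.filter (fun u : U => φ u = 1)).card :=
    MonoidHom.card_fiber_eq_of_mem_range φ (hφ q) ⟨1, map_one φ⟩
  rw [h2, ← Fintype.card_subtype, ← Nat.card_eq_fintype_card]
  refine Nat.card_congr ⟨fun u => ⟨u.1, ?_, u.1.2⟩, fun u => ⟨⟨u.1, u.2.2⟩, ?_⟩, fun _ => rfl,
    fun _ => rfl⟩
  · have := congrArg Subtype.val u.2
    exact (QuotientGroup.eq_one_iff _).mp this
  · exact Subtype.ext ((QuotientGroup.eq_one_iff _).mpr u.2.1)

/-- If `U` is not contained in `I`, then `Ĥ⁻¹(U, A_{I,φ})` is annihilated by the multiples of the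
order of `I ∩ U`. -/
theorem natCast_mul_mem_of_norm_mul_mem {I U : Subgroup Γ} {g : Γ} {s : ℕ}
    (hs : Nat.card (I ⊓ U : Subgroup Γ) ∣ s) {x : MonoidAlgebra k Γ}
    (h : normElt k U * x ∈ idealA k I g) :
    (s : MonoidAlgebra k Γ) * x ∈ idealA k I g ⊔ augIdeal k U := by
  obtain ⟨y, hy⟩ := mem_idealA.mp h
  have hfix : ∀ u ∈ U.map (QuotientGroup.mk' I), ∃ e, of k (Γ ⧸ I) u • y = y + 0 • e := by
    rintro _ ⟨u, hu, rfl⟩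
    refine ⟨0, ?_⟩
    rw [smul_zero, add_zero, ← sub_eq_zero]
    refine geometric_regular ((g⁻¹ : Γ) : Γ ⧸ I) (card_subgroup_ne_zero I) _ ?_
    have h1 : of k (Γ ⧸ I) (QuotientGroup.mk' I u) * proj k I (normElt k U) =
        proj k I (normElt k U) := by
      have : of k (Γ ⧸ I) (QuotientGroup.mk' I u) = proj k I (of k Γ u) := by rw [proj_of]; rfl
      rw [this, ← map_mul, of_mul_normElt hu]
    rw [map_mul] at hy
    rw [smul_eq_mul]
    linear_combination (-of k (Γ ⧸ I) (QuotientGroup.mk' I u)) * hy + hy + proj k I x * h1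
  obtain ⟨y₀, y₁, hy₀⟩ := (isWeaklyProjective_self _).exists_eq_norm_add 0 y hfix
  rw [zero_smul, add_zero, smul_eq_mul] at hy₀
  obtain ⟨l, rfl⟩ := hs
  have h0 := card_subgroup_ne_zero (I ⊓ U)
  set d := Nat.card (I ⊓ U : Subgroup Γ)
  set f := ((Nat.card I + 1 : ℕ) : MonoidAlgebra k (Γ ⧸ I)) - of k (Γ ⧸ I) (g⁻¹ : Γ)
  rw [map_mul, proj_normElt] at hy
  have h2 : normElt k (U.map (QuotientGroup.mk' I)) *
      (((d * l : ℕ) : MonoidAlgebra k (Γ ⧸ I)) * proj k I x - f * (l * y₀)) = 0 := by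
    push_cast
    rw [hy₀] at hy
    linear_combination (l : MonoidAlgebra k (Γ ⧸ I)) * hy
  obtain ⟨z, hz⟩ := (isWeaklyProjective_self (k := k)
    (U.map (QuotientGroup.mk' I))).mem_of_norm_eq 0 _ 0 (by
    rw [smul_eq_mul, h2, zero_smul])
  rw [zero_smul, sub_zero, smul_eq_mul, Ideal.mul_top] at hz
  obtain ⟨y₂, hy₂⟩ := proj_surjective I ((l : MonoidAlgebra k (Γ ⧸ I)) * y₀)
  have h3 : ((d * l : ℕ) : MonoidAlgebra k Γ) * x - frobElt k g (Nat.card I) * y₂ ∈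
      augIdeal k (I ⊔ U) := by
    refine mem_augIdeal_of_proj_mem le_sup_left
      (Subgroup.map_mono (le_sup_right : U ≤ I ⊔ U)) ?_
    rw [map_sub, map_mul, map_mul, map_natCast, hy₂, proj_frobElt]
    exact hz
  rw [← sub_add_cancel (((d * l : ℕ) : MonoidAlgebra k Γ) * x)
    (frobElt k g (Nat.card I) * y₂)]
  refine add_mem ?_ (Submodule.mem_sup_left (Ideal.mul_mem_right _ _ (Submodule.mem_sup_right
    (Ideal.mem_span_singleton_self _))))
  rw [augIdeal_sup] at h3
  exact sup_le_sup_right (augIdeal_le_idealA I g) _ h3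

end Ideals

/-! ### Invariants of the classes of `ω¹(A_{I,φ})` -/

section TateInv

open MonoidAlgebra

variable {k : Type} [CommRing k] {Γ : Type u} [CommGroup Γ] [Finite Γ] [IsOrderLike k]

instance (U : Subgroup Γ) (X : Type*) [AddCommGroup X] [Module (MonoidAlgebra k Γ) X] [Finite X] :
    Finite (Tate k U X) :=
  Finite.of_surjective _ (Submodule.mkQ_surjective _)

variable (k) in
/-- The additive invariant of `𝒞/∼` given by the `p`-adic valuation of the order of the
`V`-coinvariants of `s Ĥ⁰(U, X)`. -/
noncomputable def tateInv (p : ℕ) [Fact p.Prime] (s : ℕ) (U V : Subgroup Γ) :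
    SimClass (MonoidAlgebra k Γ) →+ ℕ where
  toFun := Quotient.lift (fun X => padicValNat p
      (count (s : MonoidAlgebra k Γ) (augIdeal k V) (Tate k U X.1))) (fun X Y h => by
    obtain ⟨e⟩ := Tate.nonempty_equiv_of_sim (U := U) h
    exact congrArg (padicValNat p) (count_congr _ _ e))
  map_zero' := by
    change padicValNat p (count _ _ (Tate k U PUnit)) = 0
    rw [count_eq_one, padicValNat_one_right]
    intro t
    obtain ⟨t, rfl⟩ := Submodule.mkQ_surjective _ t
    have : t = 0 := Subsingleton.elim _ _
    rw [this, map_zero, smul_zero]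
  map_add' := by
    rintro ⟨X⟩ ⟨Y⟩
    have := X.2
    have := Y.2
    obtain ⟨e⟩ := Tate.nonempty_prod_equiv (k := k) U X.1 Y.1
    have key : count (s : MonoidAlgebra k Γ) (augIdeal k V) (Tate k U (X.sum Y).1) = _ :=
      (count_congr _ _ e).trans (count_prod _ _)
    exact (congrArg (padicValNat p) key).trans
      (padicValNat.mul (count_ne_zero _ _) (count_ne_zero _ _))

theorem tateInv_mk (p : ℕ) [Fact p.Prime] (s : ℕ) (U V : Subgroup Γ)
    (X : FinMod (MonoidAlgebra k Γ)) : tateInv k p s U V (SimClass.mk X) =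
      padicValNat p (count (s : MonoidAlgebra k Γ) (augIdeal k V) (Tate k U X.1)) := rfl

omit [IsOrderLike k] in
theorem annA_ne_zero (I : Subgroup Γ) (g : Γ) : annA I g ≠ 0 :=
  geometric_ne_zero _ (card_subgroup_ne_zero I)

instance finite_quotient_idealA (I : Subgroup Γ) (g : Γ) :
    Finite (MonoidAlgebra k Γ ⧸ idealA k I g) :=
  finite_quotient_of_natCast_mem (annA_ne_zero I g) (annA_mem I g)

variable (k) in
/-- The class `[ω¹(A_{I,φ})]`, where `g` represents `φ`. -/
noncomputable def genClass (I : Subgroup Γ) (g : Γ) : SimClass (MonoidAlgebra k Γ) :=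
  shiftHom _ (quotClass (idealA k I g))

theorem exists_genClass_eq (I : Subgroup Γ) (g : Γ) : ∃ Y : FinMod (MonoidAlgebra k Γ),
    IsShift (MonoidAlgebra k Γ) (MonoidAlgebra k Γ ⧸ idealA k I g) Y.1 ∧
      genClass k I g = SimClass.mk Y := by
  obtain ⟨Y, hY⟩ := exists_isShift (R := MonoidAlgebra k Γ) (X := MonoidAlgebra k Γ ⧸ idealA k I g)
  refine ⟨Y, hY, ?_⟩
  rw [genClass, quotClass_eq]
  exact shiftHom_mk hY

/-- The value of the invariants at `[ω¹(A_{I,φ})]` for `U ≤ I`. Dimension shifting turns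
`Ĥ⁰(U, ω¹(A))` into `Ĥ⁻¹(U, A)`. As `U` acts trivially on `A`, this is the `#U`-torsion of `A`, which
is isomorphic to `k[Γ/D] / #U`. -/
theorem tateInv_genClass_of_le (p : ℕ) [Fact p.Prime] (j : ℕ) {I U : Subgroup Γ}
    (V : Subgroup Γ) (g : Γ) (hU : Nat.card U = p ^ (j + 1)) (h : U ≤ I) :
    tateInv k p (p ^ j) U V (genClass k I g) =
      padicValNat p (Nat.card (k ⧸ Ideal.span {(p : k)})) * (V ⊔ decomp I g).index := by
  obtain ⟨Y, hY, hYc⟩ := exists_genClass_eq (k := k) I g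
  rw [hYc, tateInv_mk]
  let b := idealA k I g
  have hPI : Nat.card U ∣ Nat.card I := Subgroup.card_dvd_of_le h
  obtain ⟨q, hq⟩ : Nat.card U ∣ annA I g := hPI.trans (dvd_geometric _)
  have hUb : augIdeal k U ≤ b := (augIdeal_mono h).trans (augIdeal_le_idealA I g)
  let B : Ideal (MonoidAlgebra k Γ) :=
    Submodule.comap (LinearMap.mulLeft (MonoidAlgebra k Γ) (normElt k U)) b
  obtain ⟨e⟩ := Tate.nonempty_equiv_of_isShift (U := U) (B := B) (fun x => Iff.rfl) hY
  have hB : ∀ x, x ∈ B ↔ (Nat.card U : MonoidAlgebra k Γ) * x ∈ b := fun x => by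
    have h1 : normElt k U * x - (Nat.card U : MonoidAlgebra k Γ) * x ∈ b := by
      rw [← sub_mul]
      exact Ideal.mul_mem_right _ _ (hUb (normElt_sub_card_mem U))
    change normElt k U * x ∈ b ↔ _
    constructor
    · intro h2
      have := sub_mem h2 h1
      rwa [sub_sub_cancel] at this
    · intro h2
      have := add_mem h1 h2
      rwa [sub_add_cancel] at this
  let c : Ideal (MonoidAlgebra k Γ) :=
    augIdeal k (decomp I g) ⊔ Ideal.span {((Nat.card U : ℕ) : MonoidAlgebra k Γ)}
  -- multiplication by `z / #U` identifies `k[Γ/D] / #U` with the `#U`-torsion of `A_{I,φ}`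
  let F : MonoidAlgebra k Γ →ₗ[MonoidAlgebra k Γ]
      (B ⧸ (b ⊔ augIdeal k U).submoduleOf B) :=
    (Submodule.mkQ _) ∘ₗ (LinearMap.mulLeft (MonoidAlgebra k Γ) (q : MonoidAlgebra k Γ)).codRestrict
      B (fun x => by
        rw [hB, LinearMap.mulLeft_apply, ← mul_assoc, ← Nat.cast_mul, ← hq]
        exact Ideal.mul_mem_right _ _ (annA_mem I g))
  have hbU : b ⊔ augIdeal k U = b := sup_eq_left.mpr hUb
  have hF : Function.Surjective F := by
    intro y
    obtain ⟨⟨y, hy⟩, rfl⟩ := Submodule.mkQ_surjective _ y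
    obtain ⟨x, hx⟩ := exists_mul_sub_mem_of_natCast_mul_mem hq hPI ((hB y).mp hy)
    refine ⟨x, (Submodule.Quotient.eq _).mpr ?_⟩
    change (q : MonoidAlgebra k Γ) * x - y ∈ b ⊔ augIdeal k U
    rwa [hbU]
  have hk : LinearMap.ker F = c := by
    ext x
    have : x ∈ LinearMap.ker F ↔ (q : MonoidAlgebra k Γ) * x ∈ b ⊔ augIdeal k U :=
      Submodule.Quotient.mk_eq_zero _
    rw [this, hbU]
    exact natCast_mul_mem_iff hq hPI
  let e' := (Submodule.quotEquivOfEq _ _ hk.symm).trans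
    (LinearMap.quotKerEquivOfSurjective F hF)
  have hp0 : p ^ j ≠ 0 := pow_ne_zero _ (Fact.out : p.Prime).ne_zero
  rw [← count_congr _ _ (e'.trans e), count_quotient _ _ c
    (augIdeal k (decomp I g) ⊔ Ideal.span {((p : ℕ) : MonoidAlgebra k Γ)}), ← sup_assoc,
    ← augIdeal_sup, card_quotient_augIdeal_sup, padicValNat.pow, mul_comm]
  · intro x
    constructor
    · intro hx
      obtain ⟨i, hi, y, hy, rfl⟩ := Submodule.mem_sup.mp hx
      obtain ⟨y, rfl⟩ := Ideal.mem_span_singleton'.mp hy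
      rw [mul_add]
      refine add_mem (Submodule.mem_sup_left (Ideal.mul_mem_left _ _ hi))
        (Submodule.mem_sup_right (Ideal.mem_span_singleton'.mpr ⟨y, ?_⟩))
      rw [hU, pow_succ]
      push_cast
      ring
    · intro hx
      obtain ⟨i, hi, y, hy, hxy⟩ := Submodule.mem_sup.mp hx
      obtain ⟨y, rfl⟩ := Ideal.mem_span_singleton'.mp hy
      rw [← sub_add_cancel x (y * (p : MonoidAlgebra k Γ))]
      refine add_mem (Submodule.mem_sup_left (natCast_mul_mem_augIdeal hp0 ?_))
        (Submodule.mem_sup_right (Ideal.mul_mem_left _ _ (Ideal.mem_span_singleton_self _)))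
      have : ((p ^ j : ℕ) : MonoidAlgebra k Γ) * (x - y * (p : MonoidAlgebra k Γ)) = i := by
        rw [mul_sub, ← hxy, hU, pow_succ]
        push_cast
        ring
      rwa [this]

/-- The invariants of `[ω¹(A_{I,φ})]` vanish unless `U ≤ I`: the order of `I ⊓ U` annihilates
`Ĥ⁻¹(U, A)`, and it divides `p ^ j` if `U` has order `p ^ (j + 1)` and is not contained in `I`. -/
theorem tateInv_genClass_of_not_le (p : ℕ) [hp : Fact p.Prime] (j : ℕ) {I U : Subgroup Γ}
    (V : Subgroup Γ) (g : Γ) (hU : Nat.card U = p ^ (j + 1)) (h : ¬ U ≤ I) :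
    tateInv k p (p ^ j) U V (genClass k I g) = 0 := by
  obtain ⟨Y, hY, hYc⟩ := exists_genClass_eq (k := k) I g
  rw [hYc, tateInv_mk]
  let B : Ideal (MonoidAlgebra k Γ) :=
    Submodule.comap (LinearMap.mulLeft (MonoidAlgebra k Γ) (normElt k U)) (idealA k I g)
  obtain ⟨e⟩ := Tate.nonempty_equiv_of_isShift (U := U) (B := B) (fun x => Iff.rfl) hY
  have hs : Nat.card (I ⊓ U : Subgroup Γ) ∣ p ^ j := by
    obtain ⟨i, hi, hi'⟩ := (Nat.dvd_prime_pow hp.out).mp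
      (hU ▸ Subgroup.card_dvd_of_le (inf_le_right : I ⊓ U ≤ U))
    rw [hi']
    refine pow_dvd_pow p ?_
    by_contra hij
    have hij' : i = j + 1 := by omega
    apply h
    rw [hij', ← hU] at hi'
    exact inf_eq_right.mp (Subgroup.eq_of_le_of_card_ge inf_le_right hi'.ge)
  rw [← count_congr _ _ e, count_eq_one, padicValNat_one_right]
  intro t
  obtain ⟨⟨x, hx⟩, rfl⟩ := Submodule.mkQ_surjective _ t
  rw [← map_smul]
  exact (Submodule.Quotient.mk_eq_zero _).mpr (natCast_mul_mem_of_norm_mul_mem hs hx)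

/-! ### The generators of the monoid of admissible classes -/

omit [IsOrderLike k] [Finite Γ] in
/-- The module `A_{I,φ}` is the cyclic module `k[Γ] / 𝔟`. -/
theorem nonempty_equiv_moduleA (I : Subgroup Γ) (g : Γ) :
    Nonempty ((MonoidAlgebra k Γ ⧸ idealA k I g) ≃ₗ[MonoidAlgebra k Γ] moduleA k Γ I (g : Γ ⧸ I)) := by
  let J : Ideal (MonoidAlgebra k (Γ ⧸ I)) :=
    Ideal.span {1 - of k (Γ ⧸ I) (g : Γ ⧸ I)⁻¹ + (Nat.card I : MonoidAlgebra k (Γ ⧸ I))}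
  let F : MonoidAlgebra k Γ →ₗ[MonoidAlgebra k Γ] moduleA k Γ I (g : Γ ⧸ I) :=
    { toFun := fun x => (Ideal.Quotient.mk J (proj k I x) : MonoidAlgebra k (Γ ⧸ I) ⧸ J)
      map_add' := fun x y => by rw [map_add, map_add]; rfl
      map_smul' := fun x y => by rw [smul_eq_mul, map_mul, map_mul]; rfl }
  have hF : Function.Surjective F := by
    intro y
    obtain ⟨y, rfl⟩ := Ideal.Quotient.mk_surjective (I := J) y
    obtain ⟨x, rfl⟩ := proj_surjective I y
    exact ⟨x, rfl⟩
  refine ⟨(Submodule.quotEquivOfEq _ _ ?_).trans (LinearMap.quotKerEquivOfSurjective F hF)⟩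
  ext x
  have h1 : x ∈ LinearMap.ker F ↔ proj k I x ∈ J := Ideal.Quotient.eq_zero_iff_mem
  rw [h1, mem_idealA, Ideal.mem_span_singleton]
  refine exists_congr fun y => ?_
  have : (1 - of k (Γ ⧸ I) (g : Γ ⧸ I)⁻¹ + (Nat.card I : MonoidAlgebra k (Γ ⧸ I))) =
      ((Nat.card I + 1 : ℕ) : MonoidAlgebra k (Γ ⧸ I)) - of k (Γ ⧸ I) (g⁻¹ : Γ) := by
    push_cast
    rw [QuotientGroup.mk_inv]
    ring
  rw [this]

theorem Zadm_eq_closure : Zadm k Γ = AddSubmonoid.closure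
    {c | ∃ (I : Subgroup Γ) (g : Γ), I ≠ ⊥ ∧ IsElementary I ∧ c = genClass k I g} := by
  rw [Zadm]
  congr 1
  ext c
  constructor
  · rintro ⟨I, φ, hI, hE, Y, hY, rfl⟩
    obtain ⟨g, rfl⟩ := QuotientGroup.mk_surjective φ
    refine ⟨I, g, hI, hE, ?_⟩
    obtain ⟨e⟩ := nonempty_equiv_moduleA (k := k) I g
    rw [genClass, quotClass_eq]
    exact (shiftHom_mk (X := ⟨ModuleCat.of _ (MonoidAlgebra k Γ ⧸ idealA k I g),
      finite_quotient_idealA I g⟩) (hY.of_equiv e.symm)).symm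
  · rintro ⟨I, g, hI, hE, rfl⟩
    obtain ⟨Y, hY, hc⟩ := exists_genClass_eq (k := k) I g
    obtain ⟨e⟩ := nonempty_equiv_moduleA (k := k) I g
    exact ⟨I, g, hI, hE, Y, hY.of_equiv e, hc⟩

end TateInv

/-! ### Change of the annihilating element -/

section Change

variable {R : Type u} [CommRing R]

/-- If the integer `z` annihilates `R / b`, then the `p`-primary part of `R / b` is `R / (b, p ^ N)` for
every `N` at least the exponent of `p` in `z`. -/
theorem sup_span_pow_eq_of_le {b : Ideal R} {z p N N' : ℕ} (hp : p.Prime) (hz : z ≠ 0)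
    (h : (z : R) ∈ b) (hN : z.factorization p ≤ N) (hNN' : N ≤ N') :
    b ⊔ Ideal.span {((p ^ N : ℕ) : R)} = b ⊔ Ideal.span {((p ^ N' : ℕ) : R)} := by
  refine le_antisymm (sup_le le_sup_left ?_) (sup_le le_sup_left ?_)
  · rw [Ideal.span_singleton_le_iff_mem]
    obtain ⟨i, hi, hi'⟩ := (Nat.dvd_prime_pow hp).mp (Nat.gcd_dvd_right z (p ^ N'))
    have h1 : i ≤ N := by
      have h2 : p ^ i ∣ z := hi' ▸ Nat.gcd_dvd_left z (p ^ N')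
      exact ((hp.pow_dvd_iff_le_factorization hz).mp h2).trans hN
    have h3 := Nat.gcd_eq_gcd_ab z (p ^ N')
    rw [hi'] at h3
    have h4 : ((p ^ i : ℕ) : R) = (z : R) * ((z.gcdA (p ^ N') : ℤ) : R) +
        ((p ^ N' : ℕ) : R) * ((z.gcdB (p ^ N') : ℤ) : R) := by
      exact_mod_cast congrArg (Int.cast : ℤ → R) h3
    have h5 : ((p ^ N : ℕ) : R) = ((p ^ (N - i) : ℕ) : R) * ((p ^ i : ℕ) : R) := by
      rw [← Nat.cast_mul, ← pow_add, Nat.sub_add_cancel h1]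
    rw [h5, h4]
    exact Ideal.mul_mem_left _ _ (add_mem (Submodule.mem_sup_left (Ideal.mul_mem_right _ _ h))
      (Submodule.mem_sup_right (Ideal.mul_mem_right _ _ (Ideal.mem_span_singleton_self _))))
  · rw [Ideal.span_singleton_le_iff_mem]
    refine Submodule.mem_sup_right (Ideal.mem_span_singleton'.mpr ⟨((p ^ (N' - N) : ℕ) : R), ?_⟩)
    rw [← Nat.cast_mul, ← pow_add, Nat.sub_add_cancel hNN']

theorem sup_span_mul_eq {b : Ideal R} {r p N : ℕ} (hr : p.Coprime r) (f : R) :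
    b ⊔ Ideal.span {(r : R) * f} ⊔ Ideal.span {((p ^ N : ℕ) : R)} =
      b ⊔ Ideal.span {f} ⊔ Ideal.span {((p ^ N : ℕ) : R)} := by
  refine le_antisymm (sup_le_sup_right (sup_le_sup_left ?_ _) _)
    (sup_le (sup_le (le_sup_left.trans le_sup_left) ?_) le_sup_right)
  · rw [Ideal.span_singleton_le_iff_mem]
    exact Ideal.mul_mem_left _ _ (Ideal.mem_span_singleton_self _)
  · rw [Ideal.span_singleton_le_iff_mem]
    obtain ⟨u, v, huv⟩ := Nat.Coprime.isCoprime (Nat.Coprime.pow_left N hr)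
    have huv' : (u : R) * (p ^ N : ℕ) + (v : R) * r = 1 := by
      exact_mod_cast congrArg (Int.cast : ℤ → R) huv
    have : f = v * (r * f) + (u * f) * ((p ^ N : ℕ) : R) := by
      linear_combination (-f) * huv'
    refine (congrArg (· ∈ b ⊔ Ideal.span {(r : R) * f} ⊔ Ideal.span {((p ^ N : ℕ) : R)}) this).mpr
      (add_mem (Submodule.mem_sup_left (Submodule.mem_sup_right (Ideal.mul_mem_left _ _
        (Ideal.mem_span_singleton_self _)))) (Submodule.mem_sup_right
          (Ideal.mul_mem_left _ _ (Ideal.mem_span_singleton_self _))))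

/-- The relations defining the mapping cone of `R / a → R / a × R` with components `f` and `ν`,
where `ν` annihilates `a`. -/
def coneSub (a : Ideal R) (f ν : R) : Submodule R (R × R) :=
  (Submodule.prod a ⊥) ⊔ Submodule.span R {(f, ν)}

theorem mem_coneSub {a : Ideal R} {f ν : R} {x : R × R} :
    x ∈ coneSub a f ν ↔ ∃ i ∈ a, ∃ y, x = (i + y * f, y * ν) := by
  rw [coneSub, Submodule.mem_sup]
  constructor
  · rintro ⟨⟨i, j⟩, ⟨hi, hj⟩, z, hz, rfl⟩
    obtain ⟨y, rfl⟩ := Submodule.mem_span_singleton.mp hz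
    have hj' : j = 0 := hj
    exact ⟨i, hi, y, by ext <;> simp [hj']⟩
  · rintro ⟨i, hi, y, rfl⟩
    exact ⟨(i, 0), ⟨hi, Submodule.zero_mem _⟩, y • (f, ν),
      Submodule.smul_mem _ _ (Submodule.mem_span_singleton_self _), by ext <;> simp⟩

/-- The quotient of the cone by the free submodule generated by `(-c, 1)` is `R / (a, f')` with
`f' = f + c ν` modulo `a`. -/
theorem cone_quotient_equiv (a : Ideal R) (f ν c f' t : R) (hf' : f' - f - c * ν ∈ a) :
    Nonempty ((((R × R) ⧸ coneSub a f ν) ⧸ (Submodule.span R {(coneSub a f ν).mkQ (-c, 1)} ⊔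
        LinearMap.range (LinearMap.lsmul R ((R × R) ⧸ coneSub a f ν) t))) ≃ₗ[R]
      (R ⧸ (a ⊔ Ideal.span {f'} ⊔ Ideal.span {t}))) := by
  let b := a ⊔ Ideal.span {f'} ⊔ Ideal.span {t}
  have hab : a ≤ b := le_sup_left.trans le_sup_left
  have hfb : f' ∈ b := Submodule.mem_sup_left (Submodule.mem_sup_right
    (Ideal.mem_span_singleton_self _))
  have htb : t ∈ b := Submodule.mem_sup_right (Ideal.mem_span_singleton_self _)
  let F₀ : R × R →ₗ[R] R ⧸ b := (Submodule.mkQ b) ∘ₗ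
    (LinearMap.fst R R R + c • LinearMap.snd R R R)
  have hF₀ : ∀ x y, F₀ (x, y) = Submodule.Quotient.mk (x + c * y) := fun x y => rfl
  have hS : coneSub a f ν ≤ LinearMap.ker F₀ := by
    intro x hx
    obtain ⟨i, hi, y, rfl⟩ := mem_coneSub.mp hx
    rw [LinearMap.mem_ker, hF₀]
    refine (Submodule.Quotient.mk_eq_zero _).mpr ?_
    have : i + y * f + c * (y * ν) = i + y * f' - y * (f' - f - c * ν) := by ring
    rw [this]
    exact sub_mem (add_mem (hab hi) (Ideal.mul_mem_left _ _ hfb))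
      (Ideal.mul_mem_left _ _ (hab hf'))
  let F := (coneSub a f ν).liftQ F₀ hS
  have hF : ∀ x, F ((coneSub a f ν).mkQ x) = F₀ x := fun x => rfl
  have hFs : Function.Surjective F := fun y => by
    obtain ⟨y, rfl⟩ := b.mkQ_surjective y
    refine ⟨(coneSub a f ν).mkQ (y, 0), ?_⟩
    rw [hF, hF₀, mul_zero, add_zero]
    rfl
  refine ⟨(Submodule.quotEquivOfEq _ _ ?_).trans (LinearMap.quotKerEquivOfSurjective F hFs)⟩
  refine le_antisymm (sup_le ?_ ?_) ?_
  · rw [Submodule.span_singleton_le_iff_mem, LinearMap.mem_ker, hF, hF₀]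
    simp
  · rintro _ ⟨x, rfl⟩
    obtain ⟨y, hy⟩ := b.mkQ_surjective (F x)
    rw [LinearMap.mem_ker, LinearMap.lsmul_apply, map_smul, ← hy, ← map_smul]
    exact (Submodule.Quotient.mk_eq_zero _).mpr (Ideal.mul_mem_right _ _ htb)
  · intro x hx
    obtain ⟨⟨x, y⟩, rfl⟩ := (coneSub a f ν).mkQ_surjective x
    rw [LinearMap.mem_ker, hF, hF₀] at hx
    obtain ⟨j, hj, z, hz, hxy⟩ := Submodule.mem_sup.mp ((Submodule.Quotient.mk_eq_zero _).mp hx)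
    obtain ⟨i, hi, v, hv, rfl⟩ := Submodule.mem_sup.mp hj
    obtain ⟨v, rfl⟩ := Ideal.mem_span_singleton'.mp hv
    obtain ⟨z, rfl⟩ := Ideal.mem_span_singleton'.mp hz
    have h1 : (x, y) = (i + v * (f' - f - c * ν) + v * f, v * ν) +
        ((y - v * ν) • ((-c, 1) : R × R) + t • ((z, 0) : R × R)) := by
      ext
      · simp only [Prod.fst_add, Prod.smul_fst, smul_eq_mul]
        linear_combination -hxy
      · simp
    have h2 : (i + v * (f' - f - c * ν) + v * f, v * ν) ∈ coneSub a f ν :=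
      mem_coneSub.mpr ⟨_, add_mem hi (Ideal.mul_mem_left _ v hf'), v, rfl⟩
    have h3 : (coneSub a f ν).mkQ (i + v * (f' - f - c * ν) + v * f, v * ν) = 0 :=
      (Submodule.Quotient.mk_eq_zero _).mpr h2
    rw [h1, map_add, h3, zero_add, map_add, map_smul, map_smul]
    exact add_mem (Submodule.mem_sup_left (Submodule.smul_mem _ _
      (Submodule.mem_span_singleton_self _))) (Submodule.mem_sup_right ⟨_, rfl⟩)

/-- The class of the `p`-primary part of `R / (a, f)` does not change if a multiple of `ν` is added
to `f`. -/
theorem exists_forall_quotClass_eq [IsOrderLike R] (a : Ideal R) (f ν c f' : R)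
    (hf' : f' - f - c * ν ∈ a) (hν : ∀ x ∈ a, x * ν = 0) (h₁ : ∀ x, x * f ∈ a → x ∈ a)
    (h₂ : ∀ x, x * f' ∈ a → x ∈ a) [Finite (R ⧸ a ⊔ Ideal.span {f})]
    [Finite (R ⧸ a ⊔ Ideal.span {f'})] (p : ℕ) (hp : p.Prime) : ∃ N₀, ∀ N, N₀ ≤ N →
      quotClass (a ⊔ Ideal.span {f} ⊔ Ideal.span {((p ^ N : ℕ) : R)}) =
        quotClass (a ⊔ Ideal.span {f'} ⊔ Ideal.span {((p ^ N : ℕ) : R)}) := by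
  let S := coneSub a f ν
  have key : ∀ c f' : R, f' - f - c * ν ∈ a → (∀ x, x * f' ∈ a → x ∈ a) →
      ∀ x : R, x • S.mkQ (-c, 1) = 0 → x = 0 := by
    intro c f' hf' hr x hx
    rw [← map_smul] at hx
    obtain ⟨i, hi, y, hy⟩ := mem_coneSub.mp ((Submodule.Quotient.mk_eq_zero _).mp hx)
    have hy1 : x * -c = i + y * f := congrArg Prod.fst hy
    have hy2 : x = y * ν := by simpa using congrArg Prod.snd hy
    have h1 : y * f' ∈ a := by
      have : y * f' = y * (f' - f - c * ν) - i := by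
        rw [hy2] at hy1
        linear_combination -hy1
      rw [this]
      exact sub_mem (Ideal.mul_mem_left _ _ hf') hi
    rw [hy2, hν y (hr y h1)]
  have fin : ∀ c f' : R, f' - f - c * ν ∈ a → Finite (R ⧸ a ⊔ Ideal.span {f'}) →
      Finite (((R × R) ⧸ S) ⧸ Submodule.span R {S.mkQ (-c, 1)}) := by
    intro c f' hf' hfin
    obtain ⟨e⟩ := cone_quotient_equiv a f ν c f' 0 hf'
    have h1 : LinearMap.range (LinearMap.lsmul R ((R × R) ⧸ S) 0) = ⊥ := by
      rw [map_zero, LinearMap.range_zero]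
    rw [h1, sup_bot_eq, Ideal.span_singleton_eq_bot.mpr rfl, sup_bot_eq] at e
    exact Finite.of_equiv _ e.symm.toEquiv
  have hf0 : f - f - 0 * ν ∈ a := by simp
  have := fin 0 f hf0 inferInstance
  have := fin c f' hf' inferInstance
  obtain ⟨N₀, hN₀⟩ := exists_forall_sim_quotient_span_singleton (S.mkQ (-0, 1))
    (S.mkQ (-c, 1)) (key 0 f hf0 h₁) (key c f' hf' h₂) p hp
  refine ⟨N₀, fun N hN => ?_⟩
  obtain ⟨e₁⟩ := cone_quotient_equiv a f ν 0 f ((p ^ N : ℕ) : R) hf0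
  obtain ⟨e₂⟩ := cone_quotient_equiv a f ν c f' ((p ^ N : ℕ) : R) hf'
  have := finite_quotient_of_le
    (le_sup_left : a ⊔ Ideal.span {f} ≤ a ⊔ Ideal.span {f} ⊔ Ideal.span {((p ^ N : ℕ) : R)})
  have := finite_quotient_of_le
    (le_sup_left : a ⊔ Ideal.span {f'} ≤ a ⊔ Ideal.span {f'} ⊔ Ideal.span {((p ^ N : ℕ) : R)})
  rw [quotClass_eq, quotClass_eq]
  exact Sim.of_eq ((Sim.of_equiv e₁.symm).trans ((hN₀ N hN).trans
    (Sim.of_equiv e₂.symm).symm))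

end Change

/-! ### Primary parts of finite abelian groups -/

section PrimaryParts

variable {Γ : Type u} [CommGroup Γ]

variable (Γ) in
/-- The Sylow `p`-subgroup of a finite abelian group. -/
noncomputable def pPart (p : ℕ) : Subgroup Γ :=
  (powMonoidHom (p ^ (Nat.card Γ).factorization p) : Γ →* Γ).ker

variable (Γ) in
/-- The subgroup of the elements of order prime to `p` in a finite abelian group. -/
noncomputable def pCompl (p : ℕ) : Subgroup Γ :=
  (powMonoidHom (Nat.card Γ / p ^ (Nat.card Γ).factorization p) : Γ →* Γ).ker

theorem mem_pPart {p : ℕ} {x : Γ} :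
    x ∈ pPart Γ p ↔ x ^ p ^ (Nat.card Γ).factorization p = 1 := Iff.rfl

theorem mem_pCompl {p : ℕ} {x : Γ} :
    x ∈ pCompl Γ p ↔ x ^ (Nat.card Γ / p ^ (Nat.card Γ).factorization p) = 1 := Iff.rfl

variable [Finite Γ]

theorem coprime_ordCompl {p : ℕ} (hp : p.Prime) (i : ℕ) :
    (p ^ i).Coprime (Nat.card Γ / p ^ (Nat.card Γ).factorization p) :=
  Nat.Coprime.pow_left _ (Nat.coprime_ordCompl hp
    (Nat.card_ne_zero.mpr ⟨inferInstance, inferInstance⟩))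

omit [Finite Γ] in
theorem pow_mem_pCompl {p : ℕ} (x : Γ) :
    x ^ p ^ (Nat.card Γ).factorization p ∈ pCompl Γ p := by
  rw [mem_pCompl, ← pow_mul, Nat.ordProj_mul_ordCompl_eq_self, pow_card_eq_one']

omit [Finite Γ] in
theorem mem_of_pow_mem_of_coprime {U : Subgroup Γ} {x : Γ} {r s : ℕ} (h : r.Coprime s)
    (hr : x ^ r ∈ U) (hs : x ^ s ∈ U) : x ∈ U := by
  obtain ⟨u, v, huv⟩ := Nat.Coprime.isCoprime h
  have : x = (x ^ r) ^ u * (x ^ s) ^ v := by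
    rw [← zpow_natCast, ← zpow_natCast, ← zpow_mul, ← zpow_mul, ← zpow_add, mul_comm (r : ℤ),
      mul_comm (s : ℤ), huv, zpow_one]
  rw [this]
  exact mul_mem (zpow_mem hr u) (zpow_mem hs v)

theorem exists_eq_mul_of_prime {p : ℕ} (hp : p.Prime) (x : Γ) :
    ∃ a ∈ Subgroup.zpowers x ⊓ pPart Γ p, ∃ b ∈ Subgroup.zpowers x ⊓ pCompl Γ p, x = a * b := by
  obtain ⟨u, v, huv⟩ := Nat.Coprime.isCoprime (coprime_ordCompl (Γ := Γ) hp
    ((Nat.card Γ).factorization p))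
  refine ⟨(x ^ (Nat.card Γ / p ^ (Nat.card Γ).factorization p)) ^ v, ⟨?_, ?_⟩,
    (x ^ p ^ (Nat.card Γ).factorization p) ^ u, ⟨?_, ?_⟩, ?_⟩
  · exact zpow_mem (pow_mem (Subgroup.mem_zpowers x) _) _
  · refine zpow_mem (mem_pPart.mpr ?_) _
    rw [← pow_mul, mul_comm, Nat.ordProj_mul_ordCompl_eq_self, pow_card_eq_one']
  · exact zpow_mem (pow_mem (Subgroup.mem_zpowers x) _) _
  · exact zpow_mem (pow_mem_pCompl x) _
  · rw [← zpow_natCast, ← zpow_natCast, ← zpow_mul, ← zpow_mul, ← zpow_add, mul_comm _ v,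
      mul_comm _ u, add_comm, huv, zpow_one]

theorem pPart_inf_pCompl {p : ℕ} (hp : p.Prime) : pPart Γ p ⊓ pCompl Γ p = ⊥ := by
  rw [eq_bot_iff]
  rintro x ⟨h1, h2⟩
  refine mem_of_pow_mem_of_coprime (U := ⊥) (coprime_ordCompl (Γ := Γ) hp ((Nat.card Γ).factorization p)) ?_ ?_
  · exact Subgroup.mem_bot.mpr (mem_pPart.mp h1)
  · exact Subgroup.mem_bot.mpr (mem_pCompl.mp h2)

theorem inf_sup_inf {p : ℕ} (hp : p.Prime) (U : Subgroup Γ) :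
    (U ⊓ pPart Γ p) ⊔ (U ⊓ pCompl Γ p) = U := by
  refine le_antisymm (sup_le inf_le_left inf_le_left) fun x hx => ?_
  obtain ⟨a, ha, b, hb, rfl⟩ := exists_eq_mul_of_prime hp x
  have h := Subgroup.zpowers_le.mpr hx
  exact Subgroup.mul_mem_sup ⟨h ha.1, ha.2⟩ ⟨h hb.1, hb.2⟩

theorem not_dvd_card_of_le_pCompl {p : ℕ} (hp : p.Prime) {U : Subgroup Γ} (h : U ≤ pCompl Γ p) :
    ¬ p ∣ Nat.card U := by
  intro hd
  have := Fact.mk hp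
  obtain ⟨x, hx⟩ := exists_prime_orderOf_dvd_card' p hd
  have h1 : (x : Γ) ^ p = 1 := by
    rw [← Subgroup.coe_pow, ← hx, pow_orderOf_eq_one, Subgroup.coe_one]
  have h2 : (x : Γ) ∈ (⊥ : Subgroup Γ) := by
    have := coprime_ordCompl (Γ := Γ) hp 1
    rw [pow_one] at this
    refine mem_of_pow_mem_of_coprime this (Subgroup.mem_bot.mpr h1) ?_
    exact Subgroup.mem_bot.mpr (mem_pCompl.mp (h x.2))
  have h3 : x = 1 := Subtype.ext (Subgroup.mem_bot.mp h2)
  rw [h3, orderOf_one] at hx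
  exact hp.one_lt.ne hx

omit [Finite Γ] in
theorem card_sup_dvd_mul (A B : Subgroup Γ) :
    Nat.card (A ⊔ B : Subgroup Γ) ∣ Nat.card A * Nat.card B := by
  rw [← Nat.card_prod]
  have h : (A.subtype.coprod B.subtype).range = A ⊔ B := by
    rw [MonoidHom.range_eq_map]
    refine le_antisymm ?_ (sup_le (fun a ha => ⟨(⟨a, ha⟩, 1), trivial, by simp⟩)
      (fun b hb => ⟨(1, ⟨b, hb⟩), trivial, by simp⟩))
    rintro _ ⟨⟨a, b⟩, -, rfl⟩
    exact Subgroup.mul_mem_sup a.2 b.2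
  rw [← h]
  exact Subgroup.card_range_dvd _

end PrimaryParts

/-! ### Primary parts of the admissible classes -/

section PrimaryClasses

open MonoidAlgebra

variable {k : Type} [CommRing k] {Γ : Type u} [CommGroup Γ] [Finite Γ]

variable (Γ) in
/-- An integer larger than all the integers `annA I g`. -/
noncomputable def bigN : ℕ := (1 + Nat.card Γ) ^ Nat.card Γ

theorem geometric_lt_bigN {I : Subgroup Γ} {G : Type*} [Group G] (ψ : G)
    (h : orderOf ψ ≤ Nat.card Γ) : (Nat.card I + 1) ^ orderOf ψ - 1 < bigN Γ := by
  have h1 : (Nat.card I + 1) ^ orderOf ψ ≤ bigN Γ := by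
    refine (Nat.pow_le_pow_right (by omega) h).trans (Nat.pow_le_pow_left ?_ _)
    have := Subgroup.card_le_card_group I
    omega
  have h2 : 0 < (Nat.card I + 1) ^ orderOf ψ := by positivity
  omega

theorem annA_lt_bigN (I : Subgroup Γ) (g : Γ) : annA I g < bigN Γ :=
  geometric_lt_bigN _ ((orderOf_le_card).trans
    (Nat.card_le_card_of_surjective _ (QuotientGroup.mk_surjective (s := I))))

theorem factorization_annA_le (I : Subgroup Γ) (g : Γ) (p : ℕ) :
    (annA I g).factorization p ≤ bigN Γ :=
  ((Nat.factorization_lt p (annA_ne_zero I g)).trans (annA_lt_bigN I g)).le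

variable (k) in
/-- The class of the `p`-primary part of the module `A_{I,φ}`, where `g` represents `φ`. -/
noncomputable def primClass (p : ℕ) (I : Subgroup Γ) (g : Γ) : SimClass (MonoidAlgebra k Γ) :=
  quotClass (idealA k I g ⊔ Ideal.span {((p ^ bigN Γ : ℕ) : MonoidAlgebra k Γ)})

variable [IsOrderLike k]

theorem mul_frobElt_regular {J : Subgroup Γ} {g : Γ} {n r : ℕ} (hn : n ≠ 0) (hr : r ≠ 0)
    {x : MonoidAlgebra k Γ} (h : x * ((r : MonoidAlgebra k Γ) * frobElt k g n) ∈ augIdeal k J) :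
    x ∈ augIdeal k J := by
  have h1 : (r : MonoidAlgebra k Γ) * (frobElt k g n * x) ∈ augIdeal k J := by
    convert h using 1; ring
  have h2 := natCast_mul_mem_augIdeal hr h1
  rw [← ker_proj, RingHom.mem_ker, map_mul, proj_frobElt] at h2
  rw [← ker_proj, RingHom.mem_ker]
  exact geometric_regular _ hn _ h2

theorem finite_quotient_mul_frobElt (J : Subgroup Γ) (g : Γ) {n r : ℕ} (hn : n ≠ 0) (hr : r ≠ 0) :
    Finite (MonoidAlgebra k Γ ⧸ augIdeal k J ⊔
      Ideal.span {(r : MonoidAlgebra k Γ) * frobElt k g n}) := by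
  refine finite_quotient_of_natCast_mem
    (mul_ne_zero hr (geometric_ne_zero ((g⁻¹ : Γ) : Γ ⧸ J) hn)) ?_
  obtain ⟨g', e, hg, -⟩ := exists_geometric (k := k) ((g⁻¹ : Γ) : Γ ⧸ J) n
  rw [mem_augIdeal_sup_span]
  refine ⟨g', ?_⟩
  rw [map_natCast, map_mul, proj_frobElt, map_natCast, mul_assoc, hg, Nat.cast_mul]

/-- The primary parts of `A_{I,φ}` at primes not dividing `#I` are cohomologically trivial. -/
theorem primClass_eq_zero {p : ℕ} (hp : p.Prime) (I : Subgroup Γ) (g : Γ)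
    (h : ¬ p ∣ Nat.card I) : primClass k p I g = 0 := by
  let n := Nat.card I
  let F := frobElt k g n
  have hn : n ≠ 0 := card_subgroup_ne_zero I
  have hreg : ∀ x, F * x = 0 → x = 0 := fun x hx => geometric_regular _ hn x hx
  obtain ⟨g', e, hg, -⟩ := exists_geometric (k := k) (g⁻¹ : Γ) n
  let z := (n + 1) ^ orderOf (g⁻¹ : Γ) - 1
  have hz : z ≠ 0 := geometric_ne_zero _ hn
  have hzF : (z : MonoidAlgebra k Γ) ∈ Ideal.span {F} :=
    Ideal.mem_span_singleton.mpr ⟨g', hg.symm⟩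
  have hfin : Finite (MonoidAlgebra k Γ ⧸ Ideal.span {F}) := finite_quotient_of_natCast_mem hz hzF
  have hP := InP.quotient_span_singleton F hreg
  let N := bigN Γ
  let b := idealA k I g ⊔ Ideal.span {((p ^ N : ℕ) : MonoidAlgebra k Γ)}
  let s := z.factorization p
  let t' := z / p ^ s
  have hs : s ≤ N := ((Nat.factorization_lt p hz).trans
    (geometric_lt_bigN _ orderOf_le_card)).le
  have hzt : p ^ s * t' = z := Nat.ordProj_mul_ordCompl_eq_self z p
  have hcop : (p ^ N).Coprime (t' * n) := by
    refine Nat.Coprime.pow_left _ (Nat.Coprime.mul_right (Nat.coprime_ordCompl hp hz) ?_)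
    exact (Nat.Prime.coprime_iff_not_dvd hp).mpr h
  obtain ⟨u, v, huv⟩ := Nat.Coprime.isCoprime hcop
  have huv' : (u : MonoidAlgebra k Γ) * (p ^ N : ℕ) + (v : MonoidAlgebra k Γ) * (t' * n) = 1 := by
    exact_mod_cast congrArg (Int.cast : ℤ → MonoidAlgebra k Γ) huv
  let c : MonoidAlgebra k Γ := v * t'
  have hFb : Ideal.span {F} ≤ b := le_sup_right.trans le_sup_left
  have hIb : augIdeal k I ≤ b := le_sup_left.trans le_sup_left
  have hpb : ((p ^ N : ℕ) : MonoidAlgebra k Γ) ∈ b :=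
    Submodule.mem_sup_right (Ideal.mem_span_singleton_self _)
  let r : (MonoidAlgebra k Γ ⧸ Ideal.span {F}) →ₗ[MonoidAlgebra k Γ] (MonoidAlgebra k Γ ⧸ b) :=
    Submodule.factor hFb
  let i : (MonoidAlgebra k Γ ⧸ b) →ₗ[MonoidAlgebra k Γ] (MonoidAlgebra k Γ ⧸ Ideal.span {F}) :=
    Submodule.liftQ b ((Submodule.mkQ _) ∘ₗ LinearMap.mulRight _ (c * normElt k I)) (by
      refine sup_le (sup_le ?_ ?_) ?_
      · intro x hx
        refine (Submodule.Quotient.mk_eq_zero _).mpr ?_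
        have : x * (c * normElt k I) = c * (x * normElt k I) := by ring
        rw [LinearMap.mulRight_apply, this, mul_normElt_eq_zero hx, mul_zero]
        exact zero_mem _
      · rw [Ideal.span_singleton_le_iff_mem]
        refine (Submodule.Quotient.mk_eq_zero _).mpr ?_
        exact Ideal.mul_mem_right _ _ (Ideal.mem_span_singleton_self _)
      · rw [Ideal.span_singleton_le_iff_mem]
        refine (Submodule.Quotient.mk_eq_zero _).mpr ?_
        have : ((p ^ N : ℕ) : MonoidAlgebra k Γ) * (c * normElt k I) =
            (z : MonoidAlgebra k Γ) * ((p ^ (N - s) : ℕ) * v * normElt k I) := by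
          rw [← hzt, ← Nat.sub_add_cancel hs, pow_add, Nat.add_sub_cancel]
          push_cast
          ring
        rw [LinearMap.mulRight_apply, this]
        exact Ideal.mul_mem_right _ _ hzF)
  have hT := hP.of_retract i r (by
    intro x
    obtain ⟨x, rfl⟩ := Submodule.mkQ_surjective _ x
    refine (Submodule.Quotient.eq _).mpr ?_
    have h1 := normElt_sub_card_mem (k := k) I
    have : x * (c * normElt k I) - x = x * c * (normElt k I - (Nat.card I : MonoidAlgebra k Γ)) -
        x * u * (p ^ N : ℕ) := by
      change _ = x * (v * t') * (_ - (n : MonoidAlgebra k Γ)) - _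
      change x * ((v * t') * _) - _ = _
      linear_combination x * huv'
    change x * (c * normElt k I) - x ∈ b
    rw [this]
    exact sub_mem (Ideal.mul_mem_left _ _ (hIb h1)) (Ideal.mul_mem_left _ _ hpb))
  have := hT.1
  change quotClass b = 0
  rw [quotClass_eq]
  exact hT.of_eq_zero

omit [IsOrderLike k] in
/-- The elements of order prime to `p` of `D` act trivially on the `p`-primary part of
`A_{I,φ}`. -/
theorem idealA_sup_span_pow_eq {p : ℕ} (hp : p.Prime) (I : Subgroup Γ) (g : Γ)
    (h : p ∣ Nat.card I) (N : ℕ) :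
    idealA k I g ⊔ Ideal.span {((p ^ N : ℕ) : MonoidAlgebra k Γ)} =
      augIdeal k (I ⊔ decomp I g ⊓ pCompl Γ p) ⊔ Ideal.span {frobElt k g (Nat.card I)} ⊔
        Ideal.span {((p ^ N : ℕ) : MonoidAlgebra k Γ)} := by
  let b := idealA k I g ⊔ Ideal.span {((p ^ N : ℕ) : MonoidAlgebra k Γ)}
  refine le_antisymm (sup_le_sup_right (sup_le_sup_right (augIdeal_mono le_sup_left) _) _)
    (sup_le (sup_le ?_ (le_sup_right.trans le_sup_left)) le_sup_right)
  rw [augIdeal_sup]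
  refine sup_le (le_sup_left.trans le_sup_left) ?_
  rw [augIdeal_le_iff_le_trivialOn]
  have hI : I ≤ trivialOn b := by
    rw [← augIdeal_le_iff_le_trivialOn]
    exact le_sup_left.trans le_sup_left
  have hg : g ^ p ^ N ∈ trivialOn b := by
    rw [← inv_mem_iff, ← inv_pow, mem_trivialOn, ← Ideal.Quotient.mk_eq_mk_iff_sub_mem]
    have h1 : Ideal.Quotient.mk b (of k Γ g⁻¹) = Ideal.Quotient.mk b ((Nat.card I + 1 : ℕ)) := by
      rw [eq_comm, Ideal.Quotient.mk_eq_mk_iff_sub_mem]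
      exact Submodule.mem_sup_left (Submodule.mem_sup_right (Ideal.mem_span_singleton_self _))
    rw [map_pow, map_pow, h1, ← map_pow, Ideal.Quotient.mk_eq_mk_iff_sub_mem]
    have h2 : ((p : ℕ) : ℤ) ∣ ((Nat.card I + 1 : ℕ) : ℤ) - 1 := by
      push_cast
      rw [add_sub_cancel_right]
      exact_mod_cast h
    have h3 := (pow_dvd_pow (p : ℤ) (Nat.le_succ N)).trans (dvd_sub_pow_of_dvd_sub h2 N)
    obtain ⟨c, hc⟩ := h3
    rw [one_pow] at hc
    have h4 : ((Nat.card I + 1 : ℕ) : MonoidAlgebra k Γ) ^ p ^ N - 1 =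
        ((p ^ N : ℕ) : MonoidAlgebra k Γ) * (c : MonoidAlgebra k Γ) := by
      exact_mod_cast congrArg (Int.cast : ℤ → MonoidAlgebra k Γ) hc
    rw [h4]
    exact Ideal.mul_mem_right _ _ (Submodule.mem_sup_right (Ideal.mem_span_singleton_self _))
  have hD : decomp I g ≤ (trivialOn b).comap (powMonoidHom (p ^ N)) := by
    rw [decomp_le]
    exact ⟨fun x hx => pow_mem (hI hx) _, hg⟩
  rintro d ⟨h1, h2⟩
  refine mem_of_pow_mem_of_coprime (coprime_ordCompl (Γ := Γ) hp N) (hD h1) ?_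
  rw [mem_pCompl.mp h2]
  exact one_mem _

omit [IsOrderLike k] [Finite Γ] in
/-- If `g⁻¹` acts as the integer `1 + n`, then `g ^ (-a)` acts as `(1 + n) ^ a`; the converse holds
on `p`-primary modules if `a` is prime to `p` and `g` has `p`-power order. -/
theorem sup_span_frobElt_eq {p : ℕ} (J : Subgroup Γ) {g h : Γ} {n a s : ℕ}
    (hn : p ∣ n) (ha : a.Coprime p) (hp : p.Prime) (hg : g ^ p ^ s ∈ J) (hgh : h * (g ^ a)⁻¹ ∈ J)
    (N : ℕ) :
    augIdeal k J ⊔ Ideal.span {frobElt k g n} ⊔ Ideal.span {((p ^ N : ℕ) : MonoidAlgebra k Γ)} =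
      augIdeal k J ⊔ Ideal.span {frobElt k h ((n + 1) ^ a - 1)} ⊔
        Ideal.span {((p ^ N : ℕ) : MonoidAlgebra k Γ)} := by
  have hw : (n + 1) ^ a - 1 + 1 = (n + 1) ^ a := Nat.sub_add_cancel (Nat.one_le_pow _ _ (by omega))
  have hJ : ∀ c : Ideal (MonoidAlgebra k Γ), augIdeal k J ≤ c →
      Ideal.Quotient.mk c (of k Γ h⁻¹) = Ideal.Quotient.mk c (of k Γ g⁻¹) ^ a := by
    intro c hc
    have h1 := hc (of_sub_one_mem (k := k) (inv_mem hgh))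
    have h2 : of k Γ h⁻¹ - of k Γ g⁻¹ ^ a =
        of k Γ g⁻¹ ^ a * (of k Γ (h * (g ^ a)⁻¹)⁻¹ - 1) := by
      rw [mul_sub, ← map_pow, ← map_mul, mul_one, inv_pow, mul_inv, inv_inv]
      congr 2
      rw [mul_comm h⁻¹, inv_mul_cancel_left]
    rw [← map_pow, Ideal.Quotient.mk_eq_mk_iff_sub_mem, h2]
    exact Ideal.mul_mem_left _ _ h1
  have key : ∀ (c : Ideal (MonoidAlgebra k Γ)) (x : Γ) (m : ℕ), frobElt k x m ∈ c ↔
      Ideal.Quotient.mk c (of k Γ x⁻¹) = ((m + 1 : ℕ) : MonoidAlgebra k Γ ⧸ c) := by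
    intro c x m
    rw [eq_comm, ← map_natCast (Ideal.Quotient.mk c), Ideal.Quotient.mk_eq_mk_iff_sub_mem, frobElt]
  refine le_antisymm (sup_le (sup_le (le_sup_left.trans le_sup_left) ?_) le_sup_right)
    (sup_le (sup_le (le_sup_left.trans le_sup_left) ?_) le_sup_right)
  · rw [Ideal.span_singleton_le_iff_mem, key]
    set c := augIdeal k J ⊔ Ideal.span {frobElt k h ((n + 1) ^ a - 1)} ⊔
        Ideal.span {((p ^ N : ℕ) : MonoidAlgebra k Γ)} with hc
    have hJc : augIdeal k J ≤ c := le_sup_left.trans le_sup_left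
    have h1 : frobElt k h ((n + 1) ^ a - 1) ∈ c :=
      Submodule.mem_sup_left (Submodule.mem_sup_right (Ideal.mem_span_singleton_self _))
    rw [key, hw, hJ c hJc, Nat.cast_pow] at h1
    set x := Ideal.Quotient.mk c (of k Γ g⁻¹)
    set w := ((n + 1 : ℕ) : MonoidAlgebra k Γ ⧸ c)
    have hx : x ^ p ^ s = 1 := by
      rw [← map_pow, ← map_pow, ← map_one (Ideal.Quotient.mk c),
        Ideal.Quotient.mk_eq_mk_iff_sub_mem, inv_pow]
      exact hJc (of_sub_one_mem (inv_mem hg))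
    have hp0 : ((p ^ N : ℕ) : MonoidAlgebra k Γ ⧸ c) = 0 := by
      rw [← map_natCast (Ideal.Quotient.mk c), Ideal.Quotient.eq_zero_iff_mem]
      exact Submodule.mem_sup_right (Ideal.mem_span_singleton_self _)
    have hwN : w ^ p ^ N = 1 := by
      have h2 : ((p : ℕ) : ℤ) ∣ ((n + 1 : ℕ) : ℤ) - 1 := by
        push_cast
        rw [add_sub_cancel_right]
        exact_mod_cast hn
      obtain ⟨e, he⟩ := (pow_dvd_pow (p : ℤ) (Nat.le_succ N)).trans (dvd_sub_pow_of_dvd_sub h2 N)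
      rw [one_pow] at he
      have h4 := congrArg (Int.cast : ℤ → MonoidAlgebra k Γ ⧸ c) he
      rw [Int.cast_sub, Int.cast_pow, Int.cast_natCast, Int.cast_one, Int.cast_mul, Int.cast_pow,
        Int.cast_natCast, ← Nat.cast_pow p, hp0, zero_mul] at h4
      exact sub_eq_zero.mp h4
    have hq : 1 < p ^ (s + N + 1) := Nat.one_lt_pow (by omega) hp.one_lt
    obtain ⟨a', ha'⟩ := Nat.exists_mul_mod_eq_one_of_coprime
      (Nat.Coprime.pow_right (s + N + 1) ha) hq
    have hxq : x ^ p ^ (s + N + 1) = 1 := by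
      rw [add_assoc, pow_add, pow_mul, hx, one_pow]
    have hwq : w ^ p ^ (s + N + 1) = 1 := by
      rw [add_right_comm, pow_add, mul_comm, pow_mul, hwN, one_pow]
    have h5 : ∀ y : MonoidAlgebra k Γ ⧸ c, y ^ p ^ (s + N + 1) = 1 → y = (y ^ a) ^ a' := by
      intro y hy
      rw [← pow_mul, ← Nat.mod_add_div (a * a') (p ^ (s + N + 1)), ha'.2, pow_add, pow_mul, hy,
        one_pow, pow_one, mul_one]
    rw [h5 x hxq, h5 w hwq, h1]
  · rw [Ideal.span_singleton_le_iff_mem, key]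
    set c := augIdeal k J ⊔ Ideal.span {frobElt k g n} ⊔
        Ideal.span {((p ^ N : ℕ) : MonoidAlgebra k Γ)} with hc
    have hJc : augIdeal k J ≤ c := le_sup_left.trans le_sup_left
    have h1 : frobElt k g n ∈ c :=
      Submodule.mem_sup_left (Submodule.mem_sup_right (Ideal.mem_span_singleton_self _))
    rw [key] at h1
    rw [hJ c hJc, h1, hw, Nat.cast_pow]

/-- Two generators of a cyclic group `D / J` of `p`-power order differ by an exponent prime to
`p`. -/
theorem exists_pow_mul_inv_mem {p : ℕ} {J : Subgroup Γ} {g h : Γ} {s : ℕ}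
    (hp : p.Prime) (hg : g ^ p ^ s ∈ J) (hgh : g ∈ J ⊔ Subgroup.zpowers h)
    (hhg : h ∈ J ⊔ Subgroup.zpowers g) : ∃ a : ℕ, a ≠ 0 ∧ a.Coprime p ∧ h * (g ^ a)⁻¹ ∈ J := by
  have key : ∀ x y : Γ, x ∈ J ⊔ Subgroup.zpowers y → ∃ a : ℕ, x * (y ^ a)⁻¹ ∈ J := by
    intro x y hx
    obtain ⟨j, hj, t, ht, rfl⟩ := Subgroup.mem_sup.mp hx
    obtain ⟨a, rfl⟩ := mem_powers_iff_mem_zpowers.mpr ht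
    exact ⟨a, by simpa using hj⟩
  obtain ⟨a, ha⟩ := key h g hhg
  obtain ⟨b, hb⟩ := key g h hgh
  by_cases hpa : p ∣ a
  · have hgJ : g ∈ J := by
      obtain ⟨c, rfl⟩ := hpa
      have h1 : g ^ (1 - (p * c * b : ℤ)) ∈ J := by
        have : g ^ (1 - (p * c * b : ℤ)) = g * (h ^ b)⁻¹ * (h * (g ^ (p * c))⁻¹) ^ b := by
          rw [mul_pow, inv_pow, ← pow_mul, zpow_sub, zpow_one]
          have : g ^ ((p : ℤ) * c * b) = g ^ (p * c * b) := by
            rw [← zpow_natCast]; push_cast; rfl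
          rw [this]; group
        rw [this]
        exact mul_mem hb (pow_mem ha b)
      obtain ⟨u, v, huv⟩ : IsCoprime (1 - (p * c * b : ℤ)) ((p ^ s : ℕ) : ℤ) := by
        push_cast
        refine IsCoprime.pow_right ⟨1, c * b, by ring⟩
      have : g = (g ^ (1 - (p * c * b : ℤ))) ^ u * (g ^ p ^ s) ^ v := by
        rw [← zpow_natCast, ← zpow_mul, ← zpow_mul, ← zpow_add, mul_comm _ u, mul_comm _ v, huv,
          zpow_one]
      rw [this]
      exact mul_mem (zpow_mem h1 _) (zpow_mem hg _)
    have hhJ : h ∈ J := by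
      have := mul_mem ha (pow_mem hgJ a)
      rwa [inv_mul_cancel_right] at this
    exact ⟨1, one_ne_zero, Nat.coprime_one_left p, by
      rw [pow_one]; exact mul_mem hhJ (inv_mem hgJ)⟩
  · refine ⟨a, fun h0 => hpa (h0 ▸ dvd_zero p), ?_, ha⟩
    exact ((Nat.Prime.coprime_iff_not_dvd hp).mpr hpa).symm

omit [IsOrderLike k] in
theorem primClass_eq_of_le {p : ℕ} (hp : p.Prime) (I : Subgroup Γ) (g : Γ) {N : ℕ}
    (hN : bigN Γ ≤ N) : primClass k p I g =
      quotClass (idealA k I g ⊔ Ideal.span {((p ^ N : ℕ) : MonoidAlgebra k Γ)}) :=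
  congrArg quotClass (sup_span_pow_eq_of_le hp (annA_ne_zero I g) (annA_mem I g)
    (factorization_annA_le I g p) hN)

/-- The `p`-primary part of `A_{I,φ}` depends only on `D` and on the `p`-part of `I`. -/
theorem primClass_congr {p : ℕ} (hp : p.Prime) {I I' : Subgroup Γ} {g g' : Γ}
    (hI : p ∣ Nat.card I) (hI' : p ∣ Nat.card I') (hII' : I ⊓ pPart Γ p = I' ⊓ pPart Γ p)
    (hD : decomp I g = decomp I' g') : primClass k p I g = primClass k p I' g' := by
  let C := decomp I g ⊓ pCompl Γ p
  let J := I ⊔ C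
  have hJ : ∀ (I : Subgroup Γ) (g : Γ), I ⊔ decomp I g ⊓ pCompl Γ p =
      (I ⊓ pPart Γ p) ⊔ decomp I g ⊓ pCompl Γ p := by
    intro I g
    have h1 : I ⊓ pCompl Γ p ≤ decomp I g ⊓ pCompl Γ p := inf_le_inf_right _ (le_decomp I g)
    have h2 := congrArg (· ⊔ decomp I g ⊓ pCompl Γ p) (inf_sup_inf hp I)
    simp only [sup_assoc, sup_eq_right.mpr h1] at h2
    exact h2.symm
  have hJ1 : J = (I ⊓ pPart Γ p) ⊔ C := hJ I g
  have hJ' : I' ⊔ decomp I' g' ⊓ pCompl Γ p = J := by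
    rw [hJ, ← hII', ← hD, hJ1]
  have hJD : J ⊔ Subgroup.zpowers g = decomp I g := by
    refine le_antisymm (sup_le (sup_le (le_decomp I g) inf_le_left) ?_)
      (sup_le_sup_right le_sup_left _)
    exact (Subgroup.zpowers_le.mpr (mem_decomp I g))
  have hJD' : J ⊔ Subgroup.zpowers g' = decomp I g := by
    rw [hD, ← hJ']
    refine le_antisymm (sup_le (sup_le (le_decomp I' g') inf_le_left) ?_)
      (sup_le_sup_right le_sup_left _)
    exact (Subgroup.zpowers_le.mpr (mem_decomp I' g'))
  have hgs : g ^ p ^ (Nat.card Γ).factorization p ∈ J :=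
    Subgroup.mem_sup_right ⟨pow_mem (mem_decomp I g) _, pow_mem_pCompl g⟩
  obtain ⟨a, ha0, hap, ha⟩ := exists_pow_mul_inv_mem hp hgs
    (hJD' ▸ mem_decomp I g : g ∈ J ⊔ Subgroup.zpowers g')
    (by rw [hJD, hD]; exact mem_decomp I' g' : g' ∈ J ⊔ Subgroup.zpowers g)
  let n := Nat.card I
  let n' := Nat.card I'
  let n₂ := (n + 1) ^ a - 1
  have hn : n ≠ 0 := card_subgroup_ne_zero I
  have hn' : n' ≠ 0 := card_subgroup_ne_zero I'
  have hn₂ : n₂ ≠ 0 := by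
    have : 1 < (n + 1) ^ a := Nat.one_lt_pow ha0 (by omega)
    change (n + 1) ^ a - 1 ≠ 0
    omega
  let r := Nat.card C
  have hr : r ≠ 0 := card_subgroup_ne_zero C
  have hrp : p.Coprime r :=
    (Nat.Prime.coprime_iff_not_dvd hp).mpr (not_dvd_card_of_le_pCompl hp inf_le_right)
  have hcard : Nat.card J ∣ Nat.card (I ⊓ pPart Γ p : Subgroup Γ) * r := by
    rw [hJ1]
    exact card_sup_dvd_mul _ _
  have hdiff : ((Nat.card J : ℕ) : ℤ) ∣ (r : ℤ) * (n' - n₂) := by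
    have h1 : Nat.card (I ⊓ pPart Γ p : Subgroup Γ) ∣ n := Subgroup.card_dvd_of_le inf_le_left
    have h2 : Nat.card (I ⊓ pPart Γ p : Subgroup Γ) ∣ n' := by
      rw [hII']
      exact Subgroup.card_dvd_of_le inf_le_left
    have h3 : n ∣ n₂ := by
      simpa using Nat.sub_dvd_pow_sub_pow (n + 1) 1 a
    have h4 : ((Nat.card J : ℕ) : ℤ) ∣ (Nat.card (I ⊓ pPart Γ p : Subgroup Γ) : ℤ) * r := by
      exact_mod_cast hcard
    rw [mul_comm (r : ℤ)]
    refine h4.trans (mul_dvd_mul_right (dvd_sub ?_ ?_) _)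
    · exact_mod_cast h2
    · exact_mod_cast h1.trans h3
  obtain ⟨c, hc⟩ := hdiff
  have hc' : (r : MonoidAlgebra k Γ) * (n' - n₂) = (Nat.card J : MonoidAlgebra k Γ) * (c : ℤ) := by
    exact_mod_cast congrArg (Int.cast : ℤ → MonoidAlgebra k Γ) hc
  have := finite_quotient_mul_frobElt (k := k) J g' hn₂ hr
  have := finite_quotient_mul_frobElt (k := k) J g' hn' hr
  obtain ⟨N₀, hN₀⟩ := exists_forall_quotClass_eq (augIdeal k J)
    ((r : MonoidAlgebra k Γ) * frobElt k g' n₂) (normElt k J) (c : MonoidAlgebra k Γ)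
    ((r : MonoidAlgebra k Γ) * frobElt k g' n') (by
      have : (r : MonoidAlgebra k Γ) * frobElt k g' n' - (r : MonoidAlgebra k Γ) * frobElt k g' n₂ -
          c * normElt k J = -((c : MonoidAlgebra k Γ) *
            (normElt k J - (Nat.card J : MonoidAlgebra k Γ))) := by
        rw [frobElt, frobElt]
        push_cast
        linear_combination hc'
      rw [this]
      exact neg_mem (Ideal.mul_mem_left _ _ (normElt_sub_card_mem J)))
    (fun x hx => mul_normElt_eq_zero hx) (fun x hx => mul_frobElt_regular hn₂ hr hx)
    (fun x hx => mul_frobElt_regular hn' hr hx) p hp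
  have h1 := hN₀ (max N₀ (bigN Γ)) (le_max_left _ _)
  rw [sup_span_mul_eq hrp, sup_span_mul_eq hrp] at h1
  rw [primClass_eq_of_le hp I g (le_max_right N₀ _), primClass_eq_of_le hp I' g' (le_max_right N₀ _),
    idealA_sup_span_pow_eq hp I g hI, idealA_sup_span_pow_eq hp I' g' hI', hJ', ← h1]
  congr 1
  exact sup_span_frobElt_eq J hI hap hp hgs ha _

/-- The class of `ω¹(A_{I,φ})` is the sum of the classes of its primary parts, of which only those at
the primes dividing `#I` contribute. -/
theorem genClass_eq_sum (I : Subgroup Γ) (g : Γ) :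
    genClass k I g = ∑ p ∈ (Nat.card I).primeFactors, shiftHom _ (primClass k p I g) := by
  rw [genClass, quotClass_eq_sum (bigN Γ) (annA I g) _ (annA_ne_zero I g) (annA_mem I g)
    (factorization_annA_le I g), map_sum]
  refine (Finset.sum_subset (Nat.primeFactors_mono (dvd_geometric _) (annA_ne_zero I g)) ?_).symm
  intro p hp hp'
  change shiftHom _ (primClass k p I g) = 0
  have hpp := Nat.prime_of_mem_primeFactors hp
  rw [primClass_eq_zero hpp, map_zero]
  exact fun h => hp' (Nat.mem_primeFactors.mpr ⟨hpp, h, card_subgroup_ne_zero I⟩)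

theorem genClass_eq_of_card_eq {p j : ℕ} (hp : p.Prime) (hj : j ≠ 0) {I : Subgroup Γ} (g : Γ)
    (h : Nat.card I = p ^ j) : genClass k I g = shiftHom _ (primClass k p I g) := by
  rw [genClass_eq_sum, h, Nat.primeFactors_prime_pow hj hp, Finset.sum_singleton]

end PrimaryClasses

/-! ### Intersections of subgroups -/

section Intersections

variable {Γ : Type u} [CommGroup Γ] [Finite Γ]

omit [Finite Γ] in
theorem index_sup_mul_card (V D : Subgroup Γ) :
    (V ⊔ D).index * Nat.card Γ = D.index * V.index * Nat.card (V ⊓ D : Subgroup Γ) := by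
  have h1 := Subgroup.relIndex_mul_index (le_sup_right : D ≤ V ⊔ D)
  have h2 := Subgroup.relIndex_mul_index (inf_le_left : V ⊓ D ≤ V)
  rw [Subgroup.relIndex_sup_right] at h1
  rw [Subgroup.inf_relIndex_left] at h2
  rw [← (V ⊓ D).index_mul_card, ← h1, ← h2]
  ring

/-- A combination of the functions `V ↦ #(V ∩ D)` vanishes only if the same combination of the
indicator functions of the subgroups `D` does: the quadratic form `∑ y_D y_E #(D ∩ E)` is a sum of
squares. -/
theorem sum_ite_mem_eq_zero {ι : Type*} (S : Finset ι) (D : ι → Subgroup Γ) (y : ι → ℤ)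
    (h : ∀ V : Subgroup Γ, ∑ i ∈ S, y i * Nat.card (V ⊓ D i : Subgroup Γ) = 0) (γ : Γ) :
    (open Classical in ∑ i ∈ S, if γ ∈ D i then y i else 0) = 0 := by
  classical
  cases nonempty_fintype Γ
  have hcard : ∀ V : Subgroup Γ, (Nat.card V : ℤ) = ∑ γ : Γ, if γ ∈ V then 1 else 0 := by
    intro V
    rw [Finset.sum_boole, Nat.card_eq_fintype_card, Fintype.card_subtype]
  have key : ∑ γ : Γ, (∑ i ∈ S, if γ ∈ D i then y i else 0) ^ 2 = 0 := by
    have h1 : ∑ i ∈ S, y i * ∑ j ∈ S, y j * (Nat.card (D i ⊓ D j : Subgroup Γ) : ℤ) = 0 :=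
      Finset.sum_eq_zero fun i _ => by rw [h, mul_zero]
    refine Eq.trans ?_ h1
    simp_rw [hcard, sq, Finset.mul_sum, Finset.sum_mul]
    rw [Finset.sum_comm]
    refine Finset.sum_congr rfl fun i _ => ?_
    rw [Finset.sum_comm]
    refine Finset.sum_congr rfl fun j _ => Finset.sum_congr rfl fun γ _ => ?_
    by_cases hi : γ ∈ D i <;> by_cases hj : γ ∈ D j <;> simp [hi, hj, Subgroup.mem_inf, mul_comm]
  have := (Finset.sum_eq_zero_iff_of_nonneg (fun γ _ => sq_nonneg _)).mp key γ (Finset.mem_univ _)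
  exact pow_eq_zero_iff two_ne_zero |>.mp this

end Intersections

/-! ### The parameter set -/

section Parameters

variable {Γ : Type u} [CommGroup Γ]

theorem isPGroup_pPart (p : ℕ) : IsPGroup p (pPart Γ p) := fun x =>
  ⟨(Nat.card Γ).factorization p, Subtype.ext (mem_pPart.mp x.2)⟩

variable [Finite Γ]

theorem mem_pPart_of_pow_eq_one {p i : ℕ} (hp : p.Prime) {x : Γ} (h : x ^ p ^ i = 1) :
    x ∈ pPart Γ p := by
  obtain ⟨a, ha, b, hb, rfl⟩ := exists_eq_mul_of_prime hp x
  have h1 : b ^ p ^ i = 1 := by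
    obtain ⟨n, hn⟩ := Subgroup.mem_zpowers_iff.mp hb.1
    rw [← hn, ← zpow_natCast, zpow_comm, zpow_natCast, h, one_zpow]
  have h2 : b ∈ (⊥ : Subgroup Γ) :=
    mem_of_pow_mem_of_coprime (coprime_ordCompl (Γ := Γ) hp i) (Subgroup.mem_bot.mpr h1)
      (Subgroup.mem_bot.mpr (mem_pCompl.mp hb.2))
  rw [Subgroup.mem_bot.mp h2, mul_one]
  exact ha.2

theorem sInf_isPGroup_eq {p : ℕ} (hp : p.Prime) :
    sInf {N : Subgroup Γ | IsPGroup p (Γ ⧸ N)} = pCompl Γ p := by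
  refine le_antisymm (sInf_le ?_) (le_sInf ?_)
  · intro x
    obtain ⟨x, rfl⟩ := QuotientGroup.mk_surjective x
    exact ⟨_, (QuotientGroup.eq_one_iff _).mpr (pow_mem_pCompl x)⟩
  · intro N hN x hx
    obtain ⟨i, hi⟩ := hN (x : Γ ⧸ N)
    refine mem_of_pow_mem_of_coprime (coprime_ordCompl (Γ := Γ) hp i)
      ((QuotientGroup.eq_one_iff _).mp hi) ?_
    rw [mem_pCompl.mp hx]
    exact one_mem _

variable (Γ) in
/-- The projection `Γ → Γ_p`. -/
abbrev toMaxPQuotient (p : ℕ) : Γ →* MaxPQuotient p Γ := QuotientGroup.mk' _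

theorem ker_toMaxPQuotient {p : ℕ} (hp : p.Prime) : (toMaxPQuotient Γ p).ker = pCompl Γ p := by
  rw [QuotientGroup.ker_mk', sInf_isPGroup_eq hp]

theorem exists_mem_pPart {p : ℕ} (hp : p.Prime) (y : MaxPQuotient p Γ) :
    ∃ x ∈ pPart Γ p, toMaxPQuotient Γ p x = y := by
  obtain ⟨x, rfl⟩ := QuotientGroup.mk'_surjective _ y
  obtain ⟨a, ha, b, hb, rfl⟩ := exists_eq_mul_of_prime hp x
  refine ⟨a, ha.2, ?_⟩
  have : b ∈ (toMaxPQuotient Γ p).ker := by rw [ker_toMaxPQuotient hp]; exact hb.2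
  rw [map_mul, (MonoidHom.mem_ker).mp this, mul_one]

/-- A subgroup `U` of `W` is recovered from its image in the maximal `p`-quotient of `Γ` if `U` and `W`
have the same elements of order prime to `p`. -/
theorem comap_map_inf {p : ℕ} (hp : p.Prime) (U W : Subgroup Γ) (hU : U ≤ W)
    (hW : ∀ x ∈ W, x ^ p ^ (Nat.card Γ).factorization p ∈ U) :
    (U.map (toMaxPQuotient Γ p)).comap (toMaxPQuotient Γ p) ⊓ W = U := by
  rw [Subgroup.comap_map_eq, ker_toMaxPQuotient hp]
  refine le_antisymm ?_ (le_inf le_sup_left hU)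
  rintro x ⟨hx, hxW⟩
  refine mem_of_pow_mem_of_coprime (coprime_ordCompl (Γ := Γ) hp _) (hW x hxW) ?_
  obtain ⟨a, ha, b, hb, rfl⟩ := Subgroup.mem_sup.mp hx
  rw [mul_pow, mem_pCompl.mp hb, mul_one]
  exact pow_mem ha _

namespace TSet

/-- The `p`-subgroup of `Γ` that maps isomorphically to `I` in `Γ_p`. -/
noncomputable def inertia (t : TSet Γ) : Subgroup Γ :=
  t.I.comap (toMaxPQuotient Γ t.p) ⊓ pPart Γ t.p

/-- The subgroup of `Γ` with image `D` in `Γ_p` and the same elements of order prime to `p` as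
`H`. -/
noncomputable def decompGroup (t : TSet Γ) : Subgroup Γ :=
  t.D.comap (toMaxPQuotient Γ t.p) ⊓ t.H

omit [Finite Γ] in
theorem pPart_le (t : TSet Γ) : pPart Γ t.p ≤ t.H := by
  intro x hx
  have h1 : (x : Γ ⧸ t.H) ^ t.p ^ (Nat.card Γ).factorization t.p = 1 := by
    rw [← QuotientGroup.mk_pow, mem_pPart.mp hx, QuotientGroup.mk_one]
  have h2 : (x : Γ ⧸ t.H) ^ Nat.card (Γ ⧸ t.H) = 1 := pow_card_eq_one'
  have h3 : (x : Γ ⧸ t.H) ∈ (⊥ : Subgroup (Γ ⧸ t.H)) :=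
    mem_of_pow_mem_of_coprime (Nat.Coprime.pow_right _ t.coprime) (Subgroup.mem_bot.mpr h2)
      (Subgroup.mem_bot.mpr h1)
  exact (QuotientGroup.eq_one_iff _).mp (Subgroup.mem_bot.mp h3)

theorem map_inertia (t : TSet Γ) : t.inertia.map (toMaxPQuotient Γ t.p) = t.I := by
  refine le_antisymm ?_ fun y hy => ?_
  · rintro _ ⟨x, hx, rfl⟩
    exact hx.1
  · obtain ⟨x, hx, rfl⟩ := exists_mem_pPart t.prime y
    exact ⟨x, ⟨hy, hx⟩, rfl⟩

theorem map_decompGroup (t : TSet Γ) : t.decompGroup.map (toMaxPQuotient Γ t.p) = t.D := by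
  refine le_antisymm ?_ fun y hy => ?_
  · rintro _ ⟨x, hx, rfl⟩
    exact hx.1
  · obtain ⟨x, hx, rfl⟩ := exists_mem_pPart t.prime y
    exact ⟨x, ⟨hy, t.pPart_le hx⟩, rfl⟩

theorem decompGroup_sup_pPart (t : TSet Γ) : t.decompGroup ⊔ pPart Γ t.p = t.H := by
  refine le_antisymm (sup_le inf_le_right t.pPart_le) ?_
  conv_lhs => rw [← inf_sup_inf t.prime t.H]
  refine sup_le (inf_le_right.trans le_sup_right) (le_trans ?_ le_sup_left)
  refine le_inf ?_ inf_le_left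
  rw [← ker_toMaxPQuotient t.prime]
  exact inf_le_right.trans (Subgroup.ker_le_comap _ _)

theorem ext_of_eq {t t' : TSet Γ} (hp : t.p = t'.p) (hI : t.inertia = t'.inertia)
    (hD : t.decompGroup = t'.decompGroup) : t = t' := by
  have hH : t.H = t'.H := by
    rw [← t.decompGroup_sup_pPart, ← t'.decompGroup_sup_pPart, hD, hp]
  obtain ⟨p, a, H, b, c, I, D, d, e, f⟩ := t
  obtain ⟨p', a', H', b', c', I', D', d', e', f'⟩ := t'
  dsimp only at hp hH
  subst hp hH
  have h1 : I = I' := (map_inertia ⟨p, a, H, b, c, I, D, d, e, f⟩).symm.trans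
    ((congrArg (Subgroup.map (toMaxPQuotient Γ p)) hI).trans
      (map_inertia ⟨p, a, H, b, c, I', D', d', e', f'⟩))
  have h2 : D = D' := (map_decompGroup ⟨p, a, H, b, c, I, D, d, e, f⟩).symm.trans
    ((congrArg (Subgroup.map (toMaxPQuotient Γ p)) hD).trans
      (map_decompGroup ⟨p, a, H, b, c, I', D', d', e', f'⟩))
  subst h1 h2
  rfl

omit [Finite Γ] in
theorem inertia_le_pPart (t : TSet Γ) : t.inertia ≤ pPart Γ t.p := inf_le_right

omit [Finite Γ] in
theorem inertia_le_decompGroup (t : TSet Γ) : t.inertia ≤ t.decompGroup :=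
  inf_le_inf (Subgroup.comap_mono t.le) t.pPart_le

theorem inertia_ne_bot (t : TSet Γ) : t.inertia ≠ ⊥ := by
  intro h
  apply t.ne_bot
  rw [← map_inertia, h, Subgroup.map_bot]

omit [Finite Γ] in
theorem isPGroup_inertia (t : TSet Γ) : IsPGroup t.p t.inertia :=
  (isPGroup_pPart t.p).to_le t.inertia_le_pPart

theorem exists_card_inertia (t : TSet Γ) : ∃ j, Nat.card t.inertia = t.p ^ (j + 1) := by
  have := Fact.mk t.prime
  obtain ⟨n, hn⟩ := IsPGroup.iff_card.mp t.isPGroup_inertia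
  cases n with
  | zero => exact absurd (Subgroup.eq_bot_of_card_eq _ (by rw [hn, pow_zero])) t.inertia_ne_bot
  | succ j => exact ⟨j, hn⟩

theorem dvd_card (t : TSet Γ) : t.p ∣ Nat.card Γ := by
  obtain ⟨j, hj⟩ := t.exists_card_inertia
  exact (Dvd.intro_left _ (pow_succ t.p j).symm).trans (hj ▸ Subgroup.card_subgroup_dvd_card _)

theorem p_eq_of_le {t : TSet Γ} {p j : ℕ} (hp : p.Prime) {U : Subgroup Γ}
    (hU : Nat.card U = p ^ (j + 1)) (h : U ≤ t.inertia) : t.p = p := by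
  obtain ⟨i, hi⟩ := t.exists_card_inertia
  have h1 := Subgroup.card_dvd_of_le h
  rw [hU, hi] at h1
  have h2 : p ∣ t.p ^ (i + 1) := (Dvd.intro_left _ (pow_succ p j).symm).trans h1
  exact ((Nat.prime_dvd_prime_iff_eq hp t.prime).mp (hp.dvd_of_dvd_pow h2)).symm

instance finite : Finite (TSet Γ) := by
  have hle : ∀ t : TSet Γ, t.p < Nat.card Γ + 1 := fun t =>
    Nat.lt_succ_of_le (Nat.le_of_dvd Nat.card_pos t.dvd_card)
  refine Finite.of_injective (β := Fin (Nat.card Γ + 1) × Subgroup Γ × Subgroup Γ)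
    (fun t => (⟨t.p, hle t⟩, t.inertia, t.decompGroup)) fun t t' h => ?_
  simp only [Prod.mk.injEq, Fin.mk.injEq] at h
  exact ext_of_eq h.1 h.2.1 h.2.2

end TSet

/-- The tuple in `𝒯` attached to a prime divisor of `#I`. -/
theorem exists_tset {p : ℕ} (hp : p.Prime) (I : Subgroup Γ) (g : Γ) (hI : p ∣ Nat.card I)
    (hc : IsCyclic (Γ ⧸ (decomp I g ⊔ pPart Γ p))) :
    ∃ t : TSet Γ, t.p = p ∧ t.inertia = I ⊓ pPart Γ p ∧ t.decompGroup = decomp I g := by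
  have := Fact.mk hp
  refine ⟨⟨p, hp, decomp I g ⊔ pPart Γ p, hc, ?_, I.map (toMaxPQuotient Γ p),
    (decomp I g).map (toMaxPQuotient Γ p), Subgroup.map_mono (le_decomp I g), ?_, ?_⟩, rfl, ?_, ?_⟩
  · refine ((Nat.Prime.coprime_iff_not_dvd hp).mpr fun hd => ?_).symm
    obtain ⟨x, hx⟩ := exists_prime_orderOf_dvd_card' p hd
    obtain ⟨x, rfl⟩ := QuotientGroup.mk_surjective x
    have h1 : x ∈ decomp I g ⊔ pPart Γ p := by
      refine mem_of_pow_mem_of_coprime (coprime_ordCompl (Γ := Γ) hp 1) ?_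
        (Subgroup.mem_sup_right ?_)
      · have h0 := pow_orderOf_eq_one (x : Γ ⧸ (decomp I g ⊔ pPart Γ p))
        rw [hx] at h0
        rw [pow_one]
        exact (QuotientGroup.eq_one_iff _).mp h0
      · rw [mem_pPart, ← pow_mul, mul_comm, Nat.ordProj_mul_ordCompl_eq_self, pow_card_eq_one']
    rw [(QuotientGroup.eq_one_iff _).mpr h1, orderOf_one] at hx
    exact hp.one_lt.ne hx
  · intro hbot
    obtain ⟨x, hx⟩ := exists_prime_orderOf_dvd_card' p hI
    have h1 : (x : Γ) ∈ (toMaxPQuotient Γ p).ker := by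
      have := Subgroup.mem_map_of_mem (toMaxPQuotient Γ p) x.2
      rw [hbot] at this
      exact Subgroup.mem_bot.mp this
    have h2 : (x : Γ) ^ p ^ 1 = 1 := by
      rw [pow_one, ← hx, ← Subgroup.coe_pow, pow_orderOf_eq_one, Subgroup.coe_one]
    rw [ker_toMaxPQuotient hp] at h1
    have h3 : (x : Γ) ∈ pPart Γ p ⊓ pCompl Γ p := ⟨mem_pPart_of_pow_eq_one hp h2, h1⟩
    rw [pPart_inf_pCompl hp] at h3
    have h4 : x = 1 := Subtype.ext (Subgroup.mem_bot.mp h3)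
    rw [h4, orderOf_one] at hx
    exact hp.one_lt.ne hx
  · rw [isCyclic_iff_exists_zpowers_eq_top]
    refine ⟨((⟨toMaxPQuotient Γ p g, Subgroup.mem_map_of_mem _ (mem_decomp I g)⟩ :
      (decomp I g).map (toMaxPQuotient Γ p)) : _ ⧸ _), ?_⟩
    rw [eq_top_iff]
    intro y _
    obtain ⟨⟨_, x, hx, rfl⟩, rfl⟩ := QuotientGroup.mk_surjective y
    obtain ⟨i, hi, z, hz, rfl⟩ := Subgroup.mem_sup.mp hx
    obtain ⟨a, rfl⟩ := Subgroup.mem_zpowers_iff.mp hz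
    refine Subgroup.mem_zpowers_iff.mpr ⟨a, ?_⟩
    rw [← QuotientGroup.mk_zpow, QuotientGroup.eq, Subgroup.mem_subgroupOf]
    refine ⟨i, hi, ?_⟩
    simp
  · change (I.map (toMaxPQuotient Γ p)).comap (toMaxPQuotient Γ p) ⊓ pPart Γ p = _
    rw [← comap_map_inf hp (I ⊓ pPart Γ p) (pPart Γ p) inf_le_right
      (fun x hx => by rw [mem_pPart.mp hx]; exact one_mem _)]
    congr 2
    refine le_antisymm ?_ (Subgroup.map_mono inf_le_left)
    rintro _ ⟨x, hx, rfl⟩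
    obtain ⟨a, ha, b, hb, rfl⟩ := exists_eq_mul_of_prime hp x
    refine ⟨a, ⟨Subgroup.zpowers_le.mpr hx ha.1, ha.2⟩, ?_⟩
    have : b ∈ (toMaxPQuotient Γ p).ker := by rw [ker_toMaxPQuotient hp]; exact hb.2
    rw [map_mul, (MonoidHom.mem_ker).mp this, mul_one]
  · change ((decomp I g).map (toMaxPQuotient Γ p)).comap (toMaxPQuotient Γ p) ⊓
      (decomp I g ⊔ pPart Γ p) = _
    refine comap_map_inf hp _ _ le_sup_left fun x hx => ?_
    obtain ⟨d, hd, a, ha, rfl⟩ := Subgroup.mem_sup.mp hx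
    rw [mul_pow, mem_pPart.mp ha, mul_one]
    exact pow_mem hd _

theorem pPart_eq_top_of_isPGroup {ℓ p : ℕ} (hℓ : ℓ.Prime) (hp : p.Prime) (h : IsPGroup ℓ Γ)
    (hd : p ∣ Nat.card Γ) : pPart Γ p = ⊤ := by
  have := Fact.mk hℓ
  obtain ⟨n, hn⟩ := IsPGroup.iff_card.mp h
  rw [hn] at hd
  obtain rfl := (Nat.prime_dvd_prime_iff_eq hp hℓ).mp (hp.dvd_of_dvd_pow hd)
  rw [eq_top_iff]
  intro x _
  obtain ⟨i, hi⟩ := h x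
  exact mem_pPart_of_pow_eq_one hp hi

/-- If `Γ` is cyclic or of prime power order, then `𝒯` parametrizes the pairs of a `p`-subgroup
`I` and a subgroup `D` that contains it with cyclic quotient. -/
theorem TSet.exists_decomp_eq (h : IsCyclic Γ ∨ ∃ p : ℕ, p.Prime ∧ IsPGroup p Γ) (t : TSet Γ) :
    ∃ g, decomp t.inertia g = t.decompGroup := by
  rcases h with h | ⟨ℓ, hℓ, h⟩
  · obtain ⟨⟨g, hg⟩, hg'⟩ := IsCyclic.exists_generator (α := t.decompGroup)
    refine ⟨g, le_antisymm (decomp_le.mpr ⟨t.inertia_le_decompGroup, hg⟩) fun x hx => ?_⟩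
    obtain ⟨a, ha⟩ := Subgroup.mem_zpowers_iff.mp (hg' ⟨x, hx⟩)
    have : g ^ a = x := congrArg Subtype.val ha
    rw [← this]
    exact zpow_mem (mem_decomp _ _) _
  · have htop := pPart_eq_top_of_isPGroup hℓ t.prime h t.dvd_card
    have hH : t.H = ⊤ := eq_top_iff.mpr (htop ▸ t.pPart_le)
    have := t.cyclic
    obtain ⟨y, hy⟩ := IsCyclic.exists_generator (α := t.D ⧸ t.I.subgroupOf t.D)
    obtain ⟨⟨y, hyD⟩, rfl⟩ := QuotientGroup.mk_surjective y
    obtain ⟨g, rfl⟩ := QuotientGroup.mk'_surjective _ y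
    refine ⟨g, le_antisymm (decomp_le.mpr ⟨t.inertia_le_decompGroup, hyD, ?_⟩) ?_⟩
    · rw [hH]; trivial
    rintro x ⟨hx, -⟩
    obtain ⟨a, ha⟩ := Subgroup.mem_zpowers_iff.mp (hy (⟨_, hx⟩ : t.D))
    rw [← QuotientGroup.mk_zpow, QuotientGroup.eq, Subgroup.mem_subgroupOf] at ha
    have h1 : (g ^ a)⁻¹ * x ∈ t.inertia := by
      refine ⟨?_, by rw [htop]; trivial⟩
      change toMaxPQuotient Γ t.p ((g ^ a)⁻¹ * x) ∈ t.I
      rw [map_mul, map_inv, map_zpow]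
      exact ha
    have h2 : x = g ^ a * ((g ^ a)⁻¹ * x) := by group
    rw [h2]
    exact mul_mem (zpow_mem (mem_decomp _ _) _) (le_decomp _ _ h1)

theorem isCyclic_quotient_of (h : IsCyclic Γ ∨ ∃ p : ℕ, p.Prime ∧ IsPGroup p Γ) {p : ℕ}
    (hp : p.Prime) (hd : p ∣ Nat.card Γ) (D : Subgroup Γ) :
    IsCyclic (Γ ⧸ (D ⊔ pPart Γ p)) := by
  rcases h with h | ⟨ℓ, hℓ, h⟩
  · exact isCyclic_of_surjective _ (QuotientGroup.mk'_surjective _)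
  · have : Subsingleton (Γ ⧸ (D ⊔ pPart Γ p)) := by
      rw [pPart_eq_top_of_isPGroup hℓ hp h hd, sup_top_eq]
      exact QuotientGroup.subsingleton_quotient_top
    exact isCyclic_of_subsingleton

end Parameters

/-! ### The basis for cyclic groups and groups of prime power order -/

section Basis

variable {Γ : Type u} [CommGroup Γ] [Finite Γ]

/-- The matrix of the values of the invariants at the elements of `𝒯` has trivial kernel. -/
theorem eq_zero_of_sum_index [Fintype (TSet Γ)] (g : TSet Γ → Γ)
    (hg : ∀ t, decomp t.inertia (g t) = t.decompGroup) (x : TSet Γ → ℤ)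
    (h : ∀ (p j : ℕ) (U V : Subgroup Γ), p.Prime → Nat.card U = p ^ (j + 1) →
      (open Classical in
        ∑ t, if U ≤ t.inertia then x t * (V ⊔ t.decompGroup).index else 0) = 0)
    (t : TSet Γ) : x t = 0 := by
  classical
  induction hn : Nat.card Γ - Nat.card t.inertia using Nat.strong_induction_on generalizing t with
  | _ n ih =>
    let S : Finset (TSet Γ) := Finset.univ.filter (fun t' => t'.inertia = t.inertia)
    have hS : ∀ t', t' ∈ S ↔ t'.inertia = t.inertia := fun t' => by simp [S]
    have h1 : ∀ V : Subgroup Γ, ∑ t' ∈ S, x t' * (V ⊔ t'.decompGroup).index = 0 := by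
      intro V
      obtain ⟨j, hj⟩ := t.exists_card_inertia
      rw [← h t.p j t.inertia V t.prime hj, Finset.sum_filter]
      refine Finset.sum_congr rfl fun t' _ => ?_
      by_cases hle : t.inertia ≤ t'.inertia
      · by_cases heq : t'.inertia = t.inertia
        · rw [if_pos heq, if_pos hle]
        · have hlt : Nat.card t.inertia < Nat.card t'.inertia := by
            refine lt_of_le_of_ne (Subgroup.card_le_of_le hle) fun hc => heq ?_
            exact (Subgroup.eq_of_le_of_card_ge hle hc.ge).symm
          have hle' := Subgroup.card_le_card_group t'.inertia
          rw [ih _ (by omega) t' rfl, zero_mul, ite_self, ite_self]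
      · rw [if_neg hle, if_neg fun heq => hle heq.ge]
    have h2 := sum_ite_mem_eq_zero S TSet.decompGroup (fun t' => x t' * t'.decompGroup.index)
      (fun V => by
        have h3 : (V.index : ℤ) * ∑ t' ∈ S, x t' * t'.decompGroup.index *
            (Nat.card (V ⊓ t'.decompGroup : Subgroup Γ) : ℤ) = 0 := by
          have h4 := congrArg (· * (Nat.card Γ : ℤ)) (h1 V)
          simp only [zero_mul] at h4
          rw [← h4, Finset.mul_sum, Finset.sum_mul]
          refine Finset.sum_congr rfl fun t' _ => ?_
          have h5 := congrArg (Nat.cast : ℕ → ℤ) (index_sup_mul_card V t'.decompGroup)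
          push_cast at h5
          linear_combination (-x t') * h5
        exact (mul_eq_zero.mp h3).resolve_left (by exact_mod_cast Subgroup.index_ne_zero_of_finite))
    -- the coefficients vanish, by descending induction on `D`
    have h3 : ∀ m : ℕ, ∀ t' ∈ S, Nat.card Γ - Nat.card t'.decompGroup = m → x t' = 0 := by
      intro m
      induction m using Nat.strong_induction_on with
      | _ m ih' =>
        intro t' ht' hm
        have h4 := h2 (g t')
        rw [Finset.sum_eq_single_of_mem t' ht'] at h4
        · rw [if_pos (by rw [← hg]; exact mem_decomp _ _)] at h4
          exact (mul_eq_zero.mp h4).resolve_right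
            (by exact_mod_cast Subgroup.index_ne_zero_of_finite)
        · intro t'' ht'' hne
          by_cases hmem : g t' ∈ t''.decompGroup
          · have hI : t''.inertia = t'.inertia := ((hS _).mp ht'').trans ((hS _).mp ht').symm
            have hle : t'.decompGroup ≤ t''.decompGroup := by
              rw [← hg t', decomp_le]
              exact ⟨hI ▸ t''.inertia_le_decompGroup, hmem⟩
            have hlt : Nat.card t'.decompGroup < Nat.card t''.decompGroup := by
              refine lt_of_le_of_ne (Subgroup.card_le_of_le hle) fun hc => hne ?_
              obtain ⟨j, hj⟩ := t''.exists_card_inertia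
              exact TSet.ext_of_eq (TSet.p_eq_of_le t''.prime hj hI.le).symm hI
                (Subgroup.eq_of_le_of_card_ge hle hc.ge).symm
            have hle' := Subgroup.card_le_card_group t''.decompGroup
            rw [if_pos hmem, ih' _ (by omega) t'' ht'' rfl, zero_mul]
          · rw [if_neg hmem]
    exact h3 _ t ((hS t).mpr rfl) rfl

variable {k : Type} [CommRing k] [IsOrderLike k]

/-- The class attached to an element of `𝒯` is the primary part of the class `[ω¹(A_{I,φ})]` of
any `I` and `φ` that give rise to that element. -/
theorem genClass_inertia_eq {p : ℕ} (hp : p.Prime) {I : Subgroup Γ} {g g' : Γ}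
    (hI : p ∣ Nat.card I) {t : TSet Γ} (h1 : t.p = p) (h2 : t.inertia = I ⊓ pPart Γ p)
    (h3 : t.decompGroup = decomp I g) (hg' : decomp t.inertia g' = t.decompGroup) :
    genClass k t.inertia g' = shiftHom _ (primClass k p I g) := by
  obtain ⟨j, hj⟩ := t.exists_card_inertia
  rw [h1] at hj
  rw [genClass_eq_of_card_eq hp (Nat.succ_ne_zero j) g' hj]
  congr 1
  refine primClass_congr hp ?_ hI ?_ (hg'.trans h3)
  · rw [hj]
    exact Dvd.intro_left _ (pow_succ p j).symm
  · rw [h2, inf_assoc, inf_idem]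

theorem isElementary_of_isPGroup {p : ℕ} (hp : p.Prime) {G : Type u} [Group G]
    (h : IsPGroup p G) : IsElementary G :=
  ⟨p, hp, G, PUnit, inferInstance, inferInstance, h, inferInstance, ⟨MulEquiv.prodUnique.symm⟩⟩

theorem isElementary_of_isCyclic {G : Type u} [Group G] (h : IsCyclic G) : IsElementary G :=
  ⟨2, Nat.prime_two, PUnit, G, inferInstance, inferInstance, fun _ => ⟨0, Subsingleton.elim _ _⟩, h,
    ⟨MulEquiv.uniqueProd.symm⟩⟩

/-- The classes attached to the elements of `𝒯` form a basis. -/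
theorem nonempty_basis
    (hr : ∀ p, p.Prime → p ∣ Nat.card Γ → padicValNat p (Nat.card (k ⧸ Ideal.span {(p : k)})) ≠ 0)
    (h : IsCyclic Γ ∨ ∃ p : ℕ, p.Prime ∧ IsPGroup p Γ) :
    Nonempty (Module.Basis (TSet Γ) ℕ (Zadm k Γ)) := by
  classical
  cases nonempty_fintype (TSet Γ)
  choose g hg using TSet.exists_decomp_eq (Γ := Γ) h
  let e : TSet Γ → SimClass (MonoidAlgebra k Γ) := fun t => genClass k t.inertia (g t)
  have he : ∀ t, e t ∈ Zadm k Γ := fun t => by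
    rw [Zadm_eq_closure]
    exact AddSubmonoid.subset_closure ⟨t.inertia, g t, t.inertia_ne_bot,
      isElementary_of_isPGroup t.prime t.isPGroup_inertia, rfl⟩
  have hval : ∀ (p j : ℕ) [Fact p.Prime] (U V : Subgroup Γ), Nat.card U = p ^ (j + 1) → ∀ t,
      tateInv k p (p ^ j) U V (e t) = padicValNat p (Nat.card (k ⧸ Ideal.span {(p : k)})) *
        if U ≤ t.inertia then (V ⊔ t.decompGroup).index else 0 := by
    intro p j _ U V hU t
    by_cases hle : U ≤ t.inertia
    · rw [if_pos hle, ← hg t]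
      exact tateInv_genClass_of_le p j V (g t) hU hle
    · rw [if_neg hle, mul_zero]
      exact tateInv_genClass_of_not_le p j V (g t) hU hle
  have hli : LinearIndependent ℕ e := by
    rw [Fintype.linearIndependent_iffₛ]
    intro a b hab
    have hx := eq_zero_of_sum_index g hg (fun t => (a t : ℤ) - b t) (fun p j U V hp hU => by
      have := Fact.mk hp
      have hpc : p ∣ Nat.card Γ := (Dvd.intro_left _ (pow_succ p j).symm).trans
        (hU ▸ Subgroup.card_subgroup_dvd_card U)
      have h1 := congrArg (tateInv k p (p ^ j) U V) hab
      simp only [map_sum, map_nsmul, hval p j U V hU, smul_eq_mul] at h1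
      have h2 : ∀ c : TSet Γ → ℕ, ∑ t, c t * (padicValNat p (Nat.card (k ⧸ Ideal.span {(p : k)})) *
          if U ≤ t.inertia then (V ⊔ t.decompGroup).index else 0) =
          padicValNat p (Nat.card (k ⧸ Ideal.span {(p : k)})) *
            ∑ t, c t * if U ≤ t.inertia then (V ⊔ t.decompGroup).index else 0 := by
        intro c
        rw [Finset.mul_sum]
        exact Finset.sum_congr rfl fun t _ => by ring
      rw [h2, h2] at h1
      have h3 := congrArg (Nat.cast : ℕ → ℤ) (Nat.eq_of_mul_eq_mul_left
        (Nat.pos_of_ne_zero (hr p hp hpc)) h1)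
      push_cast at h3
      rw [← sub_eq_zero, ← Finset.sum_sub_distrib] at h3
      refine Eq.trans (Finset.sum_congr rfl fun t _ => ?_) h3
      split_ifs
      · ring
      · ring)
    intro t
    have := hx t
    omega
  let v : TSet Γ → Zadm k Γ := fun t => ⟨e t, he t⟩
  have hv : LinearIndependent ℕ v :=
    LinearIndependent.of_comp ((Zadm k Γ).subtype.toNatLinearMap) hli
  refine ⟨Module.Basis.mk hv ?_⟩
  have hspan : ∀ c ∈ Zadm k Γ, c ∈ AddSubmonoid.closure (Set.range e) := by
    intro c hc
    rw [Zadm_eq_closure] at hc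
    refine (AddSubmonoid.closure_le.mpr ?_) hc
    rintro _ ⟨I, γ, -, -, rfl⟩
    rw [genClass_eq_sum]
    refine AddSubmonoid.sum_mem _ fun p hp => ?_
    have hp1 := Nat.prime_of_mem_primeFactors hp
    have hp2 := Nat.dvd_of_mem_primeFactors hp
    obtain ⟨t, ht1, ht2, ht3⟩ := exists_tset hp1 I γ hp2
      (isCyclic_quotient_of h hp1 (hp2.trans (Subgroup.card_subgroup_dvd_card I)) _)
    rw [← genClass_inertia_eq hp1 hp2 ht1 ht2 ht3 (hg t)]
    exact AddSubmonoid.subset_closure ⟨t, rfl⟩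
  rintro ⟨c, hc⟩ -
  have h1 := hspan c hc
  have h2 : AddSubmonoid.closure (Set.range e) =
      (AddSubmonoid.closure (Set.range v)).map (Zadm k Γ).subtype := by
    rw [AddMonoidHom.map_mclosure, ← Set.range_comp]
    rfl
  rw [h2] at h1
  obtain ⟨d, hd, hdc⟩ := h1
  have h3 : d = ⟨c, hc⟩ := Subtype.ext hdc
  rw [← h3]
  exact (AddSubmonoid.closure_le (S := (Submodule.span ℕ (Set.range v)).toAddSubmonoid)).mpr
    Submodule.subset_span hd

end Basis

/-! ### The remaining groups -/

section NotFree

variable {Γ : Type u} [CommGroup Γ]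

theorem zpowers_mul_eq_sup {x y : Γ} {m n : ℕ} (hmn : m.Coprime n) (hx : x ^ m = 1)
    (hy : y ^ n = 1) : Subgroup.zpowers (x * y) = Subgroup.zpowers x ⊔ Subgroup.zpowers y := by
  have h : x * y ∈ Subgroup.zpowers (x * y) := Subgroup.mem_zpowers _
  refine le_antisymm ?_ (sup_le ?_ ?_)
  · rw [Subgroup.zpowers_le]
    exact Subgroup.mul_mem_sup (Subgroup.mem_zpowers x) (Subgroup.mem_zpowers y)
  · rw [Subgroup.zpowers_le]
    have h1 : x ^ n ∈ Subgroup.zpowers (x * y) := by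
      have := pow_mem h n
      rwa [mul_pow, hy, mul_one] at this
    obtain ⟨u, v, huv⟩ := Nat.Coprime.isCoprime hmn
    have h2 : x = (x ^ m) ^ u * (x ^ n) ^ v := by
      rw [← zpow_natCast, ← zpow_natCast, ← zpow_mul, ← zpow_mul, ← zpow_add, mul_comm (m : ℤ),
        mul_comm (n : ℤ), huv, zpow_one]
    rw [hx, one_zpow, one_mul] at h2
    exact (congrArg (· ∈ Subgroup.zpowers (x * y)) h2).mpr (zpow_mem h1 v)
  · rw [Subgroup.zpowers_le]
    have h1 : y ^ m ∈ Subgroup.zpowers (x * y) := by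
      have := pow_mem h m
      rwa [mul_pow, hx, one_mul] at this
    obtain ⟨u, v, huv⟩ := Nat.Coprime.isCoprime hmn
    have h2 : y = (y ^ m) ^ u * (y ^ n) ^ v := by
      rw [← zpow_natCast, ← zpow_natCast, ← zpow_mul, ← zpow_mul, ← zpow_add, mul_comm (m : ℤ),
        mul_comm (n : ℤ), huv, zpow_one]
    rw [hy, one_zpow, mul_one] at h2
    exact (congrArg (· ∈ Subgroup.zpowers (x * y)) h2).mpr (zpow_mem h1 u)

variable [Finite Γ]

/-- A finite abelian group is cyclic if its `p`-torsion subgroups have order at most `p`. -/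
theorem isCyclic_of_card_ker_le (h : ∀ p : ℕ, p.Prime →
    Nat.card (powMonoidHom p : Γ →* Γ).ker ≤ p) : IsCyclic Γ := by
  classical
  cases nonempty_fintype Γ
  have key : ∀ n : ℕ, n ≠ 0 → Nat.card (powMonoidHom n : Γ →* Γ).ker ≤ n := by
    intro n
    induction n using Nat.recOnMul with
    | zero => intro h0; exact absurd rfl h0
    | one =>
      intro _
      have : (powMonoidHom 1 : Γ →* Γ).ker = ⊥ := by
        ext x; simp [MonoidHom.mem_ker]
      rw [this, Subgroup.card_bot]
    | prime p hp => intro _; exact h p hp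
    | mul a b ha hb =>
      intro hab
      let f : (powMonoidHom (a * b) : Γ →* Γ).ker →* (powMonoidHom b : Γ →* Γ).ker :=
        ((powMonoidHom a).comp (Subgroup.subtype _)).codRestrict _ (fun x => by
          have h1 : (x : Γ) ^ (a * b) = 1 := x.2
          change ((x : Γ) ^ a) ^ b = 1
          rw [← pow_mul, h1])
      have h1 : Nat.card f.ker ≤ Nat.card (powMonoidHom a : Γ →* Γ).ker := by
        refine Nat.card_le_card_of_injective (fun x => ⟨x.1.1, ?_⟩) ?_
        · have : f x.1 = 1 := x.2
          exact congrArg Subtype.val this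
        · intro x y hxy
          exact Subtype.ext (Subtype.ext (congrArg
            (fun z : (powMonoidHom a : Γ →* Γ).ker => (z : Γ)) hxy))
      have h2 := f.ker.index_mul_card
      rw [Subgroup.index_ker] at h2
      refine h2.symm.le.trans ((Nat.mul_le_mul ((Subgroup.card_le_card_group _).trans (hb (right_ne_zero_of_mul hab)))
        (h1.trans (ha (left_ne_zero_of_mul hab)))).trans (mul_comm b a).le)
  refine isCyclic_of_card_pow_eq_one_le fun n hn => ?_
  refine le_trans (le_of_eq ?_) (key n hn.ne')
  rw [Nat.card_eq_fintype_card, Fintype.card_subtype]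
  congr 1
  ext x
  simp only [Finset.mem_filter_univ]
  rfl

theorem exists_pair_of_not_isCyclic (h : ¬ IsCyclic Γ) : ∃ p, p.Prime ∧ ∃ x₁ x₂ : Γ,
    orderOf x₁ = p ∧ orderOf x₂ = p ∧ x₂ ∉ Subgroup.zpowers x₁ := by
  by_contra! hc
  refine h (isCyclic_of_card_ker_le fun p hp => ?_)
  have := Fact.mk hp
  by_cases htriv : ∃ x₁ : Γ, x₁ ^ p = 1 ∧ x₁ ≠ 1
  · obtain ⟨x₁, h1, h1'⟩ := htriv
    have ho := orderOf_eq_prime h1 h1'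
    have hle : (powMonoidHom p : Γ →* Γ).ker ≤ Subgroup.zpowers x₁ := by
      intro x₂ hx₂
      have h2 : x₂ ^ p = 1 := hx₂
      by_cases h2' : x₂ = 1
      · rw [h2']; exact one_mem _
      · exact hc p hp x₁ x₂ ho (orderOf_eq_prime h2 h2')
    refine (Subgroup.card_le_of_le hle).trans ?_
    rw [Nat.card_zpowers, ho]
  · push Not at htriv
    have hbot : (powMonoidHom p : Γ →* Γ).ker = ⊥ := by
      rw [eq_bot_iff]
      exact fun x hx => Subgroup.mem_bot.mpr (htriv x hx)
    rw [hbot, Subgroup.card_bot]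
    exact hp.one_lt.le

theorem exists_orderOf_eq_of_not_isPGroup {p : ℕ} (h : ¬ IsPGroup p Γ) :
    ∃ q, q.Prime ∧ q ≠ p ∧ ∃ y : Γ, orderOf y = q := by
  by_contra! hc
  refine h (IsPGroup.of_card (n := (Nat.card Γ).primeFactorsList.length)
    (Nat.eq_prime_pow_of_unique_prime_dvd Nat.card_pos.ne' fun {d} hd hdc => ?_))
  have := Fact.mk hd
  obtain ⟨y, hy⟩ := exists_prime_orderOf_dvd_card' d hdc
  by_contra hdp
  exact hc d hd hdp y hy

omit [Finite Γ] in
theorem zpowers_sup_inf_pPart {p q : ℕ} (hp : p.Prime) (hq : q.Prime) (hpq : p ≠ q) {x y : Γ}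
    (hy : y ^ q = 1) : (Subgroup.zpowers x ⊔ Subgroup.zpowers y) ⊓ pPart Γ p =
      Subgroup.zpowers x ⊓ pPart Γ p := by
  refine le_antisymm ?_ (inf_le_inf_right _ le_sup_left)
  rintro z ⟨hz, hzp⟩
  refine ⟨?_, hzp⟩
  obtain ⟨a, ha, b, hb, rfl⟩ := Subgroup.mem_sup.mp hz
  refine mem_of_pow_mem_of_coprime (r := q) (s := p ^ (Nat.card Γ).factorization p)
    (Nat.Coprime.pow_right _ ((Nat.coprime_primes hq hp).mpr hpq.symm)) ?_ ?_
  · obtain ⟨n, rfl⟩ := Subgroup.mem_zpowers_iff.mp hb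
    have : (y ^ n) ^ q = 1 := by rw [← zpow_natCast, zpow_comm, zpow_natCast, hy, one_zpow]
    rw [mul_pow, this, mul_one]
    exact pow_mem ha q
  · rw [mem_pPart.mp hzp]
    exact one_mem _

variable {k : Type} [CommRing k] [IsOrderLike k]

/-- The decomposition into primary parts at `p` and `q` for `I = ⟨x₁, y⟩` cyclic of order `pq`. -/
theorem genClass_eq_add {p q : ℕ} (hp : p.Prime) (hq : q.Prime) (hpq : p ≠ q) {x₁ x₂ y : Γ}
    (hx₁ : orderOf x₁ = p) (hx₂ : orderOf x₂ = p) (hy : orderOf y = q) :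
    genClass k (Subgroup.zpowers x₁ ⊔ Subgroup.zpowers y) x₂ =
      genClass k (Subgroup.zpowers x₁) (x₂ * y) +
        shiftHom _ (primClass k q (Subgroup.zpowers x₁ ⊔ Subgroup.zpowers y) x₂) := by
  have hcop : p.Coprime q := (Nat.coprime_primes hp hq).mpr hpq
  have h1 : x₁ ^ p = 1 := hx₁ ▸ pow_orderOf_eq_one x₁
  have h2 : x₂ ^ p = 1 := hx₂ ▸ pow_orderOf_eq_one x₂
  have h3 : y ^ q = 1 := hy ▸ pow_orderOf_eq_one y
  have hcard : Nat.card (Subgroup.zpowers x₁ ⊔ Subgroup.zpowers y : Subgroup Γ) = p * q := by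
    rw [← zpowers_mul_eq_sup hcop h1 h3, Nat.card_zpowers,
      (Commute.all x₁ y).orderOf_mul_eq_mul_orderOf_of_coprime (by rwa [hx₁, hy]), hx₁, hy]
  rw [genClass_eq_sum, hcard, Nat.primeFactors_mul hp.ne_zero hq.ne_zero, hp.primeFactors,
    hq.primeFactors, ← Finset.insert_eq, Finset.sum_pair hpq,
    genClass_eq_of_card_eq hp one_ne_zero (x₂ * y)
      (by rw [Nat.card_zpowers, hx₁, pow_one] : Nat.card (Subgroup.zpowers x₁) = p ^ 1)]
  congr 2
  refine primClass_congr hp (hcard ▸ dvd_mul_right p q) ?_ (zpowers_sup_inf_pPart hp hq hpq h3) ?_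
  · rw [Nat.card_zpowers, hx₁]
  · rw [decomp, decomp, zpowers_mul_eq_sup hcop h2 h3, sup_assoc, sup_comm (Subgroup.zpowers y)]

/-- For `p ≠ q`, the only subgroup of prime order of `⟨x⟩ × ⟨y⟩` that is not contained in `⟨x⟩` is
`⟨y⟩`. -/
theorem eq_zpowers_of_le_sup {p q ℓ : ℕ} (hp : p.Prime) (hq : q.Prime) (hpq : p ≠ q)
    (hℓ : ℓ.Prime) {x y : Γ} (hx : orderOf x = p) (hy : orderOf y = q) {U : Subgroup Γ}
    (hU : Nat.card U = ℓ) (hle : U ≤ Subgroup.zpowers x ⊔ Subgroup.zpowers y)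
    (hnle : ¬ U ≤ Subgroup.zpowers x) : ℓ = q ∧ U = Subgroup.zpowers y := by
  have hcop : p.Coprime q := (Nat.coprime_primes hp hq).mpr hpq
  have h1 : x ^ p = 1 := hx ▸ pow_orderOf_eq_one x
  have h3 : y ^ q = 1 := hy ▸ pow_orderOf_eq_one y
  have hUp : ∀ u ∈ U, u ^ ℓ = 1 := fun u hu => by
    have : (⟨u, hu⟩ : U) ^ Nat.card U = 1 := pow_card_eq_one'
    rw [hU] at this
    exact congrArg Subtype.val this
  -- an element of the sum killed by a power prime to `q` (to `p`) lies in the first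
  -- (the second) summand
  have key : ∀ (x y : Γ) (q : ℕ), y ^ q = 1 → q.Coprime ℓ →
      U ≤ Subgroup.zpowers x ⊔ Subgroup.zpowers y → U ≤ Subgroup.zpowers x := by
    intro x y q hy hc hle u hu
    refine mem_of_pow_mem_of_coprime hc ?_ (by rw [hUp u hu]; exact one_mem _)
    obtain ⟨a, ha, b, hb, rfl⟩ := Subgroup.mem_sup.mp (hle hu)
    obtain ⟨n, rfl⟩ := Subgroup.mem_zpowers_iff.mp hb
    have : (y ^ n) ^ q = 1 := by rw [← zpow_natCast, zpow_comm, zpow_natCast, hy, one_zpow]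
    rw [mul_pow, this, mul_one]
    exact pow_mem ha q
  have hℓq : ℓ = q := by
    by_contra hne
    exact hnle (key x y q h3 ((Nat.coprime_primes hq hℓ).mpr (Ne.symm hne)) hle)
  refine ⟨hℓq, ?_⟩
  refine Subgroup.eq_of_le_of_card_ge (key y x p h1 (hℓq ▸ hcop) (by rwa [sup_comm])) ?_
  rw [Nat.card_zpowers, hy, hU, hℓq]

theorem exists_le_card_eq {ℓ : ℕ} (hℓ : ℓ.Prime) {I : Subgroup Γ} (h : ℓ ∣ Nat.card I) :
    ∃ U ≤ I, Nat.card U = ℓ := by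
  have := Fact.mk hℓ
  obtain ⟨x, hx⟩ := exists_prime_orderOf_dvd_card' ℓ h
  refine ⟨Subgroup.zpowers (x : Γ), Subgroup.zpowers_le.mpr x.2, ?_⟩
  rw [Nat.card_zpowers, Subgroup.orderOf_coe, hx]

omit [Finite Γ] in
theorem exists_prime_dvd_card {I : Subgroup Γ} (h : I ≠ ⊥) : ∃ ℓ, ℓ.Prime ∧ ℓ ∣ Nat.card I :=
  ⟨_, Nat.minFac_prime fun hc => h (Subgroup.eq_bot_of_card_eq _ hc), Nat.minFac_dvd _⟩

omit [Finite Γ] in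
/-- If `D / I` is cyclic and `I` has no element of order `p`, then `D` has at most one subgroup of
order `p`. -/
theorem mem_zpowers_of_mem_decomp {p : ℕ} (hp : p.Prime) {I : Subgroup Γ} {g x₁ x₂ : Γ}
    (hI : ¬ p ∣ Nat.card I) (hx₁ : orderOf x₁ = p) (hx₂ : orderOf x₂ = p)
    (h₁ : x₁ ∈ decomp I g) (h₂ : x₂ ∈ decomp I g) : x₂ ∈ Subgroup.zpowers x₁ := by
  have h1 : x₁ ^ p = 1 := hx₁ ▸ pow_orderOf_eq_one x₁
  have h2 : x₂ ^ p = 1 := hx₂ ▸ pow_orderOf_eq_one x₂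
  have := Fact.mk hp
  -- an element of `I` killed by `p` is trivial
  have hIp : ∀ z ∈ I, z ^ p = 1 → z = 1 := by
    intro z hz hzp
    refine Subgroup.mem_bot.mp (mem_of_pow_mem_of_coprime (U := ⊥) (r := p) (s := Nat.card I)
      ((Nat.Prime.coprime_iff_not_dvd hp).mpr hI) (Subgroup.mem_bot.mpr hzp) ?_)
    have : (⟨z, hz⟩ : I) ^ Nat.card I = 1 := pow_card_eq_one'
    exact Subgroup.mem_bot.mpr (congrArg Subtype.val this)
  obtain ⟨i₁, hi₁, t₁, ht₁, e₁⟩ := Subgroup.mem_sup.mp h₁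
  obtain ⟨a, rfl⟩ := Subgroup.mem_zpowers_iff.mp ht₁
  obtain ⟨i₂, hi₂, t₂, ht₂, e₂⟩ := Subgroup.mem_sup.mp h₂
  obtain ⟨b, rfl⟩ := Subgroup.mem_zpowers_iff.mp ht₂
  -- `x₁ ^ b` and `x₂ ^ a` agree modulo `I`
  have hrel : ∀ m n : ℤ, a * m = b * n → x₁ ^ m = x₂ ^ n := by
    intro m n hmn
    have h3 : x₁ ^ m * (x₂ ^ n)⁻¹ = 1 := by
      refine hIp _ ?_ ?_
      · have : x₁ ^ m * (x₂ ^ n)⁻¹ = i₁ ^ m * (i₂ ^ n)⁻¹ := by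
          rw [← e₁, ← e₂, mul_zpow, mul_zpow, ← zpow_mul, ← zpow_mul, hmn, mul_inv,
            mul_mul_mul_comm, mul_inv_cancel, mul_one]
        rw [this]
        exact mul_mem (zpow_mem hi₁ m) (inv_mem (zpow_mem hi₂ n))
      · rw [mul_pow, inv_pow, ← zpow_natCast, ← zpow_natCast, zpow_comm, zpow_comm x₂,
          zpow_natCast, zpow_natCast, h1, h2, one_zpow, one_zpow, inv_one, mul_one]
    exact mul_inv_eq_one.mp h3
  have ha0 : a ≠ 0 := by
    intro ha0
    have h3 := hrel 1 0 (by rw [ha0]; ring)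
    rw [zpow_zero, zpow_one] at h3
    rw [h3, orderOf_one] at hx₁
    exact hp.one_lt.ne hx₁
  obtain ⟨a', b', hab, ha', hb'⟩ := Int.exists_gcd_one (Int.gcd_pos_of_ne_zero_left b ha0)
  have h3 := hrel b' a' (by
    calc a * b' = a' * (Int.gcd a b : ℤ) * b' := by rw [← ha']
      _ = b' * (Int.gcd a b : ℤ) * a' := by ring
      _ = b * a' := by rw [← hb'])
  have hpa : ¬ (p : ℤ) ∣ a' := by
    intro hpa
    have h4 : x₂ ^ a' = 1 := orderOf_dvd_iff_zpow_eq_one.mp (hx₂ ▸ hpa)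
    rw [h4] at h3
    have h5 : (p : ℤ) ∣ b' := hx₁ ▸ orderOf_dvd_iff_zpow_eq_one.mpr h3
    have h6 := Int.dvd_coe_gcd hpa h5
    rw [hab] at h6
    have h7 : p ∣ 1 := by exact_mod_cast h6
    exact hp.one_lt.ne' (Nat.dvd_one.mp h7)
  obtain ⟨u, v, huv⟩ := ((Nat.prime_iff_prime_int.mp hp).coprime_iff_not_dvd).mpr hpa
  have h4 : x₂ = (x₂ ^ p) ^ u * (x₂ ^ a') ^ v := by
    rw [← zpow_natCast, ← zpow_mul, ← zpow_mul, ← zpow_add, mul_comm (p : ℤ), mul_comm a', huv,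
      zpow_one]
  rw [h2, one_zpow, one_mul, ← h3] at h4
  rw [h4]
  exact zpow_mem (zpow_mem (Subgroup.mem_zpowers x₁) _) _

/-- In a free commutative monoid, let `b` and `b'` have no common summand other than `0`. Comparison
of coordinates in the relation `a + b' = a' + b` shows that `b` is a summand of `a`. -/
theorem exists_eq_add_of_free {M : Type*} [AddCommMonoid M] [Module.Free ℕ M] {a b a' b' : M}
    (h : a + b' = a' + b)
    (h0 : ∀ d, (∃ c, b = d + c) → (∃ c, b' = d + c) → d = 0) : ∃ c, a = c + b := by
  let e := (Module.Free.chooseBasis ℕ M).repr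
  have h1 : e b ⊓ e b' = 0 := by
    have h2 := h0 (e.symm (e b ⊓ e b')) ⟨e.symm (e b - e b ⊓ e b'), ?_⟩
      ⟨e.symm (e b' - e b ⊓ e b'), ?_⟩
    · simpa using h2
    · rw [← map_add, add_tsub_cancel_of_le inf_le_left, LinearEquiv.symm_apply_apply]
    · rw [← map_add, add_tsub_cancel_of_le inf_le_right, LinearEquiv.symm_apply_apply]
  have h3 : e b ≤ e a := by
    intro i
    have h4 := DFunLike.congr_fun h1 i
    have h5 := DFunLike.congr_fun (congrArg e h) i
    rw [map_add, map_add, Finsupp.add_apply, Finsupp.add_apply] at h5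
    rw [Finsupp.inf_apply, Finsupp.zero_apply] at h4
    rcases min_eq_iff.mp h4 with h6 | h6 <;> omega
  refine ⟨e.symm (e a - e b), ?_⟩
  apply e.injective
  rw [map_add, LinearEquiv.apply_symm_apply, tsub_add_cancel_of_le h3]

/-- The values of the invariants attached to the subgroups `U` of prime order. -/
theorem tateInv_genClass (ℓ : ℕ) [Fact ℓ.Prime] {U : Subgroup Γ} (hU : Nat.card U = ℓ)
    (V I : Subgroup Γ) (g : Γ) : (open Classical in
    tateInv k ℓ (ℓ ^ 0) U V (genClass k I g) = if U ≤ I then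
      padicValNat ℓ (Nat.card (k ⧸ Ideal.span {(ℓ : k)})) * (V ⊔ decomp I g).index else 0) := by
  have hU' : Nat.card U = ℓ ^ (0 + 1) := by rw [hU, zero_add, pow_one]
  split_ifs with h
  · exact tateInv_genClass_of_le ℓ 0 V g hU' h
  · exact tateInv_genClass_of_not_le ℓ 0 V g hU' h

theorem exists_multiset_genClass {c : SimClass (MonoidAlgebra k Γ)} (hc : c ∈ Zadm k Γ) :
    ∃ l : Multiset (SimClass (MonoidAlgebra k Γ)),
      (∀ m ∈ l, ∃ (I : Subgroup Γ) (g : Γ), I ≠ ⊥ ∧ m = genClass k I g) ∧ l.sum = c := by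
  rw [Zadm_eq_closure] at hc
  obtain ⟨l, hl, hlc⟩ := AddSubmonoid.exists_multiset_of_mem_closure hc
  refine ⟨l, fun m hm => ?_, hlc⟩
  obtain ⟨I, g, h1, -, h2⟩ := hl m hm
  exact ⟨I, g, h1, h2⟩

/-- For `x₁`, `x₂` of order `p` that generate different subgroups and `y` of order `q ≠ p`, let `a` and
`b` be the classes for `I = ⟨x₁, y⟩`, `φ = x₂` and for `I = ⟨x₁⟩`, `φ = x₂ y`, and let `a'` and `b'` be
the classes with `x₁` and `x₂` exchanged. Then `a = b + c` and `a' = b' + c` with the same `q`-primary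
class `c`, hence `a + b' = a' + b`. If the monoid were free, `b` would have an admissible complement in
`a`. The invariants force such a complement to be a single generator with `p` prime to `#I` and
`x₁, x₂ ∈ D`, although `D / I` is cyclic. -/
theorem not_free
    (hr : ∀ p, p.Prime → p ∣ Nat.card Γ → padicValNat p (Nat.card (k ⧸ Ideal.span {(p : k)})) ≠ 0)
    (h : ¬ (IsCyclic Γ ∨ ∃ p : ℕ, p.Prime ∧ IsPGroup p Γ)) :
    ¬ Module.Free ℕ (Zadm k Γ) := by
  classical
  intro hfree
  push Not at h
  obtain ⟨p, hp, x₁, x₂, hx₁, hx₂, hx⟩ := exists_pair_of_not_isCyclic h.1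
  obtain ⟨q, hq, hqp, y, hy⟩ := exists_orderOf_eq_of_not_isPGroup (h.2 p hp)
  have hpq := hqp.symm
  have hcop : p.Coprime q := (Nat.coprime_primes hp hq).mpr hpq
  let X₁ := Subgroup.zpowers x₁
  let X₂ := Subgroup.zpowers x₂
  let Y := Subgroup.zpowers y
  have hX₁ : Nat.card X₁ = p := by rw [Nat.card_zpowers, hx₁]
  have hX₂ : Nat.card X₂ = p := by rw [Nat.card_zpowers, hx₂]
  have hY : Nat.card Y = q := by rw [Nat.card_zpowers, hy]
  have hrr : ∀ (ℓ : ℕ) (U : Subgroup Γ), ℓ.Prime → Nat.card U = ℓ →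
      padicValNat ℓ (Nat.card (k ⧸ Ideal.span {(ℓ : k)})) ≠ 0 := fun ℓ U hℓ hU =>
    hr ℓ hℓ (hU ▸ Subgroup.card_subgroup_dvd_card U)
  have ne_bot : ∀ {U : Subgroup Γ} {ℓ : ℕ}, ℓ.Prime → Nat.card U = ℓ → U ≠ ⊥ := by
    intro U ℓ hℓ hU hbot
    rw [hbot, Subgroup.card_bot] at hU
    exact hℓ.one_lt.ne hU
  have hcyc : ∀ x : Γ, orderOf x = p → IsElementary (Subgroup.zpowers x ⊔ Y : Subgroup Γ) := by
    intro x hx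
    rw [← zpowers_mul_eq_sup hcop (hx ▸ pow_orderOf_eq_one x) (hy ▸ pow_orderOf_eq_one y)]
    exact isElementary_of_isCyclic inferInstance
  let a := genClass k (X₁ ⊔ Y) x₂
  let b := genClass k X₁ (x₂ * y)
  let a' := genClass k (X₂ ⊔ Y) x₁
  let b' := genClass k X₂ (x₁ * y)
  have ha : a ∈ Zadm k Γ := by
    rw [Zadm_eq_closure]
    refine AddSubmonoid.subset_closure ⟨X₁ ⊔ Y, x₂, fun h0 => ne_bot hp hX₁ ?_, hcyc x₁ hx₁, rfl⟩
    exact eq_bot_iff.mpr (le_sup_left.trans h0.le)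
  have ha' : a' ∈ Zadm k Γ := by
    rw [Zadm_eq_closure]
    refine AddSubmonoid.subset_closure ⟨X₂ ⊔ Y, x₁, fun h0 => ne_bot hp hX₂ ?_, hcyc x₂ hx₂, rfl⟩
    exact eq_bot_iff.mpr (le_sup_left.trans h0.le)
  have hb : b ∈ Zadm k Γ := by
    rw [Zadm_eq_closure]
    exact AddSubmonoid.subset_closure ⟨X₁, x₂ * y, ne_bot hp hX₁,
      isElementary_of_isCyclic inferInstance, rfl⟩
  have hb' : b' ∈ Zadm k Γ := by
    rw [Zadm_eq_closure]
    exact AddSubmonoid.subset_closure ⟨X₂, x₁ * y, ne_bot hp hX₂,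
      isElementary_of_isCyclic inferInstance, rfl⟩
  have hq_dvd : ∀ x : Γ, q ∣ Nat.card (Subgroup.zpowers x ⊔ Y : Subgroup Γ) := fun x =>
    hY ▸ Subgroup.card_dvd_of_le le_sup_right
  have hprim : primClass k q (X₁ ⊔ Y) x₂ = primClass k q (X₂ ⊔ Y) x₁ := by
    refine primClass_congr hq (hq_dvd x₁) (hq_dvd x₂) ?_ ?_
    · rw [sup_comm X₁, sup_comm X₂,
        zpowers_sup_inf_pPart hq hp hqp (hx₁ ▸ pow_orderOf_eq_one x₁),
        zpowers_sup_inf_pPart hq hp hqp (hx₂ ▸ pow_orderOf_eq_one x₂)]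
    · rw [decomp, decomp]
      change X₁ ⊔ Y ⊔ X₂ = X₂ ⊔ Y ⊔ X₁
      rw [sup_comm, ← sup_assoc, sup_right_comm]
  have hrel : a + b' = a' + b := by
    change genClass k (X₁ ⊔ Y) x₂ + b' = genClass k (X₂ ⊔ Y) x₁ + b
    rw [genClass_eq_add hp hq hpq hx₁ hx₂ hy, genClass_eq_add hp hq hpq hx₂ hx₁ hy]
    change b + shiftHom _ (primClass k q (X₁ ⊔ Y) x₂) + b' =
      b' + shiftHom _ (primClass k q (X₂ ⊔ Y) x₁) + b
    rw [hprim]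
    abel
  -- every summand of an admissible class is detected by a subgroup of prime order
  have detect : ∀ (I : Subgroup Γ) (g : Γ) (ℓ : ℕ) [Fact ℓ.Prime] (U : Subgroup Γ),
      Nat.card U = ℓ → U ≤ I → tateInv k ℓ (ℓ ^ 0) U ⊤ (genClass k I g) =
        padicValNat ℓ (Nat.card (k ⧸ Ideal.span {(ℓ : k)})) := by
    intro I g ℓ _ U hU hle
    rw [tateInv_genClass ℓ hU, if_pos hle, top_sup_eq, Subgroup.index_top, mul_one]
  have le_sum : ∀ (l : Multiset (SimClass (MonoidAlgebra k Γ))) (m) (ℓ : ℕ) [Fact ℓ.Prime]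
      (U V : Subgroup Γ), m ∈ l →
      tateInv k ℓ (ℓ ^ 0) U V m ≤ tateInv k ℓ (ℓ ^ 0) U V l.sum := by
    intro l m ℓ _ U V hm
    obtain ⟨l', rfl⟩ := Multiset.exists_cons_of_mem hm
    rw [Multiset.sum_cons, map_add]
    exact Nat.le_add_right _ _
  have eq_zero : ∀ c ∈ Zadm k Γ, (∀ (ℓ : ℕ) [Fact ℓ.Prime] (U : Subgroup Γ), Nat.card U = ℓ →
      tateInv k ℓ (ℓ ^ 0) U ⊤ c = 0) → c = 0 := by
    intro c hc h0
    obtain ⟨l, hl, rfl⟩ := exists_multiset_genClass hc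
    rcases l.empty_or_exists_mem with rfl | ⟨m, hm⟩
    · rfl
    · obtain ⟨I, g, hI, rfl⟩ := hl m hm
      obtain ⟨ℓ, hℓ, hd⟩ := exists_prime_dvd_card hI
      obtain ⟨U, hUI, hU⟩ := exists_le_card_eq hℓ hd
      have := Fact.mk hℓ
      have h1 := le_sum l _ ℓ U ⊤ hm
      rw [h0 ℓ U hU, detect I g ℓ U hU hUI] at h1
      exact absurd (Nat.le_zero.mp h1) (hrr ℓ U hℓ hU)
  -- in a free monoid, the relation `a + b' = a' + b` would make `b` a summand of `a`
  obtain ⟨⟨c, hc⟩, hac⟩ := exists_eq_add_of_free (M := Zadm k Γ) (a := ⟨a, ha⟩) (b := ⟨b, hb⟩)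
    (a' := ⟨a', ha'⟩) (b' := ⟨b', hb'⟩) (Subtype.ext hrel) (by
      rintro ⟨d, hd⟩ ⟨⟨e, he⟩, h1⟩ ⟨⟨e', he'⟩, h2⟩
      have h1' : b = d + e := congrArg Subtype.val h1
      have h2' : b' = d + e' := congrArg Subtype.val h2
      refine Subtype.ext (eq_zero d hd fun ℓ _ U hU => ?_)
      have h3 := congrArg (tateInv k ℓ (ℓ ^ 0) U ⊤) h1'
      have h4 := congrArg (tateInv k ℓ (ℓ ^ 0) U ⊤) h2'
      rw [map_add] at h3 h4
      change tateInv k ℓ (ℓ ^ 0) U ⊤ (genClass k X₁ (x₂ * y)) = _ at h3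
      change tateInv k ℓ (ℓ ^ 0) U ⊤ (genClass k X₂ (x₁ * y)) = _ at h4
      rw [tateInv_genClass ℓ hU] at h3 h4
      by_cases hU1 : U ≤ X₁
      · by_cases hU2 : U ≤ X₂
        · exfalso
          have hℓ : ℓ.Prime := Fact.out
          have hℓp : ℓ = p := by
            have := Subgroup.card_dvd_of_le hU1
            rw [hU, hX₁] at this
            exact (Nat.prime_dvd_prime_iff_eq hℓ hp).mp this
          have h5 : U = X₁ := Subgroup.eq_of_le_of_card_ge hU1 (by rw [hU, hX₁, hℓp])
          have h6 : U = X₂ := Subgroup.eq_of_le_of_card_ge hU2 (by rw [hU, hX₂, hℓp])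
          apply hx
          change x₂ ∈ X₁
          rw [← h5, h6]
          exact Subgroup.mem_zpowers x₂
        · rw [if_neg hU2] at h4
          omega
      · rw [if_neg hU1] at h3
        omega)
  have hac' : a = c + b := congrArg Subtype.val hac
  have hval : ∀ (ℓ : ℕ) [Fact ℓ.Prime] (U V : Subgroup Γ), Nat.card U = ℓ →
      (if U ≤ X₁ ⊔ Y then padicValNat ℓ (Nat.card (k ⧸ Ideal.span {(ℓ : k)})) *
        (V ⊔ decomp (X₁ ⊔ Y) x₂).index else 0) = tateInv k ℓ (ℓ ^ 0) U V c +
      if U ≤ X₁ then padicValNat ℓ (Nat.card (k ⧸ Ideal.span {(ℓ : k)})) *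
        (V ⊔ decomp X₁ (x₂ * y)).index else 0 := by
    intro ℓ _ U V hU
    rw [← tateInv_genClass ℓ hU, ← tateInv_genClass ℓ hU, ← map_add]
    exact congrArg _ hac'
  obtain ⟨l, hl, rfl⟩ := exists_multiset_genClass hc
  have hsub : ∀ (m) (I : Subgroup Γ) (g : Γ) (ℓ : ℕ) (U : Subgroup Γ), m ∈ l →
      m = genClass k I g → ℓ.Prime → Nat.card U = ℓ → U ≤ I → ℓ = q ∧ U = Y := by
    intro m I g ℓ U hm hmI hℓ hU hle
    have := Fact.mk hℓ
    have h1 := le_sum l m ℓ U ⊤ hm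
    rw [hmI, detect I g ℓ U hU hle] at h1
    have h2 := hval ℓ U ⊤ hU
    rw [top_sup_eq, top_sup_eq, Subgroup.index_top, mul_one] at h2
    have h3 := hrr ℓ U hℓ hU
    refine eq_zpowers_of_le_sup hp hq hpq hℓ hx₁ hy hU ?_ ?_
    · by_contra hn
      rw [if_neg hn] at h2
      omega
    · intro hle1
      rw [if_pos (hle1.trans le_sup_left), if_pos hle1] at h2
      omega
  have hgen : ∀ m ∈ l, ∃ (I : Subgroup Γ) (g : Γ), m = genClass k I g ∧ Y ≤ I ∧
      ¬ p ∣ Nat.card I := by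
    intro m hm
    obtain ⟨I, g, hI, hmI⟩ := hl m hm
    refine ⟨I, g, hmI, ?_, fun hpI => ?_⟩
    · obtain ⟨ℓ, hℓ, hd⟩ := exists_prime_dvd_card hI
      obtain ⟨U, hUI, hU⟩ := exists_le_card_eq hℓ hd
      exact (hsub m I g ℓ U hm hmI hℓ hU hUI).2 ▸ hUI
    · obtain ⟨U, hUI, hU⟩ := exists_le_card_eq hp hpI
      exact hpq (hsub m I g p U hm hmI hp hU hUI).1
  have := Fact.mk hq
  have hYX : ¬ Y ≤ X₁ := by
    intro hle
    have h1 := Subgroup.card_dvd_of_le hle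
    rw [hY, hX₁] at h1
    exact hqp ((Nat.prime_dvd_prime_iff_eq hq hp).mp h1)
  have hvalY : ∀ V : Subgroup Γ, padicValNat q (Nat.card (k ⧸ Ideal.span {(q : k)})) *
      (V ⊔ decomp (X₁ ⊔ Y) x₂).index = tateInv k q (q ^ 0) Y V l.sum := by
    intro V
    have h1 := hval q Y V hY
    rwa [if_pos le_sup_right, if_neg hYX, add_zero] at h1
  have hrq := hrr q Y hq hY
  -- comparison with `V = Γ` shows that there is exactly one summand
  have hl1 : Multiset.card l = 1 := by
    have h0 : l.map (tateInv k q (q ^ 0) Y ⊤) =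
        l.map fun _ => padicValNat q (Nat.card (k ⧸ Ideal.span {(q : k)})) := by
      refine Multiset.map_congr rfl fun m hm => ?_
      obtain ⟨I, g, rfl, hYI, -⟩ := hgen m hm
      exact detect I g q Y hY hYI
    have h1 := hvalY ⊤
    rw [top_sup_eq, Subgroup.index_top, map_multiset_sum, h0, Multiset.map_const',
      Multiset.sum_replicate, smul_eq_mul, mul_comm] at h1
    exact (Nat.eq_of_mul_eq_mul_right (Nat.pos_of_ne_zero hrq) h1).symm
  obtain ⟨m, rfl⟩ := Multiset.card_eq_one.mp hl1
  obtain ⟨I, g, rfl, hYI, hpI⟩ := hgen m (Multiset.mem_singleton_self m)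
  have hindex : ∀ V : Subgroup Γ,
      (V ⊔ decomp (X₁ ⊔ Y) x₂).index = (V ⊔ decomp I g).index := by
    intro V
    have h1 := hvalY V
    rw [Multiset.sum_singleton, tateInv_genClass q hY, if_pos hYI] at h1
    exact Nat.eq_of_mul_eq_mul_left (Nat.pos_of_ne_zero hrq) h1
  have hD : decomp (X₁ ⊔ Y) x₂ ≤ decomp I g := by
    have h1 := hindex (decomp I g)
    rw [sup_idem] at h1
    refine sup_eq_left.mp (Subgroup.eq_of_le_of_card_ge le_sup_left (le_of_eq ?_)).symm
    have h2 := (decomp I g ⊔ decomp (X₁ ⊔ Y) x₂).index_mul_card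
    rw [h1, ← (decomp I g).index_mul_card] at h2
    exact Nat.eq_of_mul_eq_mul_left
      (Nat.pos_of_ne_zero Subgroup.index_ne_zero_of_finite) h2
  refine hx (mem_zpowers_of_mem_decomp hp hpI hx₁ hx₂ (hD ?_) (hD (mem_decomp _ _)))
  exact le_decomp _ _ (Subgroup.mem_sup_left (Subgroup.mem_zpowers x₁))

end NotFree

/-! ### The base rings -/

section BaseRings

/-- The order of `k / p` is divisible by `p` unless `p` is invertible in `k`. -/
theorem padicValNat_card_ne_zero {k : Type*} [CommRing k] [IsOrderLike k] {p : ℕ} (hp : p.Prime)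
    (h : ¬ IsUnit (p : k)) : padicValNat p (Nat.card (k ⧸ Ideal.span {(p : k)})) ≠ 0 := by
  have := IsOrderLike.finite_quotient (R := k) p hp.ne_zero
  have := Fact.mk hp
  have h1 : addOrderOf (1 : k ⧸ Ideal.span {(p : k)}) = p := by
    refine addOrderOf_eq_prime ?_ ?_
    · rw [nsmul_one, ← map_natCast (Ideal.Quotient.mk _), Ideal.Quotient.eq_zero_iff_mem]
      exact Ideal.mem_span_singleton_self _
    · rw [← map_one (Ideal.Quotient.mk _), Ne, Ideal.Quotient.eq_zero_iff_mem,
        ← Ideal.eq_top_iff_one, Ideal.span_singleton_eq_top]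
      exact h
  have h2 : p ∣ Nat.card (k ⧸ Ideal.span {(p : k)}) := by
    conv_lhs => rw [← h1]
    exact addOrderOf_dvd_natCard _
  exact Nat.one_le_iff_ne_zero.mp (one_le_padicValNat_of_dvd Nat.card_pos.ne' h2)

instance : IsOrderLike ℤ where
  natCast_mul_eq_zero t x ht h := (mul_eq_zero.mp h).resolve_left (by exact_mod_cast ht)
  finite_quotient t ht := by
    have : NeZero (t : ℤ).natAbs := ⟨by simpa using ht⟩
    exact Finite.of_equiv _ (Int.quotientSpanEquivZMod (t : ℤ)).symm.toEquiv

theorem not_isUnit_intCast {p : ℕ} (hp : p.Prime) : ¬ IsUnit (p : ℤ) := by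
  rw [Int.isUnit_iff_natAbs_eq, Int.natAbs_natCast]
  exact hp.ne_one

theorem finite_of_isUnit_two {A : Type*} [CommRing A] {t : ℕ} (ht : t ≠ 0) (htA : (t : A) = 0)
    (h2 : IsUnit (2 : A)) (h : ∀ x : A, ∃ (n : ℕ) (z : ℤ), x * ((2 : ℤ) : A) ^ n = z) :
    Finite A := by
  -- the odd part of `t` vanishes, so `2` is inverted by an integer
  have h3 : ((t / 2 ^ t.factorization 2 : ℕ) : A) = 0 := by
    have h4 : ((2 ^ t.factorization 2 * (t / 2 ^ t.factorization 2) : ℕ) : A) = 0 := by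
      rw [Nat.ordProj_mul_ordCompl_eq_self, htA]
    rw [Nat.cast_mul, Nat.cast_pow, Nat.cast_ofNat] at h4
    exact ((h2.pow _).mul_right_eq_zero).mp h4
  obtain ⟨u, v, huv⟩ := Nat.Coprime.isCoprime (Nat.coprime_ordCompl Nat.prime_two ht)
  have h5 : (u : A) * ((2 : ℤ) : A) = 1 := by
    have h6 := congrArg (Int.cast : ℤ → A) huv
    rw [Int.cast_add, Int.cast_mul, Int.cast_mul, Int.cast_natCast (t / _), h3, mul_zero,
      add_zero, Int.cast_one] at h6
    exact h6
  let F : ℤ ⧸ Ideal.span {(t : ℤ)} →+* A := Ideal.Quotient.lift _ (Int.castRingHom A) (by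
    intro a ha
    obtain ⟨c, rfl⟩ := Ideal.mem_span_singleton'.mp ha
    rw [map_mul, map_natCast, htA, mul_zero])
  have := IsOrderLike.finite_quotient (R := ℤ) t ht
  refine Finite.of_surjective F fun x => ?_
  obtain ⟨n, z, hz⟩ := h x
  refine ⟨Ideal.Quotient.mk _ (z * u ^ n), ?_⟩
  change ((z * u ^ n : ℤ) : A) = _
  rw [Int.cast_mul, ← hz, Int.cast_pow, mul_assoc, ← mul_pow, mul_comm _ (u : A), h5, one_pow,
    mul_one]

instance : IsOrderLike (Localization.Away (2 : ℤ)) where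
  natCast_mul_eq_zero t x ht h := by
    have hM : Submonoid.powers (2 : ℤ) ≤ nonZeroDivisors ℤ :=
      powers_le_nonZeroDivisors_of_noZeroDivisors two_ne_zero
    have hd : IsDomain (Localization.Away (2 : ℤ)) := IsLocalization.isDomain_localization hM
    refine (mul_eq_zero.mp h).resolve_left fun h0 => ht ?_
    have h1 : algebraMap ℤ (Localization.Away (2 : ℤ)) t = algebraMap ℤ _ 0 := by
      rw [map_natCast, h0, map_zero]
    exact_mod_cast IsLocalization.injective (Localization.Away (2 : ℤ)) hM h1
  finite_quotient t ht := by
    let k := Localization.Away (2 : ℤ)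
    let A := k ⧸ Ideal.span {(t : k)}
    have htA : (t : A) = 0 := by
      rw [← map_natCast (Ideal.Quotient.mk _), Ideal.Quotient.eq_zero_iff_mem]
      exact Ideal.mem_span_singleton_self _
    have h2 : IsUnit (2 : A) := by
      have h1 : IsUnit (algebraMap ℤ k 2) := IsLocalization.Away.algebraMap_isUnit (2 : ℤ)
      have h2 := h1.map (Ideal.Quotient.mk (Ideal.span {(t : k)}))
      rwa [map_ofNat, map_ofNat] at h2
    refine finite_of_isUnit_two ht htA h2 fun x => ?_
    obtain ⟨x, rfl⟩ := Ideal.Quotient.mk_surjective x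
    obtain ⟨n, z, hz⟩ := IsLocalization.Away.surj (2 : ℤ) x
    refine ⟨n, z, ?_⟩
    have h6 := congrArg (Ideal.Quotient.mk (Ideal.span {(t : k)})) hz
    rwa [map_mul, map_pow, eq_intCast, eq_intCast, map_intCast, map_intCast] at h6

theorem not_isUnit_natCast_away {p : ℕ} (hp : p.Prime) (hp2 : Odd p) :
    ¬ IsUnit (p : Localization.Away (2 : ℤ)) := by
  intro h
  have := Fact.mk hp
  have h2 : IsUnit (Int.castRingHom (ZMod p) 2) := by
    refine IsUnit.mk0 _ ?_
    rw [eq_intCast]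
    have h3 := (ZMod.isUnit_iff_coprime 2 p).mpr (Nat.coprime_two_left.mpr hp2)
    exact_mod_cast h3.ne_zero
  have h3 := h.map (IsLocalization.Away.lift (S := Localization.Away (2 : ℤ)) (2 : ℤ) h2)
  rw [map_natCast, ZMod.natCast_self] at h3
  exact not_isUnit_zero h3

end BaseRings

end AdmissibleClasses

theorem theorem1p3 (Γ : Type u) [CommGroup Γ] [Finite Γ] :
    Finite (AdmissibleClasses.TSet Γ) ∧
    ((IsCyclic Γ ∨ ∃ p : ℕ, p.Prime ∧ IsPGroup p Γ) →
      Nonempty (Module.Basis (AdmissibleClasses.TSet Γ) ℕ (AdmissibleClasses.Zadm ℤ Γ)) ∧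
      (Odd (Nat.card Γ) → Nonempty (Module.Basis (AdmissibleClasses.TSet Γ) ℕ
        (AdmissibleClasses.Zadm (Localization.Away (2 : ℤ)) Γ)))) ∧
    (¬ (IsCyclic Γ ∨ ∃ p : ℕ, p.Prime ∧ IsPGroup p Γ) →
      ¬ Module.Free ℕ (AdmissibleClasses.Zadm ℤ Γ) ∧
      (Odd (Nat.card Γ) →
        ¬ Module.Free ℕ (AdmissibleClasses.Zadm (Localization.Away (2 : ℤ)) Γ))) := by
  have hZ : ∀ p, p.Prime → p ∣ Nat.card Γ →
      padicValNat p (Nat.card (ℤ ⧸ Ideal.span {(p : ℤ)})) ≠ 0 := fun p hp _ =>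
    AdmissibleClasses.padicValNat_card_ne_zero hp (AdmissibleClasses.not_isUnit_intCast hp)
  have hA : Odd (Nat.card Γ) → ∀ p, p.Prime → p ∣ Nat.card Γ →
      padicValNat p (Nat.card (Localization.Away (2 : ℤ) ⧸
        Ideal.span {(p : Localization.Away (2 : ℤ))})) ≠ 0 := fun hodd p hp hd =>
    AdmissibleClasses.padicValNat_card_ne_zero hp (AdmissibleClasses.not_isUnit_natCast_away hp
      (hodd.of_dvd_nat hd))
  exact ⟨inferInstance, fun h => ⟨AdmissibleClasses.nonempty_basis hZ h, fun hodd => AdmissibleClasses.nonempty_basis (hA hodd) h⟩,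
    fun h => ⟨AdmissibleClasses.not_free hZ h, fun hodd => AdmissibleClasses.not_free (hA hodd) h⟩⟩
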